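/- **Setting.** Let $n\ge 1$ and let $M\subset\mathbb R^{n+1}$ be a compact, path-connected $n$-dimensional $C^\infty$-submanifold (orientable or not), possibly with non-empty smooth boundary $\partial M$. Let $\operatorname{Emb}_{\partial M}$ be the set of $C^\infty$-embeddings (smooth injective immersions) $\varphi:M\to\mathbb R^{n+1}$ with $\varphi(p)=p$ for $p\in\partial M$. Let $\mathrm ds$ denote $n$-dimensional surface measure. For $\varphi\in\operatorname{Emb}_{\partial M}$ and $p\in M$ let $D^\tau\varphi(p)$ be the $n\times n$ matrix with entries $\langle D\varphi\,\tau_j(p),\tau_i^\varphi(\varphi(p))\rangle$, where $\tau(p)$ is an orthonormal basis of $T_pM$ and $\tau^\varphi(\varphi(p))$ is an orthonormal basis of $T_{\varphi(p)}\varphi(M)$ which is positively oriented with respect to the orientation carried over by $\varphi$, so that $\det D^\tau\varphi(p)>0$. Put $\det D^\tau\varphi^{-1}:=\frac{1}{\det D^\tau\varphi}\circ\varphi^{-1}$ on $\varphi(M)$. Let $g^M:M\to(0,\infty)$ be $C^\infty$, and for every $\varphi\in\operatorname{Emb}_{\partial M}$ let $f_\varphi:\varphi(M)\to(0,\infty)$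 be $C^\infty$, such that * (shape functionality) $f_{\varphi\circ\rho}=f_\varphi$ for all $\varphi\in\operatorname{Emb}_{\partial M}$ and all $C^\infty$-diffeomorphisms $\rho$ of $M$ with $\varphi\circ\rho\in\operatorname{Emb}_{\partial M}$; * (normalization) $\int_{\varphi(M)}f_\varphi\,\mathrm ds=\int_M g^M\,\mathrm ds$ for all $\varphi\in\operatorname{Emb}_{\partial M}$; * (regular dependence on $\varphi$) whenever $U\subseteq\mathbb R^k$ is open, $c:U\times M\to\mathbb R^{n+1}$ is $C^\infty$ and $c_s:=c(s,\cdot)\in\operatorname{Emb}_{\partial M}$ for all $s\in U$, the function $(s,p)\mapsto f_{c_s}(c_s(p))$ is $C^1$ on $U\times M$. The parameterization tracking problem is to minimize over $\varphi\in\operatorname{Emb}_{\partial M}$ the functional $$\mathfrak J^\tau(\varphi)=\frac12\int_{\varphi(M)}\Big(g^M\circ\varphi^{-1}\cdot\det D^\tau\varphi^{-1}-f_\varphi\Big)^2\,\mathrm ds .$$ Let $C^\infty_{\partial M}$ be the space of $V\in C^\infty(\mathbb R^{n+1},\mathbb R^{n+1})$ with $V|_{\partial M}=0$. The pre-shape derivative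 is $$\mathfrak D\mathfrak J^\tau(\varphi)[V]=\lim_{t\downarrow0}\frac{\mathfrak J^\tau(\varphi+t\,V\circ\varphi)-\mathfrak J^\tau(\varphi)}{t},$$ and its normal component is $\langle g^{\mathcal N}_\varphi,V\rangle:=\mathfrak D\mathfrak J^\tau(\varphi)[\langle V,n\rangle n]$, the same limit with $V\circ\varphi$ replaced by the normal part of $V$ on $\varphi(M)$, where $n$ is a unit normal of $\varphi(M)$. **Proposition (Characterization of global solutions by fiber stationarity).** For every $\varphi\in\operatorname{Emb}_{\partial M}$ and every such choice of frames, the following are equivalent (where "the derivative vanishes" includes the existence of the limit): 1. (fiber stationarity) $\mathfrak D\mathfrak J^\tau(\varphi)[V]=0$ for all $V\in C^\infty_{\partial M}$ with $\langle V,n\rangle=0$ on the interior of $\varphi(M)$; 2. (a) $\varphi$ is a global minimizer of $\mathfrak J^\tau$ over $\operatorname{Emb}_{\partial M}$; equivalently (b) $g^M\circ\varphi^{-1}\cdot\det D^\tau\varphi^{-1}=f_\varphi$ on $\varphi(M)$; 3. $\mathfrak D\mathfrak J^\tau(\varphi)[V]=0$ for all $V\in C^\infty_{\partial M}$, and in addition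 the normal component vanishes: $\langle g^{\mathcal N}_\varphi,V\rangle=0$ for all $V\in C^\infty_{\partial M}$. In particular, the first order condition in directions tangential to $\varphi(M)$ is already sufficient for $\varphi$ to be a global minimizer of $\mathfrak J^\tau$. -/

import Mathlib

open Set Filter Topology MeasureTheory
open scoped Manifold ContDiff RealInnerProductSpace

noncomputable section

namespace PreShape

/-- The ambient Euclidean space `ℝ^{n+1}`. -/
abbrev Amb (n : ℕ) : Type := EuclideanSpace ℝ (Fin (n + 1))

/-- The differential `Dφ(p) : T_pM → ℝ^{n+1}` of a map `φ : M → ℝ^{n+1}`, where `M` is a manifold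
with (possibly empty) boundary. -/
def diff {n : ℕ} [NeZero n] {M : Set (Amb n)} [ChartedSpace (EuclideanHalfSpace n) M]
    (φ : M → Amb n) (p : M) : TangentSpace (𝓡∂ n) p →L[ℝ] Amb n :=
  mfderiv (𝓡∂ n) 𝓘(ℝ, Amb n) φ p

/-- `φ` is a `C^∞`-embedding: a smooth injective immersion (`M` will be compact). -/
structure IsEmb {n : ℕ} [NeZero n] {M : Set (Amb n)} [ChartedSpace (EuclideanHalfSpace n) M]
    (φ : M → Amb n) : Prop where
  smooth : ContMDiff (𝓡∂ n) 𝓘(ℝ, Amb n) ∞ φ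
  injective : Function.Injective φ
  immersion : ∀ p : M, Function.Injective (diff φ p)

/-- A compact path-connected `n`-dimensional `C^∞`-submanifold `M ⊆ ℝ^{n+1}`, possibly with smooth
boundary: the subset `M` carries a smooth structure (modelled on the half space) for
which the inclusion into `ℝ^{n+1}` is a smooth embedding. -/
structure IsCompactSubmanifold {n : ℕ} [NeZero n] (M : Set (Amb n))
    [ChartedSpace (EuclideanHalfSpace n) M] : Prop where
  isManifold : IsManifold (𝓡∂ n) ∞ M
  inclusion : IsEmb (fun p : M => (p : Amb n))
  compact : IsCompact M
  pathConnected : IsPathConnected M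

/-- The pre-shape space `Emb_{∂M}(M, ℝ^{n+1})`: embeddings that fix `∂M` pointwise. -/
structure IsPreShape {n : ℕ} [NeZero n] {M : Set (Amb n)} [ChartedSpace (EuclideanHalfSpace n) M]
    (φ : M → Amb n) : Prop where
  isEmb : IsEmb φ
  fixes_boundary : ∀ p : M, p ∈ (𝓡∂ n).boundary M → φ p = p

/-! ### Orthonormal frames and the covariant derivative -/

/-- The matrix `D^τ φ (p)`, with entries `⟪Dφ τ_j(p), τ^φ_i(φ(p))⟫`. -/
def covMatrix {n : ℕ} [NeZero n] {M : Set (Amb n)} [ChartedSpace (EuclideanHalfSpace n) M]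
    (τ : (p : M) → Fin n → TangentSpace (𝓡∂ n) p) (τφ : Amb n → Fin n → Amb n)
    (φ : M → Amb n) (p : M) : Matrix (Fin n) (Fin n) ℝ :=
  Matrix.of fun i j => ⟪diff φ p (τ p j), τφ (φ p) i⟫

/-- `τ(p)` is, at every `p ∈ M`, an orthonormal basis of `T_pM` for the metric induced by the
Euclidean metric of `ℝ^{n+1}`. No regularity of `p ↦ τ(p)` is required, so that local frames may
be patched together. -/
def IsFrame {n : ℕ} [NeZero n] {M : Set (Amb n)} [ChartedSpace (EuclideanHalfSpace n) M]
    (τ : (p : M) → Fin n → TangentSpace (𝓡∂ n) p) : Prop :=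
  ∀ p : M, Orthonormal ℝ fun i => diff (fun q : M => (q : Amb n)) p (τ p i)

/-- `τφ(s)` is, at every `s = φ(p) ∈ φ(M)`, an orthonormal basis of `T_{φ(p)} φ(M) = range Dφ(p)`,
positively oriented with respect to the orientation that `φ` carries over from the frame `τ`. -/
structure IsImageFrame {n : ℕ} [NeZero n] {M : Set (Amb n)}
    [ChartedSpace (EuclideanHalfSpace n) M]
    (τ : (p : M) → Fin n → TangentSpace (𝓡∂ n) p) (φ : M → Amb n)
    (τφ : Amb n → Fin n → Amb n) : Prop where
  orthonormal : ∀ p : M, Orthonormal ℝ (τφ (φ p))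
  tangent : ∀ (p : M) (i : Fin n), ∃ v : TangentSpace (𝓡∂ n) p, diff φ p v = τφ (φ p) i
  oriented : ∀ p : M, 0 < (covMatrix τ τφ φ p).det

/-- The function `g^M ∘ φ⁻¹ · (1 / det D^τ φ) ∘ φ⁻¹ = g^M ∘ φ⁻¹ · det D^τ φ⁻¹` on `φ(M)` (with the
junk value `0` off `φ(M)`). -/
def nodeDensity {n : ℕ} [NeZero n] {M : Set (Amb n)} [ChartedSpace (EuclideanHalfSpace n) M]
    (g : M → ℝ) (τ : (p : M) → Fin n → TangentSpace (𝓡∂ n) p) (τφ : Amb n → Fin n → Amb n)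
    (φ : M → Amb n) : Amb n → ℝ :=
  Function.extend φ (fun p => g p * (1 / (covMatrix τ τφ φ p).det)) 0

/-- The objective functional of the parameterization tracking problem,
`𝔍(φ) = ½ ∫_{φ(M)} (g^M ∘ φ⁻¹ · (1 / det D^τ φ) ∘ φ⁻¹ - f_φ)² ds`. The surface measure is the
Hausdorff measure `μHE[n]`, normalized to agree with Lebesgue measure on `ℝ^n`. -/
def objective {n : ℕ} [NeZero n] {M : Set (Amb n)} [ChartedSpace (EuclideanHalfSpace n) M]
    (g : M → ℝ) (f : (M → Amb n) → Amb n → ℝ)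
    (τ : (p : M) → Fin n → TangentSpace (𝓡∂ n) p) (τφ : (M → Amb n) → Amb n → Fin n → Amb n)
    (φ : M → Amb n) : ℝ :=
  1 / 2 * ∫ s in range φ, (nodeDensity g τ (τφ φ) φ s - f φ s) ^ 2 ∂μHE[n]

/-! ### Assumptions on the targets -/

/-- The family `f_φ : φ(M) → ℝ` depends on `φ` in a `C^1` fashion: along each smooth
finite-dimensional family of pre-shapes `(c_s)_{s ∈ U}`, the function `(s, p) ↦ f_{c_s}(c_s(p))` is
`C^1` on `U × M`. For `c_t = φ + t • V ∘ φ` the derivative of this function with respect to `t`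
at `t = 0` is the material derivative of `f` in direction `V`. -/
def DependsC1 {n : ℕ} [NeZero n] {M : Set (Amb n)} [ChartedSpace (EuclideanHalfSpace n) M]
    (f : (M → Amb n) → Amb n → ℝ) : Prop :=
  ∀ (k : ℕ) (U : Set (EuclideanSpace ℝ (Fin k))) (c : EuclideanSpace ℝ (Fin k) → M → Amb n),
    IsOpen U →
    ContMDiffOn (𝓘(ℝ, EuclideanSpace ℝ (Fin k)).prod (𝓡∂ n)) 𝓘(ℝ, Amb n) ∞
      (fun x : EuclideanSpace ℝ (Fin k) × M => c x.1 x.2) (U ×ˢ univ) →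
    (∀ s ∈ U, IsPreShape (c s)) →
    ContMDiffOn (𝓘(ℝ, EuclideanSpace ℝ (Fin k)).prod (𝓡∂ n)) 𝓘(ℝ, ℝ) 1
      (fun x : EuclideanSpace ℝ (Fin k) × M => f (c x.1) (c x.1 x.2)) (U ×ˢ univ)

/-- Admissible targets for the initial node density `g`: every `f_φ : φ(M) → (0, ∞)` is smooth,
`f` has shape functionality (`f_{φ ∘ ρ} = f_φ` for diffeomorphisms `ρ` of `M`), is normalized,
and depends on `φ` regularly. -/
structure IsTarget {n : ℕ} [NeZero n] {M : Set (Amb n)} [ChartedSpace (EuclideanHalfSpace n) M]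
    (g : M → ℝ) (f : (M → Amb n) → Amb n → ℝ) : Prop where
  smooth : ∀ φ : M → Amb n, IsPreShape φ →
    ContMDiff (𝓡∂ n) 𝓘(ℝ, ℝ) ∞ (fun p => f φ (φ p))
  pos : ∀ φ : M → Amb n, IsPreShape φ → ∀ s ∈ range φ, 0 < f φ s
  shape_functionality : ∀ φ : M → Amb n, IsPreShape φ →
    ∀ ρ : Diffeomorph (𝓡∂ n) (𝓡∂ n) M M ∞, IsPreShape (φ ∘ ρ) →
      ∀ s ∈ range φ, f (φ ∘ ρ) s = f φ s
  normalized : ∀ φ : M → Amb n, IsPreShape φ →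
    ∫ s in range φ, f φ s ∂μHE[n] =
      ∫ s in M, Function.extend (fun p : M => (p : Amb n)) g 0 s ∂μHE[n]
  dependsC1 : DependsC1 f

/-! ### Pre-shape derivatives -/

/-- The one-sided directional derivative `lim_{t ↓ 0} (𝔍(φ + t • X) - 𝔍(φ)) / t` exists and equals
`d`, for a vector field `X : M → ℝ^{n+1}` along `φ`. -/
def HasDerivAlong {n : ℕ} {M : Set (Amb n)} (J : (M → Amb n) → ℝ) (φ X : M → Amb n) (d : ℝ) :
    Prop :=
  Tendsto (fun t : ℝ => (J (φ + t • X) - J φ) / t) (𝓝[>] 0) (𝓝 d)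

/-- The pre-shape derivative `𝔇𝔍(φ)[V]` exists and equals `d`: the derivative along the
perturbation of identity `φ_t = φ + t • V ∘ φ`. -/
def HasPreShapeDeriv {n : ℕ} {M : Set (Amb n)} (J : (M → Amb n) → ℝ) (φ : M → Amb n)
    (V : Amb n → Amb n) (d : ℝ) : Prop :=
  HasDerivAlong J φ (V ∘ φ) d

/-- The tangent space of `φ(M)` at `φ(p)`, as a subspace of `ℝ^{n+1}`. -/
def tangentPlane {n : ℕ} [NeZero n] {M : Set (Amb n)} [ChartedSpace (EuclideanHalfSpace n) M]
    (φ : M → Amb n) (p : M) : Submodule ℝ (Amb n) :=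
  LinearMap.range (diff φ p).toLinearMap

/-- The normal part `⟨V, n⟩ n` of `V` on `φ(M)`, as a field along `φ`: the orthogonal projection of
`V(φ(p))` to the normal line of `φ(M)` at `φ(p)`. -/
def normalPart {n : ℕ} [NeZero n] {M : Set (Amb n)} [ChartedSpace (EuclideanHalfSpace n) M]
    (φ : M → Amb n) (V : Amb n → Amb n) (p : M) : Amb n :=
  (tangentPlane φ p)ᗮ.starProjection (V (φ p))

/-- The normal component `g^𝒩_φ` of the pre-shape derivative satisfies `⟨g^𝒩_φ, V⟩ = d`: the
pre-shape derivative in the direction of the normal part of `V` exists and equals `d`. -/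
def HasNormalComponent {n : ℕ} [NeZero n] {M : Set (Amb n)}
    [ChartedSpace (EuclideanHalfSpace n) M] (J : (M → Amb n) → ℝ) (φ : M → Amb n)
    (V : Amb n → Amb n) (d : ℝ) : Prop :=
  HasDerivAlong J φ (normalPart φ V) d

/-- The directions `C^∞_{∂M}(ℝ^{n+1}, ℝ^{n+1})`: smooth vector fields vanishing on `∂M`. -/
structure IsDirection {n : ℕ} [NeZero n] (M : Set (Amb n)) [ChartedSpace (EuclideanHalfSpace n) M]
    (V : Amb n → Amb n) : Prop where
  smooth : ContDiff ℝ ∞ V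
  vanishes : ∀ p : M, p ∈ (𝓡∂ n).boundary M → V p = 0

/-- `ν` is a unit normal vector of `φ(M)` at `φ(p)`. -/
def IsUnitNormal {n : ℕ} [NeZero n] {M : Set (Amb n)} [ChartedSpace (EuclideanHalfSpace n) M]
    (φ : M → Amb n) (p : M) (ν : Amb n) : Prop :=
  ‖ν‖ = 1 ∧ ∀ v : TangentSpace (𝓡∂ n) p, ⟪diff φ p v, ν⟫ = 0

/-- `⟨V, n⟩ = 0` on the interior of `φ(M)`. -/
def IsTangential {n : ℕ} [NeZero n] {M : Set (Amb n)} [ChartedSpace (EuclideanHalfSpace n) M]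
    (φ : M → Amb n) (V : Amb n → Amb n) : Prop :=
  ∀ p : M, p ∈ (𝓡∂ n).interior M → ∀ ν : Amb n, IsUnitNormal φ p ν → ⟪V (φ p), ν⟫ = 0

/-- Fiber stationarity: the pre-shape derivative vanishes in all tangential directions. -/
def FiberStationary {n : ℕ} [NeZero n] {M : Set (Amb n)} [ChartedSpace (EuclideanHalfSpace n) M]
    (J : (M → Amb n) → ℝ) (φ : M → Amb n) : Prop :=
  ∀ V : Amb n → Amb n, IsDirection M V → IsTangential φ V → HasPreShapeDeriv J φ V 0

/-- The complete pre-shape derivative vanishes. -/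
def Stationary {n : ℕ} [NeZero n] {M : Set (Amb n)} [ChartedSpace (EuclideanHalfSpace n) M]
    (J : (M → Amb n) → ℝ) (φ : M → Amb n) : Prop :=
  ∀ V : Amb n → Amb n, IsDirection M V → HasPreShapeDeriv J φ V 0

/-- The normal component of the pre-shape derivative vanishes. -/
def NormalStationary {n : ℕ} [NeZero n] {M : Set (Amb n)}
    [ChartedSpace (EuclideanHalfSpace n) M] (J : (M → Amb n) → ℝ) (φ : M → Amb n) : Prop :=
  ∀ V : Amb n → Amb n, IsDirection M V → HasNormalComponent J φ V 0

end PreShape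

end

/-! Everything is pulled back to the fixed manifold M. With `jac ψ` the Jacobian of ψ relative to
the inclusion, the area formula gives J(ψ) = ∫_M ½ jac ψ (g / jac ψ − f_ψ∘ψ)² (`objective_eq`), and
the frames have disappeared. Write a = g / jac φ and F = f_φ∘φ; the explicit form of optimality says
that the defect a − F is zero.

If a = F, then J(φ) = 0 while J ≥ 0 everywhere, so φ is a minimizer. At a minimizer, J is
differentiable along φ + tX for every smooth field X vanishing on ∂M: nearby members of the family
are again pre-shapes (`eventually_isEmb`) and the integrand is C¹ in the parameter. Hence the
derivative is zero, for X = V∘φ and equally for the normal part of V, which is smooth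
(`contMDiff_normalPart`).

The substance is that fiber stationarity forces a = F. Along reparametrizations φ∘σ_t shape
functionality freezes f, so the variation of J is explicit. But φ + t V∘φ with V tangential in
general leaves the image φ(M) at second order. The two curves are compared inside one family c_s = φ
+ s₀ Q(s₁, ·), where Q is the smooth difference quotient with b Q(b, x) = X(x + b w(x) v) − X(x),
for X the expression of φ in a chart, w a bump function and v a direction (`shearFamily`). The ray
(t, 0) is the perturbation of identity, the ray (0, t) is constantly φ, and (t, t) is φ∘σ_t with
σ_t(x) = x + t w(x) v. The derivative of J along the family at 0 is linear and vanishes on both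
axes, on the first by stationarity and on the second by constancy; hence it vanishes on the diagonal
(`exists_integral_eq_zero`). The material derivative of f never has to be computed.

On the diagonal, integration by parts (`integral_firstVariation`) turns this into ∫ w m a ∂_v(a − F)
dx = 0, with m the volume density of φ in the chart (`integral_weight_eq_zero`). Since w and v are
arbitrary and m a > 0, the differential of a − F vanishes in chart interiors. As M is connected, a −
F is constant; integrating jac φ · (a − F) = g − jac φ · F over M, the normalization makes this
constant zero (`FiberStationary.div_jac_eq`). -/

noncomputable section

namespace PreShape

/-! ### Local-to-global comparison of measures -/

section LocalToGlobal

variable {α : Type*} [TopologicalSpace α] [SecondCountableTopology α] [MeasurableSpace α]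
  [OpensMeasurableSpace α]

/-- A comparison between two measures that holds locally on `S` holds on `S`. -/
theorem measure_le_of_locally_le {μ ν : Measure α} {S : Set α} (c : ENNReal)
    (h : ∀ x ∈ S, ∃ U ∈ 𝓝[S] x, ∀ B ⊆ U, B ⊆ S → MeasurableSet B → μ B ≤ c * ν B)
    {A : Set α} (hA : MeasurableSet A) (hAS : A ⊆ S) : μ A ≤ c * ν A := by
  choose! U hU hB using h
  have hO : ∀ x ∈ S, ∃ O : Set α, IsOpen O ∧ x ∈ O ∧ O ∩ S ⊆ U x := fun x hx =>
    mem_nhdsWithin.1 (hU x hx)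
  choose! O hOo hxO hOU using hO
  obtain ⟨t, htS, htc, hcov⟩ := TopologicalSpace.countable_cover_nhdsWithin
    (f := O) (s := S) fun x hx => mem_nhdsWithin_of_mem_nhds ((hOo x hx).mem_nhds (hxO x hx))
  rcases t.eq_empty_or_nonempty with rfl | hne
  · have : A = ∅ := by
      apply subset_empty_iff.1
      intro x hx
      simpa using hcov (hAS hx)
    simp [this]
  obtain ⟨f, rfl⟩ := htc.exists_eq_range hne
  have hfS : ∀ i, f i ∈ S := fun i => htS (mem_range_self i)
  -- Disjointing a countable cover splits A into measurable pieces, each inside one of the sets on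
  -- which the comparison is known.
  let D : ℕ → Set α := fun i => A ∩ disjointed (fun i => O (f i)) i
  have hDm : ∀ i, MeasurableSet (D i) := fun i =>
    hA.inter (MeasurableSet.disjointed (fun i => (hOo _ (hfS i)).measurableSet) i)
  have hDd : Pairwise (Function.onFun Disjoint D) := fun i j hij =>
    (disjoint_disjointed (fun i => O (f i)) hij).mono inter_subset_right inter_subset_right
  have hDU : ⋃ i, D i = A := by
    rw [← inter_iUnion, iUnion_disjointed, inter_eq_left]
    intro x hx
    simpa using hcov (hAS hx)
  rw [← hDU, measure_iUnion hDd hDm, measure_iUnion hDd hDm, ← ENNReal.tsum_mul_left]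
  refine ENNReal.tsum_le_tsum fun i => hB (f i) (hfS i) _ ?_ (inter_subset_left.trans hAS) (hDm i)
  exact fun x hx => hOU _ (hfS i) ⟨disjointed_subset (fun i => O (f i)) i hx.2, hAS hx.1⟩

end LocalToGlobal

/-! ### Area formula for injective immersions -/

section AreaFormula

/-- On B the map f factors through g by a k-Lipschitz map. Parametrizing both images by the same set
B lets a map and its linear approximation be compared in both directions. -/
theorem euclideanHausdorffMeasure_image_le_of_dist_le {ι X Y : Type*} [MetricSpace X]
    [MeasurableSpace X] [BorelSpace X] [MetricSpace Y] [MeasurableSpace Y] [BorelSpace Y]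
    (d : ℕ) (k : NNReal) (B : Set ι) (f : ι → X) (g : ι → Y)
    (h : ∀ x ∈ B, ∀ y ∈ B, dist (f x) (f y) ≤ k * dist (g x) (g y)) :
    μHE[d] (f '' B) ≤ (k : ENNReal) ^ d * μHE[d] (g '' B) := by
  rcases B.eq_empty_or_nonempty with rfl | ⟨b, hb⟩
  · simp
  have : Nonempty ι := ⟨b⟩
  let r : Y → X := fun y => f (Function.invFunOn g B y)
  have hr : ∀ x ∈ B, r (g x) = f x := fun x hx => by
    have hm : Function.invFunOn g B (g x) ∈ B := Function.invFunOn_mem ⟨x, hx, rfl⟩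
    have he : g (Function.invFunOn g B (g x)) = g x := Function.invFunOn_eq ⟨x, hx, rfl⟩
    have := h _ hm x hx
    rw [he, dist_self, mul_zero] at this
    exact dist_le_zero.1 this
  have hl : LipschitzOnWith k r (g '' B) := by
    refine LipschitzOnWith.of_dist_le_mul ?_
    rintro _ ⟨x, hx, rfl⟩ _ ⟨y, hy, rfl⟩
    rw [hr x hx, hr y hy]
    exact h x hx y hy
  have him : f '' B = r '' (g '' B) := by
    rw [image_image]
    exact image_congr fun x hx => (hr x hx).symm
  rw [him]
  simp only [Measure.euclideanHausdorffMeasure_def, Measure.smul_apply]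
  have := hl.hausdorffMeasure_image_le (d := d) (by positivity)
  rw [ENNReal.rpow_natCast] at this
  rw [mul_smul_comm]
  gcongr

variable {E F : Type*} [NormedAddCommGroup E] [InnerProductSpace ℝ E] [FiniteDimensional ℝ E]
  [NormedAddCommGroup F] [InnerProductSpace ℝ F]

/-- Exhibits `normDet` as the square root of a polynomial in L: continuous everywhere, and smooth
where it is nonzero, that is, at injective L. -/
theorem normDet_eq_sqrt_det_gram (L : E →L[ℝ] F) :
    L.toLinearMap.normDet =
      √(Matrix.gram ℝ fun i => L (stdOrthonormalBasis ℝ E i)).det := by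
  have := L.toLinearMap.normDet_sq_eq_det_gram (stdOrthonormalBasis ℝ E)
  rw [← Real.sqrt_sq L.toLinearMap.normDet_nonneg]
  congr 1

theorem contDiff_det_gram {k : WithTop ℕ∞} : ContDiff ℝ k fun L : E →L[ℝ] F =>
    (Matrix.gram ℝ fun i => L (stdOrthonormalBasis ℝ E i)).det := by
  simp only [Matrix.det_apply, Matrix.gram_apply]
  refine ContDiff.sum fun σ _ => ContDiff.const_smul _ ?_
  refine contDiff_prod fun i _ => ?_
  refine ContDiff.inner ℝ ?_ ?_ <;> exact contDiff_id.clm_apply contDiff_const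

theorem normDet_pos_of_injective {L : E →L[ℝ] F} (hL : Function.Injective L) :
    0 < L.toLinearMap.normDet :=
  have h : L.toLinearMap.normDet ≠ 0 := (L.toLinearMap.normDet_ne_zero_tfae.out 4 0).1 hL
  lt_of_le_of_ne L.toLinearMap.normDet_nonneg h.symm

theorem injective_of_normDet_ne_zero {L : E →L[ℝ] F} (hL : L.toLinearMap.normDet ≠ 0) :
    Function.Injective L :=
  (L.toLinearMap.normDet_ne_zero_tfae.out 0 4).1 hL

theorem continuous_normDet : Continuous fun L : E →L[ℝ] F => L.toLinearMap.normDet := by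
  simp only [normDet_eq_sqrt_det_gram]
  exact Real.continuous_sqrt.comp (contDiff_det_gram (k := 0)).continuous

theorem contDiffAt_normDet {k : WithTop ℕ∞} {L : E →L[ℝ] F} (hL : Function.Injective L) :
    ContDiffAt ℝ k (fun L : E →L[ℝ] F => L.toLinearMap.normDet) L := by
  have := normDet_pos_of_injective hL
  simp only [normDet_eq_sqrt_det_gram] at this ⊢
  exact contDiff_det_gram.contDiffAt.sqrt (Real.sqrt_pos.1 this).ne'

variable [MeasurableSpace E] [BorelSpace E] [MeasurableSpace F] [BorelSpace F]

theorem exists_pow_le_of_one_lt {c : NNReal} (hc : 1 < c) (d : ℕ) :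
    ∃ k : NNReal, 1 < k ∧ k ^ d ≤ c := by
  have h : Tendsto (fun k : NNReal => k ^ d) (𝓝 1) (𝓝 (1 ^ d)) :=
    (continuous_id.pow d).tendsto 1
  rw [one_pow] at h
  have h1 : ∀ᶠ k : NNReal in 𝓝 1, k ^ d < c := h.eventually (gt_mem_nhds hc)
  have h2 : ∃ᶠ k : NNReal in 𝓝 1, 1 < k := by
    have : (𝓝[>] (1 : NNReal)).NeBot := inferInstance
    exact frequently_iff_neBot.2 this
  obtain ⟨k, hk1, hk2⟩ := (h2.and_eventually h1).exists
  exact ⟨k, hk1, hk2.le⟩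

/-- Near a point at which `X` is well approximated by an injective linear map, `X` distorts volumes
nearly like this linear map. -/
theorem exists_nhdsWithin_measure_image_le {S : Set E} {X : E → F} {L : E →L[ℝ] F} {x : E}
    (hX : ∀ ε : NNReal, 0 < ε → ∃ U ∈ 𝓝[S] x, ApproximatesLinearOn X L U ε)
    (hL : Function.Injective L) {c : NNReal} (hc : 1 < c) :
    ∃ U ∈ 𝓝[S] x, ∀ B ⊆ U,
      μHE[Module.finrank ℝ E] (X '' B) ≤ c * (ENNReal.ofReal L.toLinearMap.normDet * volume B) ∧
      ENNReal.ofReal L.toLinearMap.normDet * volume B ≤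
        c * μHE[Module.finrank ℝ E] (X '' B) := by
  obtain ⟨k, hk1, hkc⟩ := exists_pow_le_of_one_lt hc (Module.finrank ℝ E)
  obtain ⟨K, hK, hLK⟩ := L.toLinearMap.exists_antilipschitzWith (LinearMap.ker_eq_bot.2 hL)
  have hk0 : (0 : ℝ) < k := by
    have : (1 : ℝ) < k := hk1
    linarith
  -- Since L is antilipschitz with constant K, this ε gives ‖u − w‖ ≤ (1 − 1/k)‖w‖ for the
  -- increments u of X and w of L. Then ‖w‖ ≤ k‖u‖, and ‖u‖ ≤ (2 − 1/k)‖w‖ ≤ k‖w‖.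
  obtain ⟨ε, hε⟩ : ∃ ε : NNReal, (ε : ℝ) = (k - 1) / (k * K) := by
    refine ⟨⟨(k - 1) / (k * K), ?_⟩, rfl⟩
    have : (1 : ℝ) < k := hk1
    have : (0 : ℝ) < K := hK
    exact div_nonneg (by linarith) (by positivity)
  have hk1' : (1 : ℝ) < k := hk1
  have hK' : (0 : ℝ) < K := hK
  have hε0 : 0 < ε := by
    rw [← NNReal.coe_pos, hε]
    exact div_pos (by linarith) (by positivity)
  obtain ⟨U, hU, hXU⟩ := hX ε hε0
  have key : ∀ a ∈ U, ∀ b ∈ U, dist (X a) (X b) ≤ k * dist (L a) (L b) ∧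
      dist (L a) (L b) ≤ k * dist (X a) (X b) := by
    intro a ha b hb
    have h1 := hXU a ha b hb
    have h2 := hLK.le_mul_dist a b
    rw [dist_eq_norm, dist_eq_norm] at h2 ⊢
    simp only [ContinuousLinearMap.coe_coe] at h2
    rw [map_sub] at h1
    set u := X a - X b
    set w := L a - L b
    have h3 : ε * ‖a - b‖ ≤ (1 - 1 / k) * ‖w‖ := by
      calc ε * ‖a - b‖ ≤ ε * (K * ‖w‖) := by gcongr
        _ = (1 - 1 / k) * ‖w‖ := by rw [hε]; field_simp
    have h4 : ‖u‖ ≤ ‖u - w‖ + ‖w‖ := by simpa using norm_add_le (u - w) w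
    have h5 : ‖w‖ ≤ ‖u - w‖ + ‖u‖ := by
      have := norm_sub_le u (u - w)
      simp only [sub_sub_cancel] at this
      linarith
    have hw := norm_nonneg w
    constructor
    · have : (1 - 1 / k) + 1 ≤ (k : ℝ) := by
        have : 0 ≤ ((k : ℝ) - 1) ^ 2 / k := by positivity
        have h6 : ((k : ℝ) - 1) ^ 2 / k = k - 2 + 1 / k := by field_simp; ring
        linarith
      nlinarith
    · have h6 : (1 / k : ℝ) * ‖w‖ ≤ ‖u‖ := by linarith
      rw [one_div, inv_mul_le_iff₀ hk0] at h6
      exact h6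
  refine ⟨U, hU, fun B hB => ?_⟩
  have hkc' : (k : ENNReal) ^ Module.finrank ℝ E ≤ c := by exact_mod_cast hkc
  have hlin := L.toLinearMap.euclideanHausdorffMeasure_image_eq_normDet_mul_volume B
  rw [← hlin]
  constructor
  · refine (euclideanHausdorffMeasure_image_le_of_dist_le _ k B X L
      fun a ha b hb => (key a (hB ha) b (hB hb)).1).trans ?_
    gcongr
    rfl
  · refine (euclideanHausdorffMeasure_image_le_of_dist_le _ k B L X
      fun a ha b hb => (key a (hB ha) b (hB hb)).2).trans ?_
    gcongr

/-- **Area formula** for injective `C^1` immersions. -/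
theorem euclideanHausdorffMeasure_image_eq_lintegral {S : Set E} (hS : MeasurableSet S) {X : E → F}
    {X' : E → E →L[ℝ] F}
    (hX : ∀ x ∈ S, ∀ ε : NNReal, 0 < ε → ∃ U ∈ 𝓝[S] x, ApproximatesLinearOn X (X' x) U ε)
    (hX' : ContinuousOn X' S) (hinj' : ∀ x ∈ S, Function.Injective (X' x)) (hinj : InjOn X S)
    (hXc : ContinuousOn X S) {A : Set E} (hA : MeasurableSet A) (hAS : A ⊆ S) :
    μHE[Module.finrank ℝ E] (X '' A) =
      ∫⁻ x in A, ENNReal.ofReal (X' x).toLinearMap.normDet := by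
  have hemb : MeasurableEmbedding (S.domRestrict X) := hXc.measurableEmbedding hS hinj
  -- Turns B ↦ μHE(X '' B) into a measure on E, so that the local-to-global comparison applies to
  -- it.
  let ν : Measure E :=
    ((μHE[Module.finrank ℝ E] : Measure F).comap (S.domRestrict X)).map Subtype.val
  have hν : ∀ B ⊆ S, MeasurableSet B → ν B = μHE[Module.finrank ℝ E] (X '' B) := by
    intro B hB hBm
    rw [Measure.map_apply measurable_subtype_coe hBm, hemb.comap_apply]
    congr 1
    ext y
    constructor
    · rintro ⟨x, hx, rfl⟩
      exact ⟨x, hx, rfl⟩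
    · rintro ⟨x, hx, rfl⟩
      exact ⟨⟨x, hB hx⟩, hx, rfl⟩
  let ρ : Measure E := volume.withDensity fun x => ENNReal.ofReal (X' x).toLinearMap.normDet
  have hρ : ∀ B, MeasurableSet B →
      ρ B = ∫⁻ x in B, ENNReal.ofReal (X' x).toLinearMap.normDet := fun B hB =>
    withDensity_apply _ hB
  rw [← hν A hAS hA, ← hρ A hA]
  have hcont : ContinuousOn (fun x => (X' x).toLinearMap.normDet) S :=
    continuous_normDet.comp_continuousOn hX'
  -- One factor c pays for the distortion of X against its derivative at x, the other for the
  -- oscillation of `normDet` near x. Letting c ↓ 1 at the end gives equality.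
  have main : ∀ c : NNReal, 1 < c → ν A ≤ (c * c : ENNReal) * ρ A ∧
      ρ A ≤ (c * c : ENNReal) * ν A := by
    intro c hc
    have hloc : ∀ x ∈ S, ∃ U ∈ 𝓝[S] x, ∀ B ⊆ U, B ⊆ S → MeasurableSet B →
        ν B ≤ (c * c : ENNReal) * ρ B ∧ ρ B ≤ (c * c : ENNReal) * ν B := by
      intro x hx
      obtain ⟨U, hU, hUB⟩ := exists_nhdsWithin_measure_image_le (hX x hx) (hinj' x hx) hc
      set m := (X' x).toLinearMap.normDet with hm
      have hm0 : 0 < m := normDet_pos_of_injective (hinj' x hx)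
      have hc' : (1 : ℝ) < c := hc
      have h1 : ∀ᶠ y in 𝓝[S] x, m < c * (X' y).toLinearMap.normDet :=
        ((hcont x hx).const_mul c).eventually (lt_mem_nhds (by nlinarith))
      have h2 : ∀ᶠ y in 𝓝[S] x, (X' y).toLinearMap.normDet < c * m :=
        (hcont x hx).eventually (gt_mem_nhds (by nlinarith))
      refine ⟨U ∩ {y | m < c * (X' y).toLinearMap.normDet ∧ (X' y).toLinearMap.normDet < c * m},
        inter_mem hU (h1.and h2), fun B hB hBS hBm => ?_⟩
      obtain ⟨hu1, hu2⟩ := hUB B (hB.trans inter_subset_left)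
      rw [hν B hBS hBm, hρ B hBm]
      have e1 : ENNReal.ofReal m * volume B ≤
          c * ∫⁻ y in B, ENNReal.ofReal (X' y).toLinearMap.normDet := by
        rw [← lintegral_const_mul' _ _ ENNReal.coe_ne_top, ← setLIntegral_const]
        refine setLIntegral_mono' hBm fun y hy => ?_
        have := (hB hy).2.1
        rw [← ENNReal.ofReal_coe_nnreal, ← ENNReal.ofReal_mul (by positivity)]
        exact ENNReal.ofReal_le_ofReal this.le
      have e2 : ∫⁻ y in B, ENNReal.ofReal (X' y).toLinearMap.normDet ≤
          c * (ENNReal.ofReal m * volume B) := by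
        rw [← mul_assoc, ← setLIntegral_const]
        refine setLIntegral_mono' hBm fun y hy => ?_
        have := (hB hy).2.2
        rw [← ENNReal.ofReal_coe_nnreal, ← ENNReal.ofReal_mul (by positivity)]
        exact ENNReal.ofReal_le_ofReal this.le
      constructor
      · rw [mul_assoc]
        exact hu1.trans (by gcongr)
      · rw [mul_assoc]
        exact e2.trans (by gcongr)
    constructor
    · refine measure_le_of_locally_le _ (fun x hx => ?_) hA hAS
      obtain ⟨U, hU, h⟩ := hloc x hx
      exact ⟨U, hU, fun B hB hBS hBm => (h B hB hBS hBm).1⟩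
    · refine measure_le_of_locally_le _ (fun x hx => ?_) hA hAS
      obtain ⟨U, hU, h⟩ := hloc x hx
      exact ⟨U, hU, fun B hB hBS hBm => (h B hB hBS hBm).2⟩
  have hlim : ∀ a : ENNReal, Tendsto (fun c : NNReal => (c * c : ENNReal) * a) (𝓝[>] 1) (𝓝 a) := by
    intro a
    have h : Tendsto (fun c : NNReal => ((c * c : NNReal) : ENNReal)) (𝓝[>] 1) (𝓝 1) := by
      have : Tendsto (fun c : NNReal => c * c) (𝓝[>] 1) (𝓝 (1 * 1)) :=
        ((continuous_id.mul continuous_id).tendsto 1).mono_left nhdsWithin_le_nhds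
      rw [one_mul] at this
      exact ENNReal.tendsto_coe.2 this
    simpa using ENNReal.Tendsto.mul_const h (b := a) (Or.inl (by simp))
  apply le_antisymm
  · exact ge_of_tendsto (hlim _) (eventually_nhdsWithin_of_forall fun c hc => (main c hc).1)
  · exact ge_of_tendsto (hlim _) (eventually_nhdsWithin_of_forall fun c hc => (main c hc).2)

end AreaFormula

/-! ### Derivatives in charts of a manifold with boundary -/

section Chart

variable {n : ℕ} [NeZero n] {M : Set (Amb n)} [ChartedSpace (EuclideanHalfSpace n) M]
  {P F : Type*} [NormedAddCommGroup P] [NormedSpace ℝ P] [NormedAddCommGroup F] [NormedSpace ℝ F]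

/-- The derivative of `ψ : M → F` in the preferred chart at `p₀`. -/
def chartDeriv (p₀ : M) (ψ : M → F) (x : EuclideanSpace ℝ (Fin n)) :
    EuclideanSpace ℝ (Fin n) →L[ℝ] F :=
  fderivWithin ℝ (ψ ∘ (extChartAt (𝓡∂ n) p₀).symm) (extChartAt (𝓡∂ n) p₀).target x

theorem contDiffOn_family_chart [IsManifold (𝓡∂ n) ∞ M] {k : WithTop ℕ∞} (hk : k ≤ ∞) {U : Set P}
    {c : P → M → F}
    (hc : ContMDiffOn (𝓘(ℝ, P).prod (𝓡∂ n)) 𝓘(ℝ, F) k (fun x : P × M => c x.1 x.2) (U ×ˢ univ))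
    (p₀ : M) :
    ContDiffOn ℝ k (fun y : P × EuclideanSpace ℝ (Fin n) =>
      c y.1 ((extChartAt (𝓡∂ n) p₀).symm y.2)) (U ×ˢ (extChartAt (𝓡∂ n) p₀).target) := by
  rw [← contMDiffOn_iff_contDiffOn, modelWithCornersSelf_prod, ← chartedSpaceSelf_prod]
  have h : ContMDiffOn 𝓘(ℝ, EuclideanSpace ℝ (Fin n)) (𝓡∂ n) k (extChartAt (𝓡∂ n) p₀).symm
      (extChartAt (𝓡∂ n) p₀).target := (contMDiffOn_extChartAt_symm p₀).of_le hk
  have h2 : ContMDiffOn (𝓘(ℝ, P).prod 𝓘(ℝ, EuclideanSpace ℝ (Fin n))) (𝓘(ℝ, P).prod (𝓡∂ n)) k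
      (fun y : P × EuclideanSpace ℝ (Fin n) => (y.1, (extChartAt (𝓡∂ n) p₀).symm y.2))
      (U ×ˢ (extChartAt (𝓡∂ n) p₀).target) :=
    contMDiffOn_fst.prodMk (h.comp contMDiffOn_snd fun y hy => hy.2)
  exact hc.comp h2 fun y hy => ⟨hy.1, mem_univ _⟩

theorem contDiffOn_comp_extChartAt_symm [IsManifold (𝓡∂ n) ∞ M] {k : WithTop ℕ∞} (hk : k ≤ ∞)
    {ψ : M → F} (hψ : ContMDiff (𝓡∂ n) 𝓘(ℝ, F) k ψ) (p₀ : M) :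
    ContDiffOn ℝ k (ψ ∘ (extChartAt (𝓡∂ n) p₀).symm) (extChartAt (𝓡∂ n) p₀).target := by
  rw [← contMDiffOn_iff_contDiffOn]
  exact hψ.comp_contMDiffOn ((contMDiffOn_extChartAt_symm p₀).of_le hk)

/-- The chart target may contain boundary points of the half-space, so the derivative is taken
within the target; unique differentiability there yields joint regularity in parameter and point,
with one order lost. -/
theorem contDiffOn_family_chartDeriv [IsManifold (𝓡∂ n) ∞ M] {k m : WithTop ℕ∞} (hk : k ≤ ∞)
    (hm : m + 1 ≤ k) {U : Set P} {c : P → M → F}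
    (hc : ContMDiffOn (𝓘(ℝ, P).prod (𝓡∂ n)) 𝓘(ℝ, F) k (fun x : P × M => c x.1 x.2) (U ×ˢ univ))
    (p₀ : M) :
    ContDiffOn ℝ m (fun y : P × EuclideanSpace ℝ (Fin n) => chartDeriv p₀ (c y.1) y.2)
      (U ×ˢ (extChartAt (𝓡∂ n) p₀).target) := by
  intro y hy
  set T := (extChartAt (𝓡∂ n) p₀).target
  refine ContDiffWithinAt.fderivWithin (n := k) (t := T)
    (f := fun (y : P × EuclideanSpace ℝ (Fin n)) => c y.1 ∘ (extChartAt (𝓡∂ n) p₀).symm)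
    (g := fun y => y.2) ?_ contDiffWithinAt_snd
    (uniqueDiffOn_extChartAt_target p₀) hm hy fun z hz => hz.2
  have h := contDiffOn_family_chart hk hc p₀ y hy
  exact ContDiffWithinAt.comp
    (f := fun z : (P × EuclideanSpace ℝ (Fin n)) × EuclideanSpace ℝ (Fin n) => (z.1.1, z.2))
    (y, y.2) h (by fun_prop) fun z hz => ⟨hz.1.1, hz.2⟩

theorem contDiffOn_chartDeriv [IsManifold (𝓡∂ n) ∞ M] {k m : WithTop ℕ∞} (hk : k ≤ ∞)
    (hm : m + 1 ≤ k) {ψ : M → F} (hψ : ContMDiff (𝓡∂ n) 𝓘(ℝ, F) k ψ) (p₀ : M) :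
    ContDiffOn ℝ m (chartDeriv p₀ ψ) (extChartAt (𝓡∂ n) p₀).target :=
  (contDiffOn_comp_extChartAt_symm hk hψ p₀).fderivWithin (uniqueDiffOn_extChartAt_target p₀) hm

theorem hasFDerivWithinAt_chartDeriv [IsManifold (𝓡∂ n) ∞ M] {ψ : M → F}
    (hψ : ContMDiff (𝓡∂ n) 𝓘(ℝ, F) 1 ψ) (p₀ : M) {x : EuclideanSpace ℝ (Fin n)}
    (hx : x ∈ (extChartAt (𝓡∂ n) p₀).target) :
    HasFDerivWithinAt (ψ ∘ (extChartAt (𝓡∂ n) p₀).symm) (chartDeriv p₀ ψ x)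
      (extChartAt (𝓡∂ n) p₀).target x :=
  ((contDiffOn_comp_extChartAt_symm (by simp) hψ p₀).differentiableOn
    one_ne_zero x hx).hasFDerivWithinAt

/-- The differential of `ψ` as a map on the model space of the tangent space. -/
def diffModel (ψ : M → F) (p : M) : EuclideanSpace ℝ (Fin n) →L[ℝ] F :=
  mfderiv (𝓡∂ n) 𝓘(ℝ, F) ψ p

/-- In the chart at `p₀`, the differential of a map differs from its intrinsic differential by a
linear isomorphism that does not depend on the map. -/
theorem exists_chartDeriv_eq [IsManifold (𝓡∂ n) ∞ M] (p₀ : M) {x : EuclideanSpace ℝ (Fin n)}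
    (hx : x ∈ (extChartAt (𝓡∂ n) p₀).target) :
    ∃ A : EuclideanSpace ℝ (Fin n) ≃L[ℝ] EuclideanSpace ℝ (Fin n),
      ∀ ψ : M → F, ContMDiff (𝓡∂ n) 𝓘(ℝ, F) 1 ψ →
        ∀ v, chartDeriv p₀ ψ x v = diffModel ψ ((extChartAt (𝓡∂ n) p₀).symm x) (A v) := by
  obtain ⟨A, hA⟩ := isInvertible_mfderivWithin_extChartAt_symm (I := 𝓡∂ n) hx
  refine ⟨A, fun ψ hψ v => ?_⟩
  have h1 : MDifferentiableAt (𝓡∂ n) 𝓘(ℝ, F) ψ ((extChartAt (𝓡∂ n) p₀).symm x) :=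
    hψ.mdifferentiable one_ne_zero _
  have h2 := mdifferentiableWithinAt_extChartAt_symm (I := 𝓡∂ n) hx
  have h3 : HasFDerivWithinAt (ψ ∘ (extChartAt (𝓡∂ n) p₀).symm)
      ((diffModel ψ ((extChartAt (𝓡∂ n) p₀).symm x)).comp
        (mfderivWithin 𝓘(ℝ, EuclideanSpace ℝ (Fin n)) (𝓡∂ n) (extChartAt (𝓡∂ n) p₀).symm
          (range (𝓡∂ n)) x : EuclideanSpace ℝ (Fin n) →L[ℝ] EuclideanSpace ℝ (Fin n)))
      (extChartAt (𝓡∂ n) p₀).target x :=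
    (h1.hasMFDerivAt.comp_hasMFDerivWithinAt x h2.hasMFDerivWithinAt).hasFDerivWithinAt.mono
      (extChartAt_target_subset_range p₀)
  have h5 := (uniqueDiffOn_extChartAt_target (I := 𝓡∂ n) p₀ x hx).eq
    (hasFDerivWithinAt_chartDeriv hψ p₀ hx) h3
  rw [← hA] at h5
  exact congrArg (fun L : EuclideanSpace ℝ (Fin n) →L[ℝ] F => L v) h5

end Chart

/-! ### The Jacobian and its independence of frames -/

section Jacobian

variable {n : ℕ} [NeZero n] {M : Set (Amb n)} [ChartedSpace (EuclideanHalfSpace n) M]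

/-- The Jacobian of `ψ` relative to the inclusion of `M`. -/
def jac (ψ : M → Amb n) (p : M) : ℝ :=
  (diffModel ψ p).toLinearMap.normDet /
    (diffModel (fun q : M => (q : Amb n)) p).toLinearMap.normDet

theorem IsEmb.normDet_diffModel_pos {ψ : M → Amb n} (hψ : IsEmb ψ) (p : M) :
    0 < (diffModel ψ p).toLinearMap.normDet :=
  normDet_pos_of_injective (hψ.immersion p)

theorem jac_pos (hM : IsCompactSubmanifold M) {ψ : M → Amb n} (hψ : IsEmb ψ) (p : M) :
    0 < jac ψ p :=
  div_pos (hψ.normDet_diffModel_pos p) (hM.inclusion.normDet_diffModel_pos p)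

theorem IsEmb.contMDiff_one {ψ : M → Amb n} (hψ : IsEmb ψ) :
    ContMDiff (𝓡∂ n) 𝓘(ℝ, Amb n) 1 ψ :=
  hψ.smooth.of_le (by simp)

theorem injective_chartDeriv [IsManifold (𝓡∂ n) ∞ M] {ψ : M → Amb n} (hψ : IsEmb ψ) (p₀ : M)
    {x : EuclideanSpace ℝ (Fin n)} (hx : x ∈ (extChartAt (𝓡∂ n) p₀).target) :
    Function.Injective (chartDeriv p₀ ψ x) := by
  obtain ⟨A, hA⟩ := exists_chartDeriv_eq (F := Amb n) p₀ hx
  intro v w h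
  rw [hA ψ hψ.contMDiff_one, hA ψ hψ.contMDiff_one] at h
  exact A.injective (hψ.immersion _ h)

/-- The factor a is the `normDet` of the change between chart and tangent space. It is common to all
ψ and therefore cancels in the quotient defining `jac`. -/
theorem normDet_chartDeriv_eq [IsManifold (𝓡∂ n) ∞ M] (p₀ : M) {x : EuclideanSpace ℝ (Fin n)}
    (hx : x ∈ (extChartAt (𝓡∂ n) p₀).target) :
    ∃ a : ℝ, 0 < a ∧ ∀ ψ : M → Amb n, ContMDiff (𝓡∂ n) 𝓘(ℝ, Amb n) 1 ψ →
      (chartDeriv p₀ ψ x).toLinearMap.normDet =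
        (diffModel ψ ((extChartAt (𝓡∂ n) p₀).symm x)).toLinearMap.normDet * a := by
  obtain ⟨A, hA⟩ := exists_chartDeriv_eq (F := Amb n) p₀ hx
  let A' : EuclideanSpace ℝ (Fin n) →L[ℝ] EuclideanSpace ℝ (Fin n) := A.toContinuousLinearMap
  refine ⟨A'.toLinearMap.normDet, normDet_pos_of_injective A.injective, fun ψ hψ => ?_⟩
  rw [← LinearMap.normDet_comp_of_finrank_eq _ _ rfl]
  congr 1
  ext1 v
  exact hA ψ hψ v

theorem normDet_chartDeriv_eq_jac_mul (hM : IsCompactSubmanifold M) {ψ : M → Amb n}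
    (hψ : ContMDiff (𝓡∂ n) 𝓘(ℝ, Amb n) 1 ψ) (p₀ : M) {x : EuclideanSpace ℝ (Fin n)}
    (hx : x ∈ (extChartAt (𝓡∂ n) p₀).target) :
    (chartDeriv p₀ ψ x).toLinearMap.normDet = jac ψ ((extChartAt (𝓡∂ n) p₀).symm x) *
      (chartDeriv p₀ (fun q : M => (q : Amb n)) x).toLinearMap.normDet := by
  have := hM.isManifold
  obtain ⟨a, ha, h⟩ := normDet_chartDeriv_eq (M := M) p₀ hx
  rw [h _ hψ, h _ hM.inclusion.contMDiff_one, jac, ← mul_assoc]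
  congr 1
  rw [div_mul_cancel₀ _ (hM.inclusion.normDet_diffModel_pos _).ne']

theorem inner_eq_sum_of_mem_span {ι H : Type*} [Fintype ι] [NormedAddCommGroup H]
    [InnerProductSpace ℝ H] {v : ι → H} (hv : Orthonormal ℝ v) {x : H}
    (hx : x ∈ Submodule.span ℝ (range v)) (y : H) :
    ⟪x, y⟫ = ∑ i, ⟪x, v i⟫ * ⟪y, v i⟫ := by
  obtain ⟨c, rfl⟩ := Submodule.mem_span_range_iff_exists_fun ℝ |>.1 hx
  rw [sum_inner]
  refine Finset.sum_congr rfl fun i _ => ?_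
  rw [hv.inner_left_fintype, real_inner_smul_left, real_inner_comm]
  rfl

/-- The determinant of the covariant derivative does not depend on the frames. -/
theorem det_covMatrix_eq_jac (hM : IsCompactSubmanifold M)
    {τ : (p : M) → Fin n → TangentSpace (𝓡∂ n) p} (hτ : IsFrame τ) {ψ : M → Amb n}
    {τψ : Amb n → Fin n → Amb n} (hτψ : IsImageFrame τ ψ τψ) (p : M) :
    (covMatrix τ τψ ψ p).det = jac ψ p := by
  let b := EuclideanSpace.basisFun (Fin n) ℝ
  -- T carries the standard basis to τ(p). The differential of the inclusion composed with T is
  -- isometric, and Dψ ∘ T has Gram matrix CᵀC with C the covariant matrix.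
  let T : EuclideanSpace ℝ (Fin n) →ₗ[ℝ] EuclideanSpace ℝ (Fin n) :=
    b.toBasis.constr ℝ fun j => (τ p j : EuclideanSpace ℝ (Fin n))
  have hTb : ∀ j, T (b j) = τ p j := fun j => by
    have := b.toBasis.constr_basis ℝ (fun j => (τ p j : EuclideanSpace ℝ (Fin n))) j
    rwa [OrthonormalBasis.coe_toBasis] at this
  have h1 : (diffModel (fun q : M => (q : Amb n)) p).toLinearMap.normDet * T.normDet = 1 := by
    rw [← LinearMap.normDet_comp_of_finrank_eq _ _ rfl]
    have h := LinearMap.normDet_sq_eq_det_gram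
      ((diffModel (fun q : M => (q : Amb n)) p).toLinearMap ∘ₗ T) b
    have hg : (Matrix.gram ℝ fun j =>
        ((diffModel (fun q : M => (q : Amb n)) p).toLinearMap ∘ₗ T) (b j)) = 1 := by
      ext i j
      rw [Matrix.gram_apply, Matrix.one_apply]
      simp only [LinearMap.comp_apply, hTb]
      exact (orthonormal_iff_ite.1 (hτ p)) i j
    rw [hg, Matrix.det_one] at h
    have h' : ((diffModel (fun q : M => (q : Amb n)) p).toLinearMap ∘ₗ T).normDet ^ 2 = 1 := h
    nlinarith [LinearMap.normDet_nonneg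
      ((diffModel (fun q : M => (q : Amb n)) p).toLinearMap ∘ₗ T)]
  have h2 : (diffModel ψ p).toLinearMap.normDet * T.normDet = (covMatrix τ τψ ψ p).det := by
    rw [← LinearMap.normDet_comp_of_finrank_eq _ _ rfl]
    have hpos := hτψ.oriented p
    have h := LinearMap.normDet_sq_eq_det_gram ((diffModel ψ p).toLinearMap ∘ₗ T) b
    have hg : (Matrix.gram ℝ fun j => ((diffModel ψ p).toLinearMap ∘ₗ T) (b j)) =
        (covMatrix τ τψ ψ p).transpose * covMatrix τ τψ ψ p := by
      have hspan : ∀ v : EuclideanSpace ℝ (Fin n), diffModel ψ p v ∈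
          Submodule.span ℝ (range (τψ (ψ p))) := by
        have hle : Submodule.span ℝ (range (τψ (ψ p))) ≤
            LinearMap.range (diffModel ψ p).toLinearMap := by
          rw [Submodule.span_le]
          rintro _ ⟨i, rfl⟩
          obtain ⟨v, hv⟩ := hτψ.tangent p i
          exact ⟨v, hv⟩
        -- Dimension count: the image frame spans n dimensions and the range of Dψ has at most n.
        have heq := Submodule.eq_of_le_of_finrank_le hle (by
          rw [finrank_span_eq_card (hτψ.orthonormal p).linearIndependent]
          refine (LinearMap.finrank_range_le _).trans ?_
          simp)
        intro v
        rw [heq]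
        exact ⟨v, rfl⟩
      ext i j
      rw [Matrix.gram_apply, Matrix.mul_apply]
      simp only [LinearMap.comp_apply, hTb, Matrix.transpose_apply, covMatrix, Matrix.of_apply]
      exact inner_eq_sum_of_mem_span (hτψ.orthonormal p) (hspan (τ p i)) _
    rw [hg, Matrix.det_mul, Matrix.det_transpose, ← sq] at h
    -- The Gram determinant gives det C only up to sign; positive orientation selects the root.
    exact (sq_eq_sq₀ (LinearMap.normDet_nonneg _) hpos.le).1 h
  rw [jac, ← h2, eq_div_iff (hM.inclusion.normDet_diffModel_pos p).ne']
  calc _ = (diffModel ψ p).toLinearMap.normDet * ((diffModel (fun q : M => (q : Amb n)) p).toLinearMap.normDet * T.normDet) := by ring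
    _ = _ := by rw [h1, mul_one]

end Jacobian

/-! ### Regularity of the Jacobian in families -/

section SmoothFamily

variable {n : ℕ} [NeZero n] {M : Set (Amb n)} [ChartedSpace (EuclideanHalfSpace n) M]
  {P : Type*} [NormedAddCommGroup P] [NormedSpace ℝ P]

/-- A function on `P × M` is smooth if it is so in every chart of `M`. -/
theorem contMDiffOn_prod_of_chart {F : Type*} [NormedAddCommGroup F] [NormedSpace ℝ F]
    [IsManifold (𝓡∂ n) ∞ M] {k : WithTop ℕ∞} (hk : k ≤ ∞)
    {U : Set P} {f : P × M → F}
    (h : ∀ p₀ : M, ContDiffOn ℝ k (fun y : P × EuclideanSpace ℝ (Fin n) =>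
      f (y.1, (extChartAt (𝓡∂ n) p₀).symm y.2)) (U ×ˢ (extChartAt (𝓡∂ n) p₀).target)) :
    ContMDiffOn (𝓘(ℝ, P).prod (𝓡∂ n)) 𝓘(ℝ, F) k f (U ×ˢ univ) := by
  rintro ⟨s, q⟩ ⟨hs, -⟩
  have h0 : ContMDiffOn (𝓘(ℝ, P).prod 𝓘(ℝ, EuclideanSpace ℝ (Fin n))) 𝓘(ℝ, F) k
      (fun y : P × EuclideanSpace ℝ (Fin n) => f (y.1, (extChartAt (𝓡∂ n) q).symm y.2))
      (U ×ˢ (extChartAt (𝓡∂ n) q).target) := by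
    have h0 := h q
    rw [← contMDiffOn_iff_contDiffOn, modelWithCornersSelf_prod, ← chartedSpaceSelf_prod] at h0
    exact h0
  have he : ContMDiffOn (𝓡∂ n) 𝓘(ℝ, EuclideanSpace ℝ (Fin n)) k (extChartAt (𝓡∂ n) q)
      (extChartAt (𝓡∂ n) q).source := by
    rw [extChartAt_source]
    exact (contMDiffOn_extChartAt (n := ∞)).of_le hk
  have h2 : ContMDiffOn (𝓘(ℝ, P).prod (𝓡∂ n)) (𝓘(ℝ, P).prod 𝓘(ℝ, EuclideanSpace ℝ (Fin n))) k
      (fun y : P × M => (y.1, extChartAt (𝓡∂ n) q y.2))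
      (U ×ˢ (extChartAt (𝓡∂ n) q).source) :=
    contMDiffOn_fst.prodMk (he.comp contMDiffOn_snd fun y hy => hy.2)
  have h3 := h0.comp h2 fun y hy => ⟨hy.1, (extChartAt (𝓡∂ n) q).map_source hy.2⟩
  have h4 : ContMDiffOn (𝓘(ℝ, P).prod (𝓡∂ n)) 𝓘(ℝ, F) k f
      (U ×ˢ (extChartAt (𝓡∂ n) q).source) := by
    refine h3.congr fun y hy => ?_
    simp only [Function.comp_apply, (extChartAt (𝓡∂ n) q).left_inv hy.2]
  refine (h4 (s, q) ⟨hs, mem_extChartAt_source q⟩).mono_of_mem_nhdsWithin ?_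
  rw [nhdsWithin_prod_eq, nhdsWithin_univ]
  exact prod_mem_prod self_mem_nhdsWithin (extChartAt_source_mem_nhds q)

/-- In each chart `jac` is a quotient of two `normDet`s of injective chart derivatives, where
`normDet` is smooth and positive. -/
theorem contMDiffOn_family_jac (hM : IsCompactSubmanifold M) {k m : WithTop ℕ∞} (hk : k ≤ ∞)
    (hm : m + 1 ≤ k) {U : Set P} {c : P → M → Amb n}
    (hc : ContMDiffOn (𝓘(ℝ, P).prod (𝓡∂ n)) 𝓘(ℝ, Amb n) k (fun x : P × M => c x.1 x.2)
      (U ×ˢ univ)) (hc1 : ∀ s ∈ U, IsEmb (c s)) :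
    ContMDiffOn (𝓘(ℝ, P).prod (𝓡∂ n)) 𝓘(ℝ, ℝ) m (fun x : P × M => jac (c x.1) x.2)
      (U ×ˢ univ) := by
  have := hM.isManifold
  have hmk : m ≤ k := le_trans (by simp) hm
  refine contMDiffOn_prod_of_chart (hmk.trans hk) fun p₀ => ?_
  have h1 := contDiffOn_family_chartDeriv hk hm hc p₀
  have h2 : ContDiffOn ℝ m (fun y : P × EuclideanSpace ℝ (Fin n) =>
      chartDeriv p₀ (fun q : M => (q : Amb n)) y.2) (U ×ˢ (extChartAt (𝓡∂ n) p₀).target) :=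
    (contDiffOn_chartDeriv hk hm (hM.inclusion.smooth.of_le hk) p₀).comp contDiffOn_snd
      fun y hy => hy.2
  have h3 : ContDiffOn ℝ m (fun y : P × EuclideanSpace ℝ (Fin n) =>
      (chartDeriv p₀ (c y.1) y.2).toLinearMap.normDet /
      (chartDeriv p₀ (fun q : M => (q : Amb n)) y.2).toLinearMap.normDet)
      (U ×ˢ (extChartAt (𝓡∂ n) p₀).target) := by
    intro y hy
    have i1 := injective_chartDeriv (hc1 y.1 hy.1) p₀ hy.2
    have i2 := injective_chartDeriv hM.inclusion p₀ hy.2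
    have j1 := (contDiffAt_normDet (k := m) i1).comp_contDiffWithinAt y (h1 y hy)
    have j2 := (contDiffAt_normDet (k := m) i2).comp_contDiffWithinAt y (h2 y hy)
    exact j1.div j2 (normDet_pos_of_injective i2).ne'
  refine h3.congr fun y hy => ?_
  rw [normDet_chartDeriv_eq_jac_mul hM (hc1 y.1 hy.1).contMDiff_one p₀ hy.2,
    mul_div_cancel_right₀]
  exact (normDet_pos_of_injective (injective_chartDeriv hM.inclusion p₀ hy.2)).ne'

theorem contMDiff_jac (hM : IsCompactSubmanifold M) {ψ : M → Amb n} (hψ : IsEmb ψ) :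
    ContMDiff (𝓡∂ n) 𝓘(ℝ, ℝ) ∞ (jac ψ) := by
  have hc : ContMDiff (𝓘(ℝ, ℝ).prod (𝓡∂ n)) 𝓘(ℝ, Amb n) ∞ (fun x : ℝ × M => ψ x.2) :=
    hψ.smooth.comp contMDiff_snd
  have h := contMDiffOn_family_jac (P := ℝ) (U := univ) (c := fun _ => ψ) hM le_rfl (m := ∞)
    (by simp) hc.contMDiffOn fun _ _ => hψ
  have h2 : ContMDiff (𝓡∂ n) (𝓘(ℝ, ℝ).prod (𝓡∂ n)) ∞ fun p : M => ((0 : ℝ), p) :=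
    contMDiff_const.prodMk contMDiff_id
  have h3 := h.comp_contMDiff h2 fun p => ⟨mem_univ _, mem_univ _⟩
  exact h3

end SmoothFamily

/-! ### Surface measure in charts and change of variables -/

section SurfaceMeasure

variable {n : ℕ} [NeZero n] {M : Set (Amb n)} [ChartedSpace (EuclideanHalfSpace n) M]

/-- The surface measure on `M` that is induced by a map `ψ : M → ℝ^{n+1}`. -/
def inducedMeasure (ψ : M → Amb n) : Measure M := (μHE[n] : Measure (Amb n)).comap ψ

theorem IsCompactSubmanifold.compactSpace (hM : IsCompactSubmanifold M) : CompactSpace M :=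
  isCompact_iff_compactSpace.1 hM.compact

theorem IsEmb.measurableEmbedding (hM : IsCompactSubmanifold M) {ψ : M → Amb n} (hψ : IsEmb ψ) :
    MeasurableEmbedding ψ :=
  have := hM.compactSpace
  (hψ.smooth.continuous.isClosedEmbedding hψ.injective).measurableEmbedding

theorem measurableSet_extChartAt_target (p₀ : M) :
    MeasurableSet (extChartAt (𝓡∂ n) p₀).target := by
  rw [extChartAt_target]
  exact ((chartAt (EuclideanHalfSpace n) p₀).open_target.preimage
    (𝓡∂ n).continuous_symm).measurableSet.inter (𝓡∂ n).isClosed_range.measurableSet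

/-- A map with continuous derivative in the chart is strictly differentiable there. -/
theorem exists_approximatesLinearOn_chartDeriv [IsManifold (𝓡∂ n) ∞ M] {ψ : M → Amb n}
    (hψ : ContMDiff (𝓡∂ n) 𝓘(ℝ, Amb n) 1 ψ) (p₀ : M) {x : EuclideanSpace ℝ (Fin n)}
    (hx : x ∈ (extChartAt (𝓡∂ n) p₀).target) {ε : NNReal} (hε : 0 < ε) :
    ∃ U ∈ 𝓝[(extChartAt (𝓡∂ n) p₀).target] x,
      ApproximatesLinearOn (ψ ∘ (extChartAt (𝓡∂ n) p₀).symm) (chartDeriv p₀ ψ x) U ε := by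
  set T := (extChartAt (𝓡∂ n) p₀).target
  have hT : T ∈ 𝓝[range (𝓡∂ n)] x := extChartAt_target_mem_nhdsWithin_of_mem hx
  have hc : ContinuousOn (chartDeriv p₀ ψ) T :=
    (contDiffOn_chartDeriv (by simp) (m := 0) (by simp) hψ p₀).continuousOn
  have h1 : ∀ᶠ y in 𝓝[range (𝓡∂ n)] x, y ∈ T ∧ ‖chartDeriv p₀ ψ y - chartDeriv p₀ ψ x‖ < ε := by
    have h2 : ∀ᶠ y in 𝓝[T] x, ‖chartDeriv p₀ ψ y - chartDeriv p₀ ψ x‖ < ε := by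
      exact (tendsto_iff_norm_sub_tendsto_zero.1 (hc x hx)).eventually (gt_mem_nhds (by simpa using hε))
    have h4 : 𝓝[T] x = 𝓝[range (𝓡∂ n)] x :=
      le_antisymm (nhdsWithin_mono _ (extChartAt_target_subset_range p₀))
        (nhdsWithin_le_of_mem hT)
    rw [h4] at h2
    exact (eventually_mem_set.2 hT).and h2
  obtain ⟨r, hr, hb⟩ := Metric.mem_nhdsWithin_iff.1 h1
  -- The chart target need not be convex. A small ball cut with the half-space is, as the mean value
  -- inequality requires.
  refine ⟨Metric.ball x r ∩ range (𝓡∂ n), ?_, ?_⟩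
  · exact nhdsWithin_mono _ (extChartAt_target_subset_range p₀)
      (inter_mem (mem_nhdsWithin_of_mem_nhds (Metric.ball_mem_nhds _ hr)) self_mem_nhdsWithin)
  · intro a ha b hbb
    refine Convex.norm_image_sub_le_of_norm_hasFDerivWithin_le' (f' := chartDeriv p₀ ψ)
      (s := Metric.ball x r ∩ range (𝓡∂ n)) (fun y hy => ?_) (fun y hy => (hb hy).2.le)
      ((convex_ball x r).inter (𝓡∂ n).convex_range) hbb ha
    exact (hasFDerivWithinAt_chartDeriv hψ p₀ (hb hy).1).mono fun z hz => (hb hz).1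

theorem inducedMeasure_image_chart (hM : IsCompactSubmanifold M) {ψ : M → Amb n} (hψ : IsEmb ψ)
    (p₀ : M) {B : Set (EuclideanSpace ℝ (Fin n))} (hB : MeasurableSet B)
    (hBT : B ⊆ (extChartAt (𝓡∂ n) p₀).target) :
    inducedMeasure ψ ((extChartAt (𝓡∂ n) p₀).symm '' B) =
      ∫⁻ x in B, ENNReal.ofReal (chartDeriv p₀ ψ x).toLinearMap.normDet := by
  have := hM.isManifold
  rw [inducedMeasure, (hψ.measurableEmbedding hM).comap_apply, image_image]
  have hcd : ContinuousOn (ψ ∘ (extChartAt (𝓡∂ n) p₀).symm) (extChartAt (𝓡∂ n) p₀).target :=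
    (contDiffOn_comp_extChartAt_symm le_rfl hψ.smooth p₀).continuousOn
  have h := euclideanHausdorffMeasure_image_eq_lintegral (measurableSet_extChartAt_target p₀)
    (X := ψ ∘ (extChartAt (𝓡∂ n) p₀).symm) (X' := chartDeriv p₀ ψ)
    (fun x hx ε hε => exists_approximatesLinearOn_chartDeriv hψ.contMDiff_one p₀ hx hε)
    (contDiffOn_chartDeriv le_rfl (m := 0) (by simp) hψ.smooth p₀).continuousOn
    (fun x hx => injective_chartDeriv hψ p₀ hx)
    (fun x hx y hy hxy => (extChartAt (𝓡∂ n) p₀).symm.injOn hx hy (hψ.injective hxy))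
    hcd hB hBT
  rw [finrank_euclideanSpace_fin] at h
  exact h

theorem continuousOn_normDet_chartDeriv [IsManifold (𝓡∂ n) ∞ M] {ψ : M → Amb n} (hψ : IsEmb ψ)
    (p₀ : M) : ContinuousOn (fun x => (chartDeriv p₀ ψ x).toLinearMap.normDet)
      (extChartAt (𝓡∂ n) p₀).target :=
  continuous_normDet.comp_continuousOn
    (contDiffOn_chartDeriv le_rfl (m := 0) (by simp) hψ.smooth p₀).continuousOn

theorem inducedMeasure_restrict_source (hM : IsCompactSubmanifold M) {ψ : M → Amb n}
    (hψ : IsEmb ψ) (p₀ : M) :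
    (inducedMeasure ψ).restrict (extChartAt (𝓡∂ n) p₀).source =
      (((volume.restrict (extChartAt (𝓡∂ n) p₀).target).withDensity
        fun x => ENNReal.ofReal (chartDeriv p₀ ψ x).toLinearMap.normDet)).map
          (extChartAt (𝓡∂ n) p₀).symm := by
  have := hM.isManifold
  set e := extChartAt (𝓡∂ n) p₀
  have hT : MeasurableSet e.target := measurableSet_extChartAt_target p₀
  have hec : ContinuousOn e.symm e.target := continuousOn_extChartAt_symm p₀
  have hem : AEMeasurable e.symm ((volume.restrict e.target).withDensity
        fun x => ENNReal.ofReal (chartDeriv p₀ ψ x).toLinearMap.normDet) :=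
    (hec.aemeasurable hT).mono_ac (withDensity_absolutelyContinuous _ _)
  ext B hB
  classical
  have hmeas : MeasurableSet (e.target ∩ e.symm ⁻¹' B) := by
    have := (hec.measurable_piecewise (g := fun _ => p₀) continuousOn_const hT)
    have h2 := (this hB).inter hT
    convert h2 using 1
    ext x
    constructor
    · rintro ⟨h1, h2⟩
      exact ⟨by simpa [piecewise_eq_of_mem _ _ _ h1] using h2, h1⟩
    · rintro ⟨h1, h2⟩
      refine ⟨h2, ?_⟩
      simpa [piecewise_eq_of_mem _ _ _ h2] using h1
  rw [Measure.restrict_apply hB, Measure.map_apply_of_aemeasurable hem hB]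
  have himg : B ∩ e.source = e.symm '' (e.target ∩ e.symm ⁻¹' B) := by
    ext q
    constructor
    · rintro ⟨h1, h2⟩
      exact ⟨e q, ⟨e.map_source h2, by simpa [e.left_inv h2] using h1⟩, e.left_inv h2⟩
    · rintro ⟨x, ⟨h1, h2⟩, rfl⟩
      exact ⟨h2, e.map_target h1⟩
  rw [himg, inducedMeasure_image_chart hM hψ p₀ hmeas inter_subset_left]
  rw [withDensity_apply', Measure.restrict_restrict' hT, inter_comm]

theorem setLIntegral_source (hM : IsCompactSubmanifold M) {ψ : M → Amb n}
    (hψ : IsEmb ψ) (p₀ : M) {u : M → ENNReal} (hu : Measurable u) :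
    ∫⁻ p in (extChartAt (𝓡∂ n) p₀).source, u p ∂(inducedMeasure ψ) =
      ∫⁻ x in (extChartAt (𝓡∂ n) p₀).target,
        ENNReal.ofReal (chartDeriv p₀ ψ x).toLinearMap.normDet *
          u ((extChartAt (𝓡∂ n) p₀).symm x) := by
  have := hM.isManifold
  have hT := measurableSet_extChartAt_target p₀
  have hem := (continuousOn_extChartAt_symm (I := 𝓡∂ n) p₀).aemeasurable (μ := volume) hT
  have hd := ((continuousOn_normDet_chartDeriv hψ p₀).aemeasurable (μ := volume) hT).ennreal_ofReal
  rw [inducedMeasure_restrict_source hM hψ p₀, lintegral_map' hu.aemeasurable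
    (hem.mono_ac (withDensity_absolutelyContinuous _ _))]
  exact lintegral_withDensity_eq_lintegral_mul₀ hd (hu.comp_aemeasurable hem)

theorem integral_chart (hM : IsCompactSubmanifold M) {ψ : M → Amb n}
    (hψ : IsEmb ψ) (p₀ : M) {u : M → ℝ} (hu : Measurable u)
    (hu0 : ∀ p, p ∉ (extChartAt (𝓡∂ n) p₀).source → u p = 0) :
    ∫ p, u p ∂(inducedMeasure ψ) =
      ∫ x in (extChartAt (𝓡∂ n) p₀).target,
        (chartDeriv p₀ ψ x).toLinearMap.normDet * u ((extChartAt (𝓡∂ n) p₀).symm x) := by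
  have := hM.isManifold
  have hT := measurableSet_extChartAt_target p₀
  have hem := (continuousOn_extChartAt_symm (I := 𝓡∂ n) p₀).aemeasurable (μ := volume) hT
  have hd := (continuousOn_normDet_chartDeriv hψ p₀).aemeasurable (μ := volume) hT
  rw [← setIntegral_eq_integral_of_forall_compl_eq_zero hu0,
    inducedMeasure_restrict_source hM hψ p₀,
    integral_map (hem.mono_ac (withDensity_absolutelyContinuous _ _)) hu.aestronglyMeasurable,
    integral_withDensity_eq_integral_toReal_smul₀ hd.ennreal_ofReal (by simp)]
  refine integral_congr_ae (Eventually.of_forall fun x => ?_)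
  simp [ENNReal.toReal_ofReal (LinearMap.normDet_nonneg _)]

/-- **Change of variables**: the surface measure of `ψ(M)` pulled back to `M`. -/
theorem inducedMeasure_eq_withDensity (hM : IsCompactSubmanifold M) {ψ : M → Amb n}
    (hψ : IsEmb ψ) :
    inducedMeasure ψ = (inducedMeasure fun q : M => (q : Amb n)).withDensity
      fun p => ENNReal.ofReal (jac ψ p) := by
  have := hM.isManifold
  have hJ : Measurable fun p => ENNReal.ofReal (jac ψ p) :=
    (contMDiff_jac hM hψ).continuous.measurable.ennreal_ofReal
  have hloc : ∀ p₀ : M, ∀ B ⊆ (extChartAt (𝓡∂ n) p₀).source, MeasurableSet B →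
      inducedMeasure ψ B = ((inducedMeasure fun q : M => (q : Amb n)).withDensity
        fun p => ENNReal.ofReal (jac ψ p)) B := by
    intro p₀ B hB hBm
    have e1 : inducedMeasure ψ B = ∫⁻ p in (extChartAt (𝓡∂ n) p₀).source,
        B.indicator 1 p ∂(inducedMeasure ψ) := by
      rw [lintegral_indicator_one hBm, Measure.restrict_apply hBm, inter_eq_left.2 hB]
    have e2 : ((inducedMeasure fun q : M => (q : Amb n)).withDensity
        fun p => ENNReal.ofReal (jac ψ p)) B = ∫⁻ p in (extChartAt (𝓡∂ n) p₀).source,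
        B.indicator (fun p => ENNReal.ofReal (jac ψ p)) p
          ∂(inducedMeasure fun q : M => (q : Amb n)) := by
      rw [withDensity_apply _ hBm, lintegral_indicator hBm, Measure.restrict_restrict hBm,
        inter_eq_left.2 hB]
    rw [e1, e2, setLIntegral_source hM hψ p₀ (measurable_one.indicator hBm),
      setLIntegral_source hM hM.inclusion p₀ (hJ.indicator hBm)]
    refine setLIntegral_congr_fun (measurableSet_extChartAt_target p₀) fun x hx => ?_
    rw [normDet_chartDeriv_eq_jac_mul hM hψ.contMDiff_one p₀ hx]
    by_cases hxB : (extChartAt (𝓡∂ n) p₀).symm x ∈ B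
    · rw [indicator_of_mem hxB, indicator_of_mem hxB, Pi.one_apply, mul_one, mul_comm,
        ENNReal.ofReal_mul (LinearMap.normDet_nonneg _)]
    · rw [indicator_of_notMem hxB, indicator_of_notMem hxB, mul_zero, mul_zero]
  ext A hA
  refine le_antisymm ?_ ?_
  · have h := measure_le_of_locally_le (μ := inducedMeasure ψ)
      (ν := (inducedMeasure fun q : M => (q : Amb n)).withDensity
        fun p => ENNReal.ofReal (jac ψ p)) (S := univ) 1 (fun p₀ _ => ⟨(extChartAt (𝓡∂ n) p₀).source,
          mem_nhdsWithin_of_mem_nhds (extChartAt_source_mem_nhds p₀),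
          fun B hB _ hBm => by rw [one_mul, hloc p₀ B hB hBm]⟩) hA (subset_univ _)
    rwa [one_mul] at h
  · have h := measure_le_of_locally_le (ν := inducedMeasure ψ)
      (μ := (inducedMeasure fun q : M => (q : Amb n)).withDensity
        fun p => ENNReal.ofReal (jac ψ p)) (S := univ) 1 (fun p₀ _ => ⟨(extChartAt (𝓡∂ n) p₀).source,
          mem_nhdsWithin_of_mem_nhds (extChartAt_source_mem_nhds p₀),
          fun B hB _ hBm => by rw [one_mul, hloc p₀ B hB hBm]⟩) hA (subset_univ _)
    rwa [one_mul] at h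

/-- Near each point the chart density is bounded on a set of finite volume, and M is compact. -/
theorem isFiniteMeasure_inducedMeasure (hM : IsCompactSubmanifold M) {ψ : M → Amb n}
    (hψ : IsEmb ψ) : IsFiniteMeasure (inducedMeasure ψ) := by
  have := hM.isManifold
  have := hM.compactSpace
  refine ⟨isCompact_univ.measure_lt_top_of_nhdsWithin fun q _ => ?_⟩
  set e := extChartAt (𝓡∂ n) q
  set m := fun x => (chartDeriv q ψ x).toLinearMap.normDet
  have hqT : e q ∈ e.target := e.map_source (mem_extChartAt_source q)
  have h1 : {x | m x < m (e q) + 1} ∈ 𝓝[e.target] (e q) :=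
    (continuousOn_normDet_chartDeriv hψ q _ hqT).eventually (gt_mem_nhds (lt_add_one _))
  obtain ⟨O, hO, hqO, hOm⟩ := mem_nhdsWithin.1 h1
  set B := e.target ∩ (O ∩ Metric.ball (e q) 1)
  refine ⟨e.symm '' B, ?_, ?_⟩
  · rw [nhdsWithin_univ]
    have hc : e ⁻¹' (O ∩ Metric.ball (e q) 1) ∈ 𝓝 q :=
      (continuousAt_extChartAt q).preimage_mem_nhds
        (inter_mem (hO.mem_nhds hqO) (Metric.ball_mem_nhds _ one_pos))
    filter_upwards [hc, extChartAt_source_mem_nhds (I := 𝓡∂ n) q] with p hp hps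
    exact ⟨e p, ⟨e.map_source hps, hp⟩, e.left_inv hps⟩
  · have hBm : MeasurableSet B := (measurableSet_extChartAt_target q).inter
      (hO.measurableSet.inter Metric.isOpen_ball.measurableSet)
    rw [inducedMeasure_image_chart hM hψ q hBm inter_subset_left]
    calc ∫⁻ x in B, ENNReal.ofReal (m x)
        ≤ ∫⁻ _ in B, ENNReal.ofReal (m (e q) + 1) :=
          setLIntegral_mono' hBm fun x hx => ENNReal.ofReal_le_ofReal
            (hOm ⟨hx.2.1, hx.1⟩ : m x < m (e q) + 1).le
      _ = ENNReal.ofReal (m (e q) + 1) * volume B := setLIntegral_const _ _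
      _ ≤ ENNReal.ofReal (m (e q) + 1) * volume (Metric.ball (e q) 1) := by
          gcongr
          exact inter_subset_right.trans inter_subset_right
      _ < ⊤ := ENNReal.mul_lt_top ENNReal.ofReal_lt_top measure_ball_lt_top

/-- The chart density is positive, and a chart target contains a nonempty open set even at a
boundary point, because the half-space lies in the closure of its interior. -/
theorem inducedMeasure_ne_zero (hM : IsCompactSubmanifold M) {ψ : M → Amb n}
    (hψ : IsEmb ψ) : inducedMeasure ψ ≠ 0 := by
  have := hM.isManifold
  obtain ⟨q⟩ : Nonempty M := hM.pathConnected.nonempty.to_subtype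
  intro h0
  set e := extChartAt (𝓡∂ n) q
  have hqT : e q ∈ e.target := e.map_source (mem_extChartAt_source q)
  have h1 := inducedMeasure_image_chart hM hψ q (measurableSet_extChartAt_target q) subset_rfl
  rw [h0, Measure.coe_zero, Pi.zero_apply] at h1
  have hm := ((continuousOn_normDet_chartDeriv hψ q).aemeasurable (μ := volume)
    (measurableSet_extChartAt_target q)).ennreal_ofReal
  have h2 := (lintegral_eq_zero_iff' hm).1 h1.symm
  have h3 : volume e.target = 0 := by
    rw [Filter.EventuallyEq, ae_restrict_iff' (measurableSet_extChartAt_target q)] at h2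
    refine measure_mono_null ?_ h2
    intro x hx hx2
    have h4 := hx2 hx
    have h5 := normDet_pos_of_injective (injective_chartDeriv hψ q hx)
    simp only [Pi.zero_apply, ENNReal.ofReal_eq_zero] at h4
    linarith
  obtain ⟨O, hO, hqO, hOT⟩ := mem_nhdsWithin.1 (extChartAt_target_mem_nhdsWithin (I := 𝓡∂ n) q)
  have hcl := (𝓡∂ n).range_subset_closure_interior (extChartAt_target_subset_range q hqT)
  obtain ⟨y, hyO, hyI⟩ := mem_closure_iff.1 hcl O hO hqO
  have h6 : volume (O ∩ interior (range (𝓡∂ n))) ≠ 0 :=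
    ((hO.inter isOpen_interior).measure_pos volume ⟨y, hyO, hyI⟩).ne'
  exact h6 (measure_mono_null (fun z hz => hOT ⟨hz.1, interior_subset hz.2⟩) h3)

end SurfaceMeasure

/-! ### The objective as an integral over M -/

section Objective

variable {n : ℕ} [NeZero n] {M : Set (Amb n)} [ChartedSpace (EuclideanHalfSpace n) M]

/-- The surface measure of `M`. -/
def surfaceMeasure (M : Set (Amb n)) : Measure M :=
  inducedMeasure fun q : M => (q : Amb n)

theorem setIntegral_range (hM : IsCompactSubmanifold M) {ψ : M → Amb n} (hψ : IsEmb ψ)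
    (u : Amb n → ℝ) :
    ∫ s in range ψ, u s ∂μHE[n] = ∫ p, jac ψ p * u (ψ p) ∂(surfaceMeasure M) := by
  have hemb := hψ.measurableEmbedding hM
  rw [← hemb.map_comap, hemb.integral_map]
  change ∫ p, u (ψ p) ∂(inducedMeasure ψ) = _
  rw [inducedMeasure_eq_withDensity hM hψ, integral_withDensity_eq_integral_toReal_smul
    (contMDiff_jac hM hψ).continuous.measurable.ennreal_ofReal (by simp)]
  refine integral_congr_ae (Eventually.of_forall fun p => ?_)
  simp [ENNReal.toReal_ofReal (jac_pos hM hψ p).le]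

/-- The integrand of the objective functional, pulled back to `M`. -/
def density (g : M → ℝ) (f : (M → Amb n) → Amb n → ℝ) (ψ : M → Amb n) (p : M) : ℝ :=
  1 / 2 * (jac ψ p * (g p / jac ψ p - f ψ (ψ p)) ^ 2)

theorem nodeDensity_apply (hM : IsCompactSubmanifold M) {g : M → ℝ}
    {τ : (p : M) → Fin n → TangentSpace (𝓡∂ n) p} (hτ : IsFrame τ) {ψ : M → Amb n}
    {τψ : Amb n → Fin n → Amb n} (hψ : IsEmb ψ) (hτψ : IsImageFrame τ ψ τψ) (p : M) :
    nodeDensity g τ τψ ψ (ψ p) = g p / jac ψ p := by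
  rw [nodeDensity, hψ.injective.extend_apply, det_covMatrix_eq_jac hM hτ hτψ]
  ring

/-- The moving domain ψ(M) and the frames disappear together, leaving an integral against a fixed
finite measure that can be differentiated under the integral sign. -/
theorem objective_eq (hM : IsCompactSubmanifold M) {g : M → ℝ}
    {f : (M → Amb n) → Amb n → ℝ} {τ : (p : M) → Fin n → TangentSpace (𝓡∂ n) p}
    (hτ : IsFrame τ) {τφ : (M → Amb n) → Amb n → Fin n → Amb n} {ψ : M → Amb n} (hψ : IsEmb ψ)
    (hτψ : IsImageFrame τ ψ (τφ ψ)) :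
    objective g f τ τφ ψ = ∫ p, density g f ψ p ∂(surfaceMeasure M) := by
  rw [objective, setIntegral_range hM hψ, ← integral_const_mul]
  refine integral_congr_ae (Eventually.of_forall fun p => ?_)
  simp only [density, nodeDensity_apply hM hτ hψ hτψ]

/-- The normalization transported to M, in the form that rules out a nonzero constant defect. -/
theorem integral_target_eq (hM : IsCompactSubmanifold M) {g : M → ℝ}
    {f : (M → Amb n) → Amb n → ℝ} (hf : IsTarget g f) {ψ : M → Amb n} (hψ : IsPreShape ψ) :
    ∫ p, jac ψ p * f ψ (ψ p) ∂(surfaceMeasure M) = ∫ p, g p ∂(surfaceMeasure M) := by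
  rw [← setIntegral_range hM hψ.isEmb, hf.normalized ψ hψ]
  have h := setIntegral_range hM hM.inclusion (Function.extend (fun p : M => (p : Amb n)) g 0)
  rw [Subtype.range_coe] at h
  rw [h]
  refine integral_congr_ae (Eventually.of_forall fun p => ?_)
  simp only
  rw [hM.inclusion.injective.extend_apply, jac,
    div_self (hM.inclusion.normDet_diffModel_pos p).ne', one_mul]

end Objective

/-! ### Differentiation under the integral sign -/

section ParametricIntegral

variable {n : ℕ} [NeZero n] {M : Set (Amb n)} [ChartedSpace (EuclideanHalfSpace n) M]
  {P : Type*} [NormedAddCommGroup P] [NormedSpace ℝ P]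

/-- In each chart this is a partial derivative of a jointly C¹ function. The parametric rule is
applied within U, where openness identifies it with the full derivative. -/
theorem continuousOn_fderiv_param [IsManifold (𝓡∂ n) ∞ M] {U : Set P} (hU : IsOpen U)
    {H : P → M → ℝ}
    (hH : ContMDiffOn (𝓘(ℝ, P).prod (𝓡∂ n)) 𝓘(ℝ, ℝ) 1 (fun x : P × M => H x.1 x.2)
      (U ×ˢ univ)) :
    ContinuousOn (fun x : P × M => fderiv ℝ (fun s => H s x.2) x.1) (U ×ˢ univ) := by
  have h := contMDiffOn_prod_of_chart (M := M) (k := 0) (by simp) (U := U)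
    (f := fun x : P × M => fderiv ℝ (fun s => H s x.2) x.1) fun p₀ => ?_
  · exact h.continuousOn
  intro y hy
  set T := (extChartAt (𝓡∂ n) p₀).target
  have h1 : ContDiffWithinAt ℝ 0 (fun y : P × EuclideanSpace ℝ (Fin n) =>
      fderivWithin ℝ (fun s => H s ((extChartAt (𝓡∂ n) p₀).symm y.2)) U y.1) (U ×ˢ T) y := by
    refine ContDiffWithinAt.fderivWithin (n := 1) (t := U)
      (f := fun (y : P × EuclideanSpace ℝ (Fin n)) s => H s ((extChartAt (𝓡∂ n) p₀).symm y.2))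
      (g := fun y => y.1) ?_ contDiffWithinAt_fst hU.uniqueDiffOn (by simp) hy fun z hz => hz.1
    have h := contDiffOn_family_chart (by simp) hH p₀ y hy
    exact ContDiffWithinAt.comp
      (f := fun z : (P × EuclideanSpace ℝ (Fin n)) × P => (z.2, z.1.2))
      (y, y.1) h (by fun_prop) fun z hz => ⟨hz.2, hz.1.2⟩
  exact h1.congr (fun z hz => (fderivWithin_of_isOpen hU hz.1).symm)
    (fderivWithin_of_isOpen hU hy.1).symm

theorem differentiableAt_param [IsManifold (𝓡∂ n) ∞ M] {U : Set P} (hU : IsOpen U)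
    {H : P → M → ℝ}
    (hH : ContMDiffOn (𝓘(ℝ, P).prod (𝓡∂ n)) 𝓘(ℝ, ℝ) 1 (fun x : P × M => H x.1 x.2)
      (U ×ˢ univ)) {s : P} (hs : s ∈ U) (p : M) :
    DifferentiableAt ℝ (fun s => H s p) s := by
  have h := contDiffOn_family_chart (by simp) hH p
  have h2 : ContDiffOn ℝ 1 (fun s : P => H s ((extChartAt (𝓡∂ n) p).symm (extChartAt (𝓡∂ n) p p)))
      U := h.comp (f := fun s : P => (s, extChartAt (𝓡∂ n) p p)) (by fun_prop)
        fun z hz => ⟨hz, (extChartAt (𝓡∂ n) p).map_source (mem_extChartAt_source p)⟩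
  rw [extChartAt_to_inv] at h2
  exact (h2.contDiffAt (hU.mem_nhds hs)).differentiableAt one_ne_zero

theorem integrable_of_continuous {X G : Type*} [TopologicalSpace X] [CompactSpace X]
    [MeasurableSpace X] [OpensMeasurableSpace X] [NormedAddCommGroup G] (μ : Measure X)
    [IsFiniteMeasure μ] {u : X → G} (hu : Continuous u) : Integrable u μ :=
  hu.integrable_of_hasCompactSupport (HasCompactSupport.of_compactSpace u)

/-- Differentiation under the integral over a compact manifold. -/
theorem hasFDerivAt_integral_param [IsManifold (𝓡∂ n) ∞ M] [CompactSpace M] (μ : Measure M)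
    [IsFiniteMeasure μ] {U : Set P} (hU : IsOpen U) {H : P → M → ℝ}
    (hH : ContMDiffOn (𝓘(ℝ, P).prod (𝓡∂ n)) 𝓘(ℝ, ℝ) 1 (fun x : P × M => H x.1 x.2)
      (U ×ˢ univ)) {s₀ : P} (hs₀ : s₀ ∈ U) :
    Continuous (fun p => fderiv ℝ (fun s => H s p) s₀) ∧
    HasFDerivAt (fun s => ∫ p, H s p ∂μ) (∫ p, fderiv ℝ (fun s => H s p) s₀ ∂μ) s₀ := by
  have hD := continuousOn_fderiv_param hU hH
  have hUM : IsOpen (U ×ˢ (univ : Set M)) := hU.prod isOpen_univ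
  have hcD : ∀ s ∈ U, Continuous fun p => fderiv ℝ (fun s => H s p) s := fun s hs =>
    hD.comp_continuous (f := fun p : M => (s, p)) (by fun_prop) fun p => ⟨hs, mem_univ _⟩
  have hcH : ∀ s ∈ U, Continuous fun p => H s p := fun s hs =>
    hH.continuousOn.comp_continuous (f := fun p : M => (s, p)) (by fun_prop)
      fun p => ⟨hs, mem_univ _⟩
  refine ⟨hcD s₀ hs₀, ?_⟩
  obtain ⟨C, hC⟩ := isCompact_univ.exists_bound_of_continuousOn (hcD s₀ hs₀).continuousOn
  -- Compactness of M makes the neighbourhood of s₀ uniform in p, so the constant C + 1 dominates.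
  have hnear : ∀ᶠ s in 𝓝 s₀, ∀ p ∈ (univ : Set M), ‖fderiv ℝ (fun s => H s p) s‖ < C + 1 := by
    refine isCompact_univ.eventually_forall_of_forall_eventually fun p _ => ?_
    have hca : ContinuousAt (fun x : P × M => fderiv ℝ (fun s => H s x.2) x.1) (s₀, p) :=
      hD.continuousAt (hUM.mem_nhds ⟨hs₀, mem_univ _⟩)
    exact hca.norm.eventually (gt_mem_nhds ((hC p (mem_univ _)).trans_lt (lt_add_one _)))
  have hnU := hnear.and (hU.mem_nhds hs₀)
  refine hasFDerivAt_integral_of_dominated_of_fderiv_le (bound := fun _ => C + 1)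
    (F' := fun s p => fderiv ℝ (fun s => H s p) s) hnU ?_ (integrable_of_continuous μ (hcH s₀ hs₀))
    (integrable_of_continuous μ (hcD s₀ hs₀)).aestronglyMeasurable ?_ (integrable_const _) ?_
  · filter_upwards [hnU] with s hs
    exact (integrable_of_continuous μ (hcH s hs.2)).aestronglyMeasurable
  · exact Eventually.of_forall fun p s hs => (hs.1 p (mem_univ _)).le
  · exact Eventually.of_forall fun p s hs => (differentiableAt_param hU hH hs.2 p).hasFDerivAt

end ParametricIntegral

/-! ### Regularity of the integrand and stability of embeddings -/

section Families

variable {n : ℕ} [NeZero n] {M : Set (Amb n)} [ChartedSpace (EuclideanHalfSpace n) M]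

/-- Only f limits the regularity to C¹: the Jacobian is smooth along the family, and dividing by it
is harmless because it is positive. -/
theorem contMDiffOn_density (hM : IsCompactSubmanifold M) {g : M → ℝ}
    (hg : ContMDiff (𝓡∂ n) 𝓘(ℝ, ℝ) ∞ g) {f : (M → Amb n) → Amb n → ℝ} (hf : DependsC1 f) {k : ℕ}
    {U : Set (EuclideanSpace ℝ (Fin k))} {c : EuclideanSpace ℝ (Fin k) → M → Amb n}
    (hU : IsOpen U)
    (hc : ContMDiffOn (𝓘(ℝ, EuclideanSpace ℝ (Fin k)).prod (𝓡∂ n)) 𝓘(ℝ, Amb n) ∞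
      (fun x : EuclideanSpace ℝ (Fin k) × M => c x.1 x.2) (U ×ˢ univ))
    (hpre : ∀ s ∈ U, IsPreShape (c s)) :
    ContMDiffOn (𝓘(ℝ, EuclideanSpace ℝ (Fin k)).prod (𝓡∂ n)) 𝓘(ℝ, ℝ) 1
      (fun x : EuclideanSpace ℝ (Fin k) × M => density g f (c x.1) x.2) (U ×ˢ univ) := by
  have := hM.isManifold
  have hJ := contMDiffOn_family_jac hM (m := 1) le_rfl (by norm_cast) hc fun s hs => (hpre s hs).isEmb
  have hF := hf k U c hU hc hpre
  refine contMDiffOn_prod_of_chart (mod_cast le_top)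
    (f := fun x : EuclideanSpace ℝ (Fin k) × M => density g f (c x.1) x.2) fun p₀ => ?_
  have h1 := contDiffOn_family_chart (by simp) (c := fun s p => jac (c s) p) hJ p₀
  have h2 := contDiffOn_family_chart (by simp) (c := fun s p => f (c s) (c s p)) hF p₀
  have h3 : ContDiffOn ℝ 1 (fun y : EuclideanSpace ℝ (Fin k) × EuclideanSpace ℝ (Fin n) =>
      g ((extChartAt (𝓡∂ n) p₀).symm y.2)) (U ×ˢ (extChartAt (𝓡∂ n) p₀).target) :=
    (contDiffOn_comp_extChartAt_symm (by simp) (hg.of_le (mod_cast le_top)) p₀).comp contDiffOn_snd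
      fun y hy => hy.2
  have h4 := h3.div h1 fun y hy => (jac_pos hM (hpre y.1 hy.1).isEmb _).ne'
  exact contDiffOn_const.mul (h1.mul ((h4.sub h2).pow 2))

theorem contMDiff_family_apply {P : Type*} [NormedAddCommGroup P] [NormedSpace ℝ P] {U : Set P}
    {c : P → M → Amb n} {k : WithTop ℕ∞}
    (hc : ContMDiffOn (𝓘(ℝ, P).prod (𝓡∂ n)) 𝓘(ℝ, Amb n) k (fun x : P × M => c x.1 x.2)
      (U ×ˢ univ)) {s : P} (hs : s ∈ U) : ContMDiff (𝓡∂ n) 𝓘(ℝ, Amb n) k (c s) := by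
  have h2 : ContMDiff (𝓡∂ n) (𝓘(ℝ, P).prod (𝓡∂ n)) k fun p : M => (s, p) :=
    contMDiff_const.prodMk contMDiff_id
  exact hc.comp_contMDiff h2 fun p => ⟨hs, mem_univ _⟩

section Stability

variable {P : Type*} [NormedAddCommGroup P] [NormedSpace ℝ P] {U : Set P} {c : P → M → Amb n}

theorem exists_nhds_norm_chartDeriv_sub_lt (hM : IsCompactSubmanifold M) (hU : IsOpen U)
    (hc : ContMDiffOn (𝓘(ℝ, P).prod (𝓡∂ n)) 𝓘(ℝ, Amb n) ∞ (fun x : P × M => c x.1 x.2)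
      (U ×ˢ univ)) {s₀ : P} (hs₀ : s₀ ∈ U) (p : M) {ε : ℝ} (hε : 0 < ε) :
    ∃ W ∈ 𝓝 s₀, ∃ r > 0, ∀ s ∈ W, ∀ x ∈ Metric.ball (extChartAt (𝓡∂ n) p p) r ∩ range (𝓡∂ n),
      ‖chartDeriv p (c s) x - chartDeriv p (c s₀) (extChartAt (𝓡∂ n) p p)‖ < ε ∧ s ∈ U ∧
        x ∈ (extChartAt (𝓡∂ n) p).target := by
  have := hM.isManifold
  set e := extChartAt (𝓡∂ n) p
  have hp : e p ∈ e.target := e.map_source (mem_extChartAt_source p)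
  have hD : ContinuousOn (fun y : P × EuclideanSpace ℝ (Fin n) =>
      chartDeriv p (c y.1) y.2) (U ×ˢ e.target) :=
    (contDiffOn_family_chartDeriv le_rfl (m := 0) (by simp) hc p).continuousOn
  have h1 : ∀ᶠ y in 𝓝[U ×ˢ e.target] (s₀, e p),
      ‖chartDeriv p (c y.1) y.2 - chartDeriv p (c s₀) (e p)‖ < ε :=
    (tendsto_iff_norm_sub_tendsto_zero.1 (hD (s₀, e p) ⟨hs₀, hp⟩)).eventually (gt_mem_nhds hε)
  have h2 : 𝓝[U ×ˢ e.target] (s₀, e p) = 𝓝[univ ×ˢ range (𝓡∂ n)] (s₀, e p) := by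
    rw [nhdsWithin_prod_eq, nhdsWithin_prod_eq, hU.nhdsWithin_eq hs₀, nhdsWithin_univ]
    congr 1
    exact le_antisymm (nhdsWithin_mono _ (extChartAt_target_subset_range p))
      (nhdsWithin_le_of_mem (extChartAt_target_mem_nhdsWithin_of_mem hp))
  have h3 : ∀ᶠ y in 𝓝[U ×ˢ e.target] (s₀, e p), y ∈ U ×ˢ e.target := self_mem_nhdsWithin
  have h4 := h1.and h3
  rw [h2, nhdsWithin_prod_eq, nhdsWithin_univ] at h4
  obtain ⟨W, hW, Y, hY, hWY⟩ := mem_prod_iff.1 h4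
  obtain ⟨r, hr, hb⟩ := Metric.mem_nhdsWithin_iff.1 hY
  refine ⟨W, hW, r, hr, fun s hs x hx => ?_⟩
  have h5 : (s, x) ∈ W ×ˢ Y := ⟨hs, hb hx⟩
  obtain ⟨h6, h7, h8⟩ := hWY h5
  exact ⟨h6, h7, h8⟩

/-- In a chart c_s differs from L = D c_{s₀} at p by a map with Lipschitz constant 1/(2K), while ‖L
u‖ ≥ ‖u‖/K, so collisions are impossible. What matters is that N does not depend on s. -/
theorem exists_nhds_injOn (hM : IsCompactSubmanifold M) (hU : IsOpen U)
    (hc : ContMDiffOn (𝓘(ℝ, P).prod (𝓡∂ n)) 𝓘(ℝ, Amb n) ∞ (fun x : P × M => c x.1 x.2)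
      (U ×ˢ univ)) {s₀ : P} (hs₀ : s₀ ∈ U) (h0 : IsEmb (c s₀)) (p : M) :
    ∃ W ∈ 𝓝 s₀, ∃ N ∈ 𝓝 p, ∀ s ∈ W, InjOn (c s) N := by
  have := hM.isManifold
  set e := extChartAt (𝓡∂ n) p with he
  have hp : e p ∈ e.target := e.map_source (mem_extChartAt_source p)
  obtain ⟨L, hLdef⟩ : ∃ L, L = chartDeriv p (c s₀) (e p) := ⟨_, rfl⟩
  have hL : Function.Injective L := hLdef ▸ injective_chartDeriv h0 p hp
  obtain ⟨K, hK, hLK⟩ := L.toLinearMap.exists_antilipschitzWith (LinearMap.ker_eq_bot.2 hL)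
  have hK' : (0 : ℝ) < K := hK
  obtain ⟨W, hW, r, hr, hball⟩ := exists_nhds_norm_chartDeriv_sub_lt hM hU hc hs₀ p
    (ε := 1 / (2 * K)) (by positivity)
  rw [← he, ← hLdef] at hball
  refine ⟨W, hW, (e ⁻¹' Metric.ball (e p) r) ∩ e.source,
    inter_mem ((continuousAt_extChartAt p).preimage_mem_nhds (Metric.ball_mem_nhds _ hr))
      (extChartAt_source_mem_nhds p), fun s hs => ?_⟩
  rintro a ⟨ha, hae⟩ b ⟨hb, hbe⟩ hab
  have hra : e a ∈ range (𝓡∂ n) := extChartAt_target_subset_range p (e.map_source hae)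
  have hrb : e b ∈ range (𝓡∂ n) := extChartAt_target_subset_range p (e.map_source hbe)
  have hsU : s ∈ U := (hball s hs _ ⟨ha, hra⟩).2.1
  have hcs := (contMDiff_family_apply hc hsU).of_le (show (1 : WithTop ℕ∞) ≤ ∞ by simp)
  have hmv := Convex.norm_image_sub_le_of_norm_hasFDerivWithin_le'
    (f := c s ∘ e.symm) (f' := chartDeriv p (c s)) (φ := L)
    (s := Metric.ball (e p) r ∩ range (𝓡∂ n)) (x := e b) (y := e a)
    (fun y hy => (hasFDerivWithinAt_chartDeriv hcs p (hball s hs y hy).2.2).mono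
      fun z hz => (hball s hs z hz).2.2) (fun y hy => (hball s hs y hy).1.le)
    ((convex_ball _ r).inter (𝓡∂ n).convex_range) ⟨hb, hrb⟩ ⟨ha, hra⟩
  rw [Function.comp_apply, Function.comp_apply, e.left_inv hae, e.left_inv hbe, hab, sub_self,
    zero_sub, norm_neg] at hmv
  have hal := hLK.le_mul_dist (e a) (e b)
  rw [dist_eq_norm, dist_eq_norm, ← map_sub] at hal
  have : ‖e a - e b‖ ≤ 1 / 2 * ‖e a - e b‖ := by
    calc ‖e a - e b‖ ≤ K * ‖L (e a - e b)‖ := hal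
      _ ≤ K * (1 / (2 * K) * ‖e a - e b‖) := by gcongr
      _ = 1 / 2 * ‖e a - e b‖ := by field_simp
  have h5 : ‖e a - e b‖ = 0 := le_antisymm (by linarith) (norm_nonneg _)
  exact e.injOn hae hbe (sub_eq_zero.1 (norm_eq_zero.1 h5))

/-- Injectivity is positivity of `normDet`, an open condition jointly in s and p; compactness of M
makes it uniform in p. -/
theorem eventually_injective_diffModel (hM : IsCompactSubmanifold M) (hU : IsOpen U)
    (hc : ContMDiffOn (𝓘(ℝ, P).prod (𝓡∂ n)) 𝓘(ℝ, Amb n) ∞ (fun x : P × M => c x.1 x.2)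
      (U ×ˢ univ)) {s₀ : P} (hs₀ : s₀ ∈ U) (h0 : IsEmb (c s₀)) :
    ∀ᶠ s in 𝓝 s₀, ∀ p : M, Function.Injective (diffModel (c s) p) := by
  have := hM.isManifold
  have := hM.compactSpace
  have h : ∀ᶠ s in 𝓝 s₀, ∀ p ∈ (univ : Set M), Function.Injective (diffModel (c s) p) := by
    refine isCompact_univ.eventually_forall_of_forall_eventually fun p _ => ?_
    set e := extChartAt (𝓡∂ n) p
    have hp : e p ∈ e.target := e.map_source (mem_extChartAt_source p)
    have hD : ContinuousOn (fun y : P × EuclideanSpace ℝ (Fin n) =>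
        chartDeriv p (c y.1) y.2) (U ×ˢ e.target) :=
      (contDiffOn_family_chartDeriv le_rfl (m := 0) (by simp) hc p).continuousOn
    have hcont : ContinuousOn (fun x : P × M => chartDeriv p (c x.1) (e x.2))
        (U ×ˢ e.source) := by
      refine hD.comp (f := fun x : P × M => (x.1, e x.2)) ?_
        fun x hx => ⟨hx.1, e.map_source hx.2⟩
      exact continuousOn_fst.prodMk
        ((continuousOn_extChartAt p).comp continuousOn_snd fun x hx => hx.2)
    have hmem : U ×ˢ e.source ∈ 𝓝 (s₀, p) :=
      prod_mem_nhds (hU.mem_nhds hs₀) (extChartAt_source_mem_nhds p)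
    have hca := continuous_normDet.continuousAt.comp (hcont.continuousAt hmem)
    have hpos := normDet_pos_of_injective (injective_chartDeriv h0 p hp)
    filter_upwards [hca.eventually (lt_mem_nhds hpos), hmem] with x hx hxm
    obtain ⟨A, hA⟩ := exists_chartDeriv_eq (F := Amb n) p (e.map_source hxm.2)
    have h2 := hA (c x.1) ((contMDiff_family_apply hc hxm.1).of_le (by simp))
    rw [e.left_inv hxm.2] at h2
    have hinj := injective_of_normDet_ne_zero (L := chartDeriv p (c x.1) (e x.2)) hx.ne'
    intro v w hvw
    have h3 : A.symm v = A.symm w := by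
      apply hinj
      rw [h2, h2, A.apply_symm_apply, A.apply_symm_apply, hvw]
    exact A.symm.injective h3
  simpa using h

/-- Embeddings of a compact manifold are stable under perturbations. -/
theorem eventually_isEmb (hM : IsCompactSubmanifold M) (hU : IsOpen U)
    (hc : ContMDiffOn (𝓘(ℝ, P).prod (𝓡∂ n)) 𝓘(ℝ, Amb n) ∞ (fun x : P × M => c x.1 x.2)
      (U ×ˢ univ)) {s₀ : P} (hs₀ : s₀ ∈ U) (h0 : IsEmb (c s₀)) :
    ∀ᶠ s in 𝓝 s₀, IsEmb (c s) := by
  have := hM.isManifold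
  have := hM.compactSpace
  have hinj : ∀ᶠ s in 𝓝 s₀, ∀ z ∈ (univ : Set (M × M)), c s z.1 = c s z.2 → z.1 = z.2 := by
    refine isCompact_univ.eventually_forall_of_forall_eventually fun z _ => ?_
    obtain ⟨p, q⟩ := z
    -- Double points near the diagonal of M × M are excluded by uniform local injectivity, those off
    -- the diagonal by continuity.
    by_cases hpq : p = q
    · subst hpq
      obtain ⟨W, hW, N, hN, hWN⟩ := exists_nhds_injOn hM hU hc hs₀ h0 p
      filter_upwards [prod_mem_nhds hW (prod_mem_nhds hN hN)] with x hx hab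
      exact hWN x.1 hx.1 hx.2.1 hx.2.2 hab
    · have hne : c s₀ p ≠ c s₀ q := fun h => hpq (h0.injective h)
      have hca : ∀ q : M, ContinuousAt (fun x : P × M => c x.1 x.2) (s₀, q) := fun q =>
        hc.continuousOn.continuousAt (prod_mem_nhds (hU.mem_nhds hs₀) univ_mem)
      have h1 : ContinuousAt (fun x : P × (M × M) => c x.1 x.2.1) (s₀, (p, q)) :=
        ContinuousAt.comp_of_eq (f := fun x : P × (M × M) => (x.1, x.2.1)) (hca p)
          (by fun_prop) rfl
      have h2 : ContinuousAt (fun x : P × (M × M) => c x.1 x.2.2) (s₀, (p, q)) :=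
        ContinuousAt.comp_of_eq (f := fun x : P × (M × M) => (x.1, x.2.2)) (hca q)
          (by fun_prop) rfl
      filter_upwards [(h1.ne_iff_eventually_ne h2).1 hne] with x hx heq
      exact absurd heq hx
  filter_upwards [eventually_injective_diffModel hM hU hc hs₀ h0, hinj, hU.mem_nhds hs₀]
    with s h1 h2 h3
  exact ⟨contMDiff_family_apply hc h3, fun p q hpq => h2 (p, q) (mem_univ _) hpq,
    fun p => h1 p⟩

end Stability

end Families

/-! ### One-sided directional derivatives -/

section DerivAlong

variable {n : ℕ} {M : Set (Amb n)}

theorem hasDerivAlong_of_hasDerivAt {J : (M → Amb n) → ℝ} {φ X : M → Amb n} {d : ℝ}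
    (h : HasDerivAt (fun t : ℝ => J (φ + t • X)) d 0) : HasDerivAlong J φ X d := by
  have h1 := h.tendsto_slope_zero_right
  simp only [zero_add, zero_smul, add_zero, smul_eq_mul] at h1
  exact h1.congr fun t => by rw [inv_mul_eq_div]

theorem HasDerivAlong.unique {J : (M → Amb n) → ℝ} {φ X : M → Amb n} {d d' : ℝ}
    (h : HasDerivAlong J φ X d) (h' : HasDerivAlong J φ X d') : d = d' :=
  tendsto_nhds_unique h h'

end DerivAlong

/-! ### First variation of the objective -/

section FirstVariation

variable {n : ℕ} [NeZero n] {M : Set (Amb n)} [ChartedSpace (EuclideanHalfSpace n) M]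
  {g : M → ℝ} {f : (M → Amb n) → Amb n → ℝ} {τ : (p : M) → Fin n → TangentSpace (𝓡∂ n) p}
  {τφ : (M → Amb n) → Amb n → Fin n → Amb n}

theorem eventually_isPreShape (hM : IsCompactSubmanifold M) {k : ℕ}
    {c : EuclideanSpace ℝ (Fin k) → M → Amb n}
    (hc : ContMDiff (𝓘(ℝ, EuclideanSpace ℝ (Fin k)).prod (𝓡∂ n)) 𝓘(ℝ, Amb n) ∞
      (fun x : EuclideanSpace ℝ (Fin k) × M => c x.1 x.2))
    (hbd : ∀ s, ∀ p : M, p ∈ (𝓡∂ n).boundary M → c s p = p) {s₀ : EuclideanSpace ℝ (Fin k)}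
    (h0 : IsEmb (c s₀)) : ∀ᶠ s in 𝓝 s₀, IsPreShape (c s) := by
  filter_upwards [eventually_isEmb hM isOpen_univ hc.contMDiffOn (mem_univ s₀) h0] with s hs
  exact ⟨hs, hbd s⟩

/-- The first variation of the objective functional along a smooth family of pre-shapes. -/
theorem hasFDerivAt_objective (hM : IsCompactSubmanifold M)
    (hg : ContMDiff (𝓡∂ n) 𝓘(ℝ, ℝ) ∞ g) (hf : IsTarget g f) (hτ : IsFrame τ)
    (hτφ : ∀ ψ : M → Amb n, IsPreShape ψ → IsImageFrame τ ψ (τφ ψ)) {k : ℕ}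
    {c : EuclideanSpace ℝ (Fin k) → M → Amb n}
    (hc : ContMDiff (𝓘(ℝ, EuclideanSpace ℝ (Fin k)).prod (𝓡∂ n)) 𝓘(ℝ, Amb n) ∞
      (fun x : EuclideanSpace ℝ (Fin k) × M => c x.1 x.2))
    (hbd : ∀ s, ∀ p : M, p ∈ (𝓡∂ n).boundary M → c s p = p) {s₀ : EuclideanSpace ℝ (Fin k)}
    (h0 : IsEmb (c s₀)) :
    (∀ p, DifferentiableAt ℝ (fun s => density g f (c s) p) s₀) ∧
    Continuous (fun p => fderiv ℝ (fun s => density g f (c s) p) s₀) ∧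
    HasFDerivAt (fun s => objective g f τ τφ (c s))
      (∫ p, fderiv ℝ (fun s => density g f (c s) p) s₀ ∂(surfaceMeasure M)) s₀ := by
  have := hM.isManifold
  have := hM.compactSpace
  have : IsFiniteMeasure (surfaceMeasure M) := isFiniteMeasure_inducedMeasure hM hM.inclusion
  -- Regular dependence of f is available only over an open set of parameters giving pre-shapes;
  -- stability of embeddings places s₀ in this interior.
  let U := interior {s | IsPreShape (c s)}
  have hs₀ : s₀ ∈ U := mem_interior_iff_mem_nhds.2 (eventually_isPreShape hM hc hbd h0)
  have hpre : ∀ s ∈ U, IsPreShape (c s) := fun s hs => (interior_subset hs : _)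
  have hd := contMDiffOn_density hM hg hf.dependsC1 isOpen_interior hc.contMDiffOn hpre
  obtain ⟨h1, h2⟩ := hasFDerivAt_integral_param (H := fun s p => density g f (c s) p)
    (surfaceMeasure M) isOpen_interior hd hs₀
  refine ⟨differentiableAt_param (H := fun s p => density g f (c s) p) isOpen_interior hd hs₀,
    h1, h2.congr_of_eventuallyEq ?_⟩
  filter_upwards [isOpen_interior.mem_nhds hs₀] with s hs
  exact objective_eq hM hτ (hpre s hs).isEmb (hτφ _ (hpre s hs))

/-- The scalar parameter is a vector of ℝ¹, to match the Euclidean parameter spaces of `DependsC1`.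
-/
theorem contMDiff_affine_family {φ X : M → Amb n} (hφ : ContMDiff (𝓡∂ n) 𝓘(ℝ, Amb n) ∞ φ)
    (hX : ContMDiff (𝓡∂ n) 𝓘(ℝ, Amb n) ∞ X) :
    ContMDiff (𝓘(ℝ, EuclideanSpace ℝ (Fin 1)).prod (𝓡∂ n)) 𝓘(ℝ, Amb n) ∞
      (fun x : EuclideanSpace ℝ (Fin 1) × M => φ x.2 + x.1 0 • X x.2) := by
  have h1 : ContMDiff (𝓘(ℝ, EuclideanSpace ℝ (Fin 1)).prod (𝓡∂ n)) 𝓘(ℝ, ℝ) ∞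
      (fun x : EuclideanSpace ℝ (Fin 1) × M => x.1 0) := by
    have : ContDiff ℝ ∞ fun s : EuclideanSpace ℝ (Fin 1) => s 0 := by fun_prop
    exact this.contMDiff.comp contMDiff_fst
  exact (hφ.comp contMDiff_snd).add (h1.smul (hX.comp contMDiff_snd))

/-- At a global minimizer the derivative vanishes in every smooth direction. -/
theorem hasDerivAlong_zero_of_isMin (hM : IsCompactSubmanifold M)
    (hg : ContMDiff (𝓡∂ n) 𝓘(ℝ, ℝ) ∞ g) (hf : IsTarget g f) (hτ : IsFrame τ)
    (hτφ : ∀ ψ : M → Amb n, IsPreShape ψ → IsImageFrame τ ψ (τφ ψ)) {φ X : M → Amb n}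
    (hφ : IsPreShape φ) (hX : ContMDiff (𝓡∂ n) 𝓘(ℝ, Amb n) ∞ X)
    (hXbd : ∀ p : M, p ∈ (𝓡∂ n).boundary M → X p = 0)
    (hmin : ∀ ψ : M → Amb n, IsPreShape ψ → objective g f τ τφ φ ≤ objective g f τ τφ ψ) :
    HasDerivAlong (objective g f τ τφ) φ X 0 := by
  let c : EuclideanSpace ℝ (Fin 1) → M → Amb n := fun s p => φ p + s 0 • X p
  have hc := contMDiff_affine_family hφ.isEmb.smooth hX
  have hbd : ∀ s, ∀ p : M, p ∈ (𝓡∂ n).boundary M → c s p = p := fun s p hp => by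
    simp [c, hXbd p hp, hφ.fixes_boundary p hp]
  have hc0 : c 0 = φ := by
    funext p
    simp [c]
  have h0 : IsEmb (c 0) := hc0 ▸ hφ.isEmb
  obtain ⟨-, -, hD⟩ := hasFDerivAt_objective hM hg hf hτ hτφ hc hbd h0
  have hloc : IsLocalMin (fun s => objective g f τ τφ (c s)) 0 := by
    filter_upwards [eventually_isPreShape hM hc hbd h0] with s hs
    rw [hc0]
    exact hmin _ hs
  have hD0 := hloc.hasFDerivAt_eq_zero hD
  let ℓ : ℝ → EuclideanSpace ℝ (Fin 1) := fun t => t • EuclideanSpace.single 0 1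
  have hℓ : HasDerivAt ℓ (EuclideanSpace.single 0 1) 0 := by
    simpa using (hasDerivAt_id (0 : ℝ)).smul_const (EuclideanSpace.single (0 : Fin 1) (1 : ℝ))
  have hℓ0 : ℓ 0 = 0 := zero_smul _ _
  have hcomp := HasFDerivAt.comp_hasDerivAt_of_eq (0 : ℝ) hD hℓ hℓ0.symm
  rw [hD0, zero_apply] at hcomp
  refine hasDerivAlong_of_hasDerivAt (hcomp.congr_of_eventuallyEq (Eventually.of_forall ?_))
  intro t
  change objective g f τ τφ (φ + t • X) = objective g f τ τφ (c (ℓ t))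
  congr 1
  funext p
  simp [c, ℓ]

end FirstVariation

/-! ### Smoothness of the normal part -/

section NormalPart

variable {n : ℕ} [NeZero n] {M : Set (Amb n)} [ChartedSpace (EuclideanHalfSpace n) M]

theorem contMDiff_of_chart {F : Type*} [NormedAddCommGroup F] [NormedSpace ℝ F]
    [IsManifold (𝓡∂ n) ∞ M] {k : WithTop ℕ∞} (hk : k ≤ ∞) {u : M → F}
    (h : ∀ p₀ : M, ContDiffOn ℝ k (u ∘ (extChartAt (𝓡∂ n) p₀).symm)
      (extChartAt (𝓡∂ n) p₀).target) :
    ContMDiff (𝓡∂ n) 𝓘(ℝ, F) k u := by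
  have h1 := contMDiffOn_prod_of_chart (P := ℝ) hk (U := univ) (f := fun x : ℝ × M => u x.2)
    fun p₀ => (h p₀).comp contDiffOn_snd fun y hy => hy.2
  have h2 : ContMDiff (𝓡∂ n) (𝓘(ℝ, ℝ).prod (𝓡∂ n)) k fun p : M => ((0 : ℝ), p) :=
    contMDiff_const.prodMk contMDiff_id
  exact h1.comp_contMDiff h2 fun p => ⟨mem_univ _, mem_univ _⟩

/-- L*L has the same kernel as L. Its inverse enters the formula L(L*L)⁻¹L* for the projection onto
the range. -/
theorem exists_equiv_adjoint_comp_self {E F : Type*} [NormedAddCommGroup E]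
    [InnerProductSpace ℝ E] [FiniteDimensional ℝ E] [NormedAddCommGroup F] [InnerProductSpace ℝ F]
    [FiniteDimensional ℝ F] {L : E →L[ℝ] F} (hL : Function.Injective L) :
    haveI := FiniteDimensional.complete ℝ E
    haveI := FiniteDimensional.complete ℝ F
    ∃ A : E ≃L[ℝ] E, (A : E →L[ℝ] E) = ContinuousLinearMap.adjoint L ∘L L := by
  have := FiniteDimensional.complete ℝ E
  have := FiniteDimensional.complete ℝ F
  have hinj : Function.Injective (ContinuousLinearMap.adjoint L ∘L L).toLinearMap := by
    rw [← LinearMap.ker_eq_bot, ContinuousLinearMap.ker_adjoint_comp_self]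
    exact LinearMap.ker_eq_bot.2 hL
  refine ⟨(LinearEquiv.ofInjectiveEndo _ hinj).toContinuousLinearEquiv, ?_⟩
  ext v
  simp

/-- The orthogonal projection to the orthogonal complement of the range of an injective linear
map. -/
theorem starProjection_range_orthogonal {E F : Type*} [NormedAddCommGroup E]
    [InnerProductSpace ℝ E] [FiniteDimensional ℝ E] [NormedAddCommGroup F] [InnerProductSpace ℝ F]
    [FiniteDimensional ℝ F] {L : E →L[ℝ] F} (hL : Function.Injective L) {K : Submodule ℝ F}
    (hK : K = LinearMap.range L.toLinearMap) (v : F) :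
    haveI := FiniteDimensional.complete ℝ E
    haveI := FiniteDimensional.complete ℝ F
    Kᗮ.starProjection v =
      v - L ((ContinuousLinearMap.adjoint L ∘L L).inverse (ContinuousLinearMap.adjoint L v)) := by
  have := FiniteDimensional.complete ℝ E
  have := FiniteDimensional.complete ℝ F
  obtain ⟨A, hA⟩ := exists_equiv_adjoint_comp_self hL
  subst hK
  rw [Submodule.starProjection_orthogonal, ← hA, ContinuousLinearMap.inverse_equiv]
  simp only [sub_apply, ContinuousLinearMap.id_apply]
  congr 1
  refine Submodule.eq_starProjection_of_mem_of_inner_eq_zero ⟨_, rfl⟩ ?_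
  rintro _ ⟨w, rfl⟩
  have h : A (A.symm (ContinuousLinearMap.adjoint L v)) = ContinuousLinearMap.adjoint L v :=
    A.apply_symm_apply _
  have h2 : ∀ u, A u = ContinuousLinearMap.adjoint L (L u) := fun u =>
    congrArg (fun T : E →L[ℝ] E => T u) hA
  rw [h2] at h
  change ⟪v - L _, L w⟫ = 0
  rw [← ContinuousLinearMap.adjoint_inner_left, map_sub]
  change ⟪_ - ContinuousLinearMap.adjoint L (L (A.symm (ContinuousLinearMap.adjoint L v))), w⟫ = 0
  rw [h, sub_self, inner_zero_left]

/-- In a chart the normal part of v is v − L(L*L)⁻¹L*v with L the chart derivative, and operator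
inversion is smooth. No global unit normal enters, so M may be non-orientable. -/
theorem contMDiff_normalPart (hM : IsCompactSubmanifold M) {φ : M → Amb n} (hφ : IsEmb φ)
    {V : Amb n → Amb n} (hV : ContDiff ℝ ∞ V) :
    ContMDiff (𝓡∂ n) 𝓘(ℝ, Amb n) ∞ (normalPart φ V) := by
  have := hM.isManifold
  refine contMDiff_of_chart le_rfl fun p₀ => ?_
  set e := extChartAt (𝓡∂ n) p₀
  have hD := contDiffOn_chartDeriv le_rfl (m := ∞) (by simp) hφ.smooth p₀
  have hX := hV.comp_contDiffOn (contDiffOn_comp_extChartAt_symm le_rfl hφ.smooth p₀)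
  have hadj : ContDiffOn ℝ ∞ (fun x => ContinuousLinearMap.adjoint (chartDeriv p₀ φ x))
      e.target :=
    (ContinuousLinearMap.adjoint (𝕜 := ℝ) (E := EuclideanSpace ℝ (Fin n))
      (F := Amb n)).toContinuousLinearEquiv.contDiff.comp_contDiffOn hD
  have hcomp : ContDiffOn ℝ ∞ (fun x => ContinuousLinearMap.adjoint (chartDeriv p₀ φ x) ∘L
      chartDeriv p₀ φ x) e.target := hadj.clm_comp hD
  have hinv : ContDiffOn ℝ ∞ (fun x => (ContinuousLinearMap.adjoint (chartDeriv p₀ φ x) ∘L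
      chartDeriv p₀ φ x).inverse) e.target := by
    intro x hx
    obtain ⟨A, hA⟩ := exists_equiv_adjoint_comp_self (injective_chartDeriv hφ p₀ hx)
    have h := contDiffAt_map_inverse (n := ∞) A
    rw [hA] at h
    exact h.comp_contDiffWithinAt x (hcomp x hx)
  have hfin := hX.sub (hD.clm_apply (hinv.clm_apply (hadj.clm_apply hX)))
  refine hfin.congr fun x hx => ?_
  obtain ⟨A, hA⟩ := exists_chartDeriv_eq (F := Amb n) p₀ hx
  have hrange : tangentPlane φ (e.symm x) = LinearMap.range (chartDeriv p₀ φ x).toLinearMap := by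
    ext y
    constructor
    · rintro ⟨v, rfl⟩
      refine ⟨A.symm v, ?_⟩
      exact (hA φ hφ.contMDiff_one (A.symm v)).trans
        (congrArg (diffModel φ _) (A.apply_symm_apply (v : EuclideanSpace ℝ (Fin n))))
    · rintro ⟨v, rfl⟩
      exact ⟨A v, (hA φ hφ.contMDiff_one v).symm⟩
  rw [Function.comp_apply, normalPart,
    starProjection_range_orthogonal (injective_chartDeriv hφ p₀ hx) hrange]
  rfl

end NormalPart

/-! ### Vanishing defect, minimality and stationarity -/

section GlobalMinimizers

variable {n : ℕ} [NeZero n] {M : Set (Amb n)} [ChartedSpace (EuclideanHalfSpace n) M]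
  {g : M → ℝ} {f : (M → Amb n) → Amb n → ℝ} {τ : (p : M) → Fin n → TangentSpace (𝓡∂ n) p}
  {τφ : (M → Amb n) → Amb n → Fin n → Amb n}

theorem IsDirection.comp_eq_zero {V : Amb n → Amb n} (hV : IsDirection M V) {φ : M → Amb n}
    (hφ : IsPreShape φ) {p : M} (hp : p ∈ (𝓡∂ n).boundary M) : V (φ p) = 0 := by
  rw [hφ.fixes_boundary p hp, hV.vanishes p hp]

theorem stationary_of_isMin (hM : IsCompactSubmanifold M)
    (hg : ContMDiff (𝓡∂ n) 𝓘(ℝ, ℝ) ∞ g) (hf : IsTarget g f) (hτ : IsFrame τ)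
    (hτφ : ∀ ψ : M → Amb n, IsPreShape ψ → IsImageFrame τ ψ (τφ ψ)) {φ : M → Amb n}
    (hφ : IsPreShape φ)
    (hmin : ∀ ψ : M → Amb n, IsPreShape ψ → objective g f τ τφ φ ≤ objective g f τ τφ ψ) :
    Stationary (objective g f τ τφ) φ := fun _ hV =>
  hasDerivAlong_zero_of_isMin hM hg hf hτ hτφ hφ
    (hV.smooth.contMDiff.comp hφ.isEmb.smooth) (fun _ hp => hV.comp_eq_zero hφ hp) hmin

theorem normalStationary_of_isMin (hM : IsCompactSubmanifold M)
    (hg : ContMDiff (𝓡∂ n) 𝓘(ℝ, ℝ) ∞ g) (hf : IsTarget g f) (hτ : IsFrame τ)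
    (hτφ : ∀ ψ : M → Amb n, IsPreShape ψ → IsImageFrame τ ψ (τφ ψ)) {φ : M → Amb n}
    (hφ : IsPreShape φ)
    (hmin : ∀ ψ : M → Amb n, IsPreShape ψ → objective g f τ τφ φ ≤ objective g f τ τφ ψ) :
    NormalStationary (objective g f τ τφ) φ := fun _ hV =>
  hasDerivAlong_zero_of_isMin hM hg hf hτ hτφ hφ
    (contMDiff_normalPart hM hφ.isEmb hV.smooth)
    (fun p hp => by rw [normalPart, hV.comp_eq_zero hφ hp, map_zero]) hmin

theorem isMin_of_nodeDensity_eq {φ : M → Amb n}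
    (h : ∀ s ∈ range φ, nodeDensity g τ (τφ φ) φ s = f φ s)
    (hmeas : MeasurableSet (range φ)) (ψ : M → Amb n) :
    objective g f τ τφ φ ≤ objective g f τ τφ ψ := by
  have h0 : objective g f τ τφ φ = 0 := by
    rw [objective, setIntegral_congr_fun hmeas (g := fun _ => 0), integral_zero, mul_zero]
    intro s hs
    simp [h s hs]
  rw [h0, objective]
  exact mul_nonneg (by norm_num) (integral_nonneg fun s => sq_nonneg _)

end GlobalMinimizers

/-! ### Smooth dependence of interval integrals on parameters -/

section ParametricSmooth

variable {P : Type} [NormedAddCommGroup P] [NormedSpace ℝ P]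

theorem hasFDerivAt_intervalIntegral_param {G : Type} [NormedAddCommGroup G] [NormedSpace ℝ G]
    [CompleteSpace G] {h : P × ℝ → G} (hh : ContDiff ℝ 1 h) (x₀ : P) :
    HasFDerivAt (fun x => ∫ σ in (0 : ℝ)..1, h (x, σ))
      (∫ σ in (0 : ℝ)..1, (fderiv ℝ h (x₀, σ)).comp (ContinuousLinearMap.inl ℝ P ℝ)) x₀ := by
  have hcont := hh.continuous
  have hD : Continuous fun y : P × ℝ =>
      (fderiv ℝ h y).comp (ContinuousLinearMap.inl ℝ P ℝ) :=
    (hh.continuous_fderiv (by simp)).clm_comp continuous_const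
  have hDx : ∀ x, Continuous fun σ : ℝ =>
      (fderiv ℝ h (x, σ)).comp (ContinuousLinearMap.inl ℝ P ℝ) :=
    fun x => hD.comp (by fun_prop : Continuous fun σ : ℝ => (x, σ))
  obtain ⟨C, hC⟩ := isCompact_Icc.exists_bound_of_continuousOn (hDx x₀).continuousOn
    (s := Icc (0 : ℝ) 1)
  have hnear : ∀ᶠ x in 𝓝 x₀, ∀ σ ∈ Icc (0 : ℝ) 1,
      ‖(fderiv ℝ h (x, σ)).comp (ContinuousLinearMap.inl ℝ P ℝ)‖ < C + 1 := by
    refine isCompact_Icc.eventually_forall_of_forall_eventually fun σ hσ => ?_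
    exact hD.norm.continuousAt.eventually (gt_mem_nhds ((hC σ hσ).trans_lt (lt_add_one _)))
  refine intervalIntegral.hasFDerivAt_integral_of_dominated_of_fderiv_le
    (bound := fun _ => C + 1) (F := fun x σ => h (x, σ))
    (F' := fun x σ => (fderiv ℝ h (x, σ)).comp (ContinuousLinearMap.inl ℝ P ℝ)) hnear
    (Eventually.of_forall fun x => Continuous.aestronglyMeasurable (by fun_prop))
    (Continuous.intervalIntegrable (by fun_prop) _ _) (hDx x₀).aestronglyMeasurable
    (Eventually.of_forall fun σ hσ x hx => (hx σ ?_).le) (by simp)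
    (Eventually.of_forall fun σ _ x _ => ?_)
  · rw [uIoc_of_le zero_le_one] at hσ
    exact Ioc_subset_Icc_self hσ
  · have h1 : HasFDerivAt h (fderiv ℝ h (x, σ)) (x, σ) :=
      (hh.differentiable (by simp)).differentiableAt.hasFDerivAt
    exact h1.comp x (hasFDerivAt_prodMk_left x σ)

/-- The derivative in x is again such an integral, with values in `P →L[ℝ] G`. Hence G has to vary
in the induction, within one universe. -/
theorem contDiff_intervalIntegral_nat (k : ℕ) : ∀ {G : Type} [NormedAddCommGroup G]
    [NormedSpace ℝ G] [CompleteSpace G] {h : P × ℝ → G}, ContDiff ℝ ∞ h →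
    ContDiff ℝ k (fun x => ∫ σ in (0 : ℝ)..1, h (x, σ)) := by
  induction k with
  | zero =>
    intro G _ _ _ h hh
    rw [Nat.cast_zero, contDiff_zero]
    exact intervalIntegral.continuous_parametric_intervalIntegral_of_continuous'
      (f := fun x σ => h (x, σ)) hh.continuous 0 1
  | succ k ih =>
    intro G _ _ _ h hh
    rw [Nat.cast_succ, contDiff_succ_iff_hasFDerivAt]
    refine ⟨_, ?_, fun x => hasFDerivAt_intervalIntegral_param (hh.of_le (by simp)) x⟩
    exact ih (h := fun y => (fderiv ℝ h y).comp (ContinuousLinearMap.inl ℝ P ℝ))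
      ((hh.fderiv_right (m := ∞) (by simp)).clm_comp contDiff_const)

theorem contDiff_intervalIntegral {G : Type} [NormedAddCommGroup G]
    [NormedSpace ℝ G] [CompleteSpace G] {h : P × ℝ → G} (hh : ContDiff ℝ ∞ h) :
    ContDiff ℝ ∞ (fun x => ∫ σ in (0 : ℝ)..1, h (x, σ)) :=
  contDiff_infty.2 fun k => contDiff_intervalIntegral_nat k hh

end ParametricSmooth

/-! ### Smooth difference quotients -/

section Quotient

variable {E F : Type} [NormedAddCommGroup E] [NormedSpace ℝ E] [NormedAddCommGroup F]
  [NormedSpace ℝ F]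

/-- The difference quotient `(X (x + b • w x • v) - X x) / b`, smoothly continued to `b = 0`. -/
def diffQuotient (X : E → F) (w : E → ℝ) (v : E) (y : ℝ × E) : F :=
  ∫ σ in (0 : ℝ)..1, fderiv ℝ X (y.2 + (σ * (y.1 * w y.2)) • v) (w y.2 • v)

theorem contDiff_diffQuotient [CompleteSpace F] {X : E → F} (hX : ContDiff ℝ ∞ X) {w : E → ℝ}
    (hw : ContDiff ℝ ∞ w) (v : E) : ContDiff ℝ ∞ (diffQuotient X w v) := by
  refine contDiff_intervalIntegral
    (h := fun z : (ℝ × E) × ℝ => fderiv ℝ X (z.1.2 + (z.2 * (z.1.1 * w z.1.2)) • v)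
      (w z.1.2 • v)) ?_
  have hD : ContDiff ℝ ∞ (fderiv ℝ X) := hX.fderiv_right (by simp)
  have hw' : ContDiff ℝ ∞ fun z : (ℝ × E) × ℝ => w z.1.2 := hw.comp (by fun_prop)
  exact (hD.comp (by fun_prop)).clm_apply (by fun_prop)

theorem diffQuotient_eq_zero {X : E → F} {w : E → ℝ} {v : E} {y : ℝ × E} (h : w y.2 = 0) :
    diffQuotient X w v y = 0 := by
  simp [diffQuotient, h]

theorem diffQuotient_zero [CompleteSpace F] (X : E → F) (w : E → ℝ) (v x : E) :
    diffQuotient X w v (0, x) = fderiv ℝ X x (w x • v) := by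
  simp [diffQuotient]

/-- Fundamental theorem of calculus along the segment from x to x + b w(x) v; no division by b takes
place. -/
theorem smul_diffQuotient [CompleteSpace F] {X : E → F} (hX : ContDiff ℝ ∞ X) (w : E → ℝ) (v : E)
    (b : ℝ) (x : E) :
    b • diffQuotient X w v (b, x) = X (x + (b * w x) • v) - X x := by
  have hd : ∀ σ : ℝ, HasDerivAt (fun σ : ℝ => X (x + (σ * (b * w x)) • v))
      (fderiv ℝ X (x + (σ * (b * w x)) • v) ((b * w x) • v)) σ := by
    intro σ
    have h1 : HasDerivAt (fun σ : ℝ => x + (σ * (b * w x)) • v) ((b * w x) • v) σ := by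
      simpa using (((hasDerivAt_id σ).mul_const (b * w x)).smul_const v).const_add x
    exact ((hX.differentiable (by simp)).differentiableAt.hasFDerivAt).comp_hasDerivAt σ h1
  have hc : Continuous fun σ : ℝ =>
      fderiv ℝ X (x + (σ * (b * w x)) • v) ((b * w x) • v) :=
    ((hX.continuous_fderiv (by simp)).comp (by fun_prop)).clm_apply continuous_const
  have h2 := intervalIntegral.integral_eq_sub_of_hasDerivAt (a := 0) (b := 1)
    (fun σ _ => hd σ) (hc.intervalIntegrable _ _)
  rw [diffQuotient, ← intervalIntegral.integral_smul]
  simpa [mul_smul] using h2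

end Quotient

/-! ### Cutoff and local extension -/

section Cutoff

variable {E : Type*} [NormedAddCommGroup E] [NormedSpace ℝ E] [FiniteDimensional ℝ E]
  {F : Type*} [NormedAddCommGroup F] [NormedSpace ℝ F]

omit [FiniteDimensional ℝ E] in
theorem contDiff_smul_of_tsupport_subset {k : ℕ∞} {χ : E → ℝ} (hχ : ContDiff ℝ k χ) {A : E → F}
    {Ω : Set E} (hΩ : IsOpen Ω) (hA : ContDiffOn ℝ k A Ω) (hs : tsupport χ ⊆ Ω) :
    ContDiff ℝ k (fun x => χ x • A x) := by
  rw [contDiff_iff_contDiffAt]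
  intro x
  by_cases hx : x ∈ Ω
  · exact hχ.contDiffAt.smul (hA.contDiffAt (hΩ.mem_nhds hx))
  · have h0 : (fun x => χ x • A x) =ᶠ[𝓝 x] fun _ => 0 := by
      filter_upwards [notMem_tsupport_iff_eventuallyEq.1 fun h => hx (hs h)] with y hy
      simp [hy]
    exact contDiffAt_const.congr_of_eventuallyEq h0

/-- A smooth function on an open set agrees near each point with a smooth function on the whole
space. -/
theorem exists_contDiff_eqOn_ball {k : ℕ∞} {A : E → F} {Ω : Set E} (hΩ : IsOpen Ω)
    (hA : ContDiffOn ℝ k A Ω) {x₀ : E} (hx₀ : x₀ ∈ Ω) :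
    ∃ B : E → F, ContDiff ℝ k B ∧ ∃ r > 0, EqOn B A (Metric.ball x₀ r) := by
  obtain ⟨R, hR, hRΩ⟩ := Metric.isOpen_iff.1 hΩ x₀ hx₀
  let χ : ContDiffBump x₀ := ⟨R / 4, R / 2, by positivity, by linarith⟩
  refine ⟨fun x => χ x • A x, contDiff_smul_of_tsupport_subset χ.contDiff hΩ hA ?_, R / 4,
    by positivity, fun x hx => ?_⟩
  · rw [χ.tsupport_eq]
    exact (Metric.closedBall_subset_ball (by change R / 2 < R; linarith)).trans hRΩ
  · simp [χ.one_of_mem_closedBall (Metric.ball_subset_closedBall hx)]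

end Cutoff

/-! ### Shears as diffeomorphisms -/

section Shear

variable {E : Type*} [NormedAddCommGroup E] [NormedSpace ℝ E] [FiniteDimensional ℝ E]

omit [FiniteDimensional ℝ E] in
theorem hasFDerivAt_shear {w : E → ℝ} (hw : ContDiff ℝ ∞ w) (v : E) (t : ℝ) (x : E) :
    HasFDerivAt (fun x => x + (t * w x) • v)
      (ContinuousLinearMap.id ℝ E + (t • fderiv ℝ w x).smulRight v) x := by
  have h1 : HasFDerivAt w (fderiv ℝ w x) x :=
    (hw.differentiable (by simp)).differentiableAt.hasFDerivAt
  exact (hasFDerivAt_id x).add ((h1.const_mul t).smul_const v)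

theorem det_id_add_smulRight (ℓ : E →L[ℝ] ℝ) (v : E) :
    (ContinuousLinearMap.id ℝ E + ℓ.smulRight v).det = 1 + ℓ v := by
  exact LinearMap.transvection.det ℓ.toLinearMap v

/-- For compactly supported `w` and small `t`, the map `x ↦ x + t w(x) v` is a diffeomorphism. -/
theorem eventually_exists_shear {w : E → ℝ} (hw : ContDiff ℝ ∞ w) (hs : HasCompactSupport w)
    (v : E) : ∀ᶠ t in 𝓝 (0 : ℝ), (∀ x, 0 < 1 + t * fderiv ℝ w x v) ∧
      ∃ σ : E ≃ₜ E, (∀ x, σ x = x + (t * w x) • v) ∧ ContDiff ℝ ∞ σ ∧ ContDiff ℝ ∞ σ.symm := by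
  have := FiniteDimensional.complete ℝ E
  obtain ⟨C, hC⟩ := ContDiff.lipschitzWith_of_hasCompactSupport hs hw (by simp)
  -- This number bounds both the Lipschitz distance of the shear from the identity and |t ∂_v w|.
  -- Below 1 it gives global invertibility and positive Jacobian at once.
  have hlim : Tendsto (fun t : ℝ => ‖t‖₊ * C * ‖v‖₊) (𝓝 0) (𝓝 0) := by
    have : Continuous fun t : ℝ => ‖t‖₊ * C * ‖v‖₊ := by fun_prop
    simpa using this.tendsto 0
  filter_upwards [hlim.eventually (gt_mem_nhds one_pos)] with t ht
  have hpos : ∀ x, 0 < 1 + t * fderiv ℝ w x v := by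
    intro x
    have h1 : ‖t * fderiv ℝ w x v‖ ≤ ‖t‖ * C * ‖v‖ := by
      rw [norm_mul, mul_assoc]
      gcongr
      exact (fderiv ℝ w x).le_of_opNorm_le (norm_fderiv_le_of_lipschitz ℝ hC) v
    have h2 : ‖t‖ * C * ‖v‖ < 1 := by exact_mod_cast ht
    have h3 := neg_abs_le (t * fderiv ℝ w x v)
    rw [Real.norm_eq_abs] at h1
    linarith
  refine ⟨hpos, ?_⟩
  have happ : ApproximatesLinearOn (fun x => x + (t * w x) • v)
      ((ContinuousLinearEquiv.refl ℝ E : E ≃L[ℝ] E) : E →L[ℝ] E) univ (‖t‖₊ * C * ‖v‖₊) := by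
    intro x _ y _
    have h1 : x + (t * w x) • v - (y + (t * w y) • v)
        - ((ContinuousLinearEquiv.refl ℝ E : E ≃L[ℝ] E) : E →L[ℝ] E) (x - y)
        = (t * (w x - w y)) • v := by
      simp only [ContinuousLinearEquiv.coe_coe, ContinuousLinearEquiv.refl_apply]
      module
    rw [h1, norm_smul, norm_mul]
    have h2 := hC.dist_le_mul x y
    rw [dist_eq_norm, dist_eq_norm] at h2
    push_cast
    calc ‖t‖ * ‖w x - w y‖ * ‖v‖ ≤ ‖t‖ * (C * ‖x - y‖) * ‖v‖ := by gcongr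
      _ = _ := by ring
  have hcond : Subsingleton E ∨
      ‖t‖₊ * C * ‖v‖₊ < ‖((ContinuousLinearEquiv.refl ℝ E).symm : E →L[ℝ] E)‖₊⁻¹ := by
    rcases subsingleton_or_nontrivial E with h | h
    · exact Or.inl h
    · right
      have : ‖((ContinuousLinearEquiv.refl ℝ E).symm : E →L[ℝ] E)‖₊ = 1 := by
        ext
        exact ContinuousLinearMap.norm_id
      rwa [this, inv_one]
  have hsm : ContDiff ℝ ∞ fun x => x + (t * w x) • v := by fun_prop
  refine ⟨happ.toHomeomorph _ hcond, fun x => rfl, hsm, ?_⟩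
  have hdet : ∀ x, (ContinuousLinearMap.id ℝ E + (t • fderiv ℝ w x).smulRight v).det ≠ 0 := by
    intro x
    rw [det_id_add_smulRight]
    exact (hpos x).ne'
  refine Homeomorph.contDiff_symm (happ.toHomeomorph _ hcond)
    (f₀' := fun x => ContinuousLinearMap.toContinuousLinearEquivOfDetNeZero _ (hdet x))
    (fun x => ?_) hsm
  rw [ContinuousLinearMap.coe_toContinuousLinearEquivOfDetNeZero]
  exact hasFDerivAt_shear hw v t x

end Shear

/-! ### Pointwise variation and integration by parts -/

section Variation

/-- The function is ½(γ²/m − 2γF + mF²). In the application γ, which is g times the volume density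
of the inclusion, stays fixed while m and F are transported. -/
theorem hasDerivAt_weighted_sq {m F : ℝ → ℝ} {m' F' γ t : ℝ} (hm : HasDerivAt m m' t)
    (hF : HasDerivAt F F' t) (h0 : m t ≠ 0) :
    HasDerivAt (fun s => 1 / 2 * (m s * (γ / m s - F s) ^ 2))
      (1 / 2 * m' * (F t ^ 2 - (γ / m t) ^ 2) - (γ - m t * F t) * F') t := by
  have h1 := (hm.mul ((((hasDerivAt_const t γ).div hm h0).sub hF).pow 2)).const_mul (1 / 2)
  refine h1.congr_deriv ?_
  simp only [Pi.sub_apply, Pi.div_apply, Pi.pow_apply, Nat.cast_ofNat, Nat.add_one_sub_one, pow_one]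
  field_simp
  ring

variable {E : Type*} [NormedAddCommGroup E] [NormedSpace ℝ E] [FiniteDimensional ℝ E]
  [MeasurableSpace E] [BorelSpace E] (μ : Measure E) [μ.IsAddHaarMeasure]

theorem integral_fderiv_eq_zero {u : E → ℝ} (hu : ContDiff ℝ 1 u) (hs : HasCompactSupport u)
    (v : E) : ∫ x, fderiv ℝ u x v ∂μ = 0 := by
  have hint : Integrable u μ := hu.continuous.integrable_of_hasCompactSupport hs
  have hint' : Integrable (fun x => fderiv ℝ u x v) μ :=
    ((hu.continuous_fderiv (by simp)).clm_apply continuous_const).integrable_of_hasCompactSupport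
      (hs.fderiv_apply ℝ v)
  have h := integral_mul_fderiv_eq_neg_fderiv_mul_of_integrable (μ := μ) (f := fun _ : E => (1 : ℝ))
    (g := u) (v := v) (by simp) (by simpa using hint') (by simpa using hint)
    (fun x _ => differentiableAt_const _) (fun x _ => (hu.differentiable (by simp)).differentiableAt)
  simpa using h

/-- Integration by parts in the first variation of the objective along a flow with velocity
`w • v`. -/
theorem integral_firstVariation {m a F w : E → ℝ} (hm : ContDiff ℝ 1 m) (ha : ContDiff ℝ 1 a)
    (hF : ContDiff ℝ 1 F) (hw : ContDiff ℝ 1 w) (hs : HasCompactSupport w) (v : E) :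
    ∫ x, (1 / 2 * (fderiv ℝ m x (w x • v) + m x * fderiv ℝ w x v) * (F x ^ 2 - a x ^ 2)
        - (m x * a x - m x * F x) * fderiv ℝ F x (w x • v)) ∂μ
      = ∫ x, w x • (m x * a x * fderiv ℝ (fun y => a y - F y) x v) ∂μ := by
  -- The two integrands differ exactly by ∂_v u, whose integral is zero because u has compact
  -- support.
  let u : E → ℝ := fun x => w x * (m x * (1 / 2 * (F x ^ 2 - a x ^ 2)))
  have hu : ContDiff ℝ 1 u := by fun_prop
  have hus : HasCompactSupport u := hs.mul_right
  have hint : Integrable (fun x => fderiv ℝ u x v) μ :=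
    ((hu.continuous_fderiv (by simp)).clm_apply continuous_const).integrable_of_hasCompactSupport
      (hus.fderiv_apply ℝ v)
  have hdaF : Continuous fun x => fderiv ℝ (fun y => a y - F y) x v :=
    ((ha.sub hF).continuous_fderiv (by simp)).clm_apply continuous_const
  have hint2 : Integrable (fun x => w x • (m x * a x * fderiv ℝ (fun y => a y - F y) x v)) μ := by
    refine Continuous.integrable_of_hasCompactSupport ?_ hs.smul_right
    have := hw.continuous
    have := hm.continuous
    have := ha.continuous
    fun_prop
  rw [← sub_eq_zero, ← integral_fderiv_eq_zero μ hu hus v, sub_eq_iff_eq_add,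
    ← integral_add hint hint2]
  refine integral_congr_ae (Eventually.of_forall fun x => ?_)
  have dm := (hm.differentiable (by simp) x).hasFDerivAt
  have da := (ha.differentiable (by simp) x).hasFDerivAt
  have dF := (hF.differentiable (by simp) x).hasFDerivAt
  have dw := (hw.differentiable (by simp) x).hasFDerivAt
  have du := dw.mul (dm.mul (((dF.pow 2).sub (da.pow 2)).const_mul (1 / 2)))
  have du' : fderiv ℝ u x = _ := du.fderiv
  have dd : fderiv ℝ (fun y => a y - F y) x = _ := (da.sub dF).fderiv
  simp only [du', dd, map_smul, smul_eq_mul, add_apply, smul_apply, sub_apply]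
  simp only [Pi.sub_apply, Pi.mul_apply, Nat.add_one_sub_one, pow_one]
  ring

end Variation

/-! ### Local left inverses -/

section LocalInverse

variable {E : Type*} [NormedAddCommGroup E] [NormedSpace ℝ E] [FiniteDimensional ℝ E]

/-- A smooth local left inverse near a point with invertible derivative. -/
theorem exists_contDiffOn_leftInverse {θ : E → E} (hθ : ContDiff ℝ ∞ θ) {x₀ : E}
    (h0 : fderiv ℝ θ x₀ = ContinuousLinearMap.id ℝ E) :
    ∃ κ : E → E, ∃ N W : Set E, IsOpen N ∧ x₀ ∈ N ∧ IsOpen W ∧ MapsTo θ N W ∧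
      ContDiffOn ℝ ∞ κ W ∧ ∀ x ∈ N, κ (θ x) = x := by
  have := FiniteDimensional.complete ℝ E
  have hd : HasFDerivAt θ ((ContinuousLinearEquiv.refl ℝ E : E ≃L[ℝ] E) : E →L[ℝ] E) x₀ := by
    have := (hθ.differentiable (by simp) x₀).hasFDerivAt
    rwa [h0] at this
  let Φ := hθ.contDiffAt.toOpenPartialHomeomorph θ hd (by simp)
  have hdet : Continuous fun x => (fderiv ℝ θ x).det :=
    ContinuousLinearMap.continuous_det.comp (hθ.continuous_fderiv (by simp))
  have hopen : IsOpen {x | (fderiv ℝ θ x).det ≠ 0} := isOpen_ne.preimage hdet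
  -- Restricting to points with invertible derivative makes the inverse smooth on all of W, not only
  -- at the image of x₀.
  refine ⟨Φ.symm, Φ.source ∩ {x | (fderiv ℝ θ x).det ≠ 0},
    Φ '' (Φ.source ∩ {x | (fderiv ℝ θ x).det ≠ 0}), Φ.open_source.inter hopen,
    ⟨hθ.contDiffAt.mem_toOpenPartialHomeomorph_source hd (by simp), ?_⟩,
    Φ.isOpen_image_of_subset_source (Φ.open_source.inter hopen) inter_subset_left,
    fun x hx => ⟨x, hx, rfl⟩, ?_, fun x hx => Φ.left_inv hx.1⟩
  · simp [h0, ContinuousLinearMap.det]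
  · rintro _ ⟨x, ⟨hx, hxd⟩, rfl⟩
    refine ContDiffAt.contDiffWithinAt ?_
    refine Φ.contDiffAt_symm (f₀' := ContinuousLinearMap.toContinuousLinearEquivOfDetNeZero _ hxd)
      (Φ.map_source hx) ?_ ?_
    · rw [Φ.left_inv hx, ContinuousLinearMap.coe_toContinuousLinearEquivOfDetNeZero]
      exact (hθ.differentiable (by simp) x).hasFDerivAt
    · exact hθ.contDiffAt

omit [FiniteDimensional ℝ E] in
theorem exists_leftInverse_of_injective {F : Type*} [NormedAddCommGroup F] [NormedSpace ℝ F]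
    [FiniteDimensional ℝ F] {L : E →L[ℝ] F} (hL : Function.Injective L) :
    ∃ π : F →L[ℝ] E, π ∘L L = ContinuousLinearMap.id ℝ E := by
  obtain ⟨π, hπ⟩ := L.toLinearMap.exists_leftInverse_of_injective (LinearMap.ker_eq_bot.2 hL)
  refine ⟨LinearMap.toContinuousLinearMap π, ?_⟩
  ext x
  exact LinearMap.congr_fun hπ x

end LocalInverse

/-! ### Fields supported in a chart -/

section ChartPush

variable {n : ℕ} [NeZero n] {M : Set (Amb n)} [ChartedSpace (EuclideanHalfSpace n) M]

/-- Interior points are recognized in every chart of the atlas; here the chart is centred at p₀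
rather than at p. -/
theorem notMem_boundary_of_mem_interior_target [IsManifold (𝓡∂ n) ∞ M] {p₀ p : M}
    (hp : p ∈ (extChartAt (𝓡∂ n) p₀).source)
    (h : extChartAt (𝓡∂ n) p₀ p ∈ interior (extChartAt (𝓡∂ n) p₀).target) :
    p ∉ (𝓡∂ n).boundary M := by
  have h1 : (𝓡∂ n).IsInteriorPoint p :=
    ((𝓡∂ n).isInteriorPoint_iff_of_mem_atlas (n := ∞) (by simp) (chart_mem_atlas _ p₀)
      (by rwa [extChartAt_source] at hp)).2 h
  exact ((𝓡∂ n).isInteriorPoint_iff_not_isBoundaryPoint p).1 h1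

theorem isClosed_symm_image_of_isCompact (p₀ : M)
    {K : Set (EuclideanSpace ℝ (Fin n))} (hK : IsCompact K)
    (hKT : K ⊆ (extChartAt (𝓡∂ n) p₀).target) :
    IsClosed ((extChartAt (𝓡∂ n) p₀).symm '' K) :=
  (hK.image_of_continuousOn ((continuousOn_extChartAt_symm p₀).mono hKT)).isClosed

/-- A function of the chart `extChartAt p₀`, extended by zero. -/
def chartPush {F : Type*} [Zero F] (p₀ : M) (Z : EuclideanSpace ℝ (Fin n) → F) : M → F :=
  (extChartAt (𝓡∂ n) p₀).source.indicator (Z ∘ extChartAt (𝓡∂ n) p₀)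

section

variable {F : Type*} [Zero F] {p₀ : M} {Z : EuclideanSpace ℝ (Fin n) → F}

theorem chartPush_of_mem {p : M} (hp : p ∈ (extChartAt (𝓡∂ n) p₀).source) :
    chartPush p₀ Z p = Z (extChartAt (𝓡∂ n) p₀ p) :=
  indicator_of_mem hp _

theorem chartPush_of_notMem {p : M} (hp : p ∉ (extChartAt (𝓡∂ n) p₀).source) :
    chartPush p₀ Z p = 0 :=
  indicator_of_notMem hp _

theorem chartPush_eq_zero_of_notMem_image {K : Set (EuclideanSpace ℝ (Fin n))}
    (h0 : ∀ x ∉ K, Z x = 0) {p : M} (hp : p ∉ (extChartAt (𝓡∂ n) p₀).symm '' K) :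
    chartPush p₀ Z p = 0 := by
  by_cases h : p ∈ (extChartAt (𝓡∂ n) p₀).source
  · rw [chartPush_of_mem h]
    exact h0 _ fun hk => hp ⟨_, hk, (extChartAt (𝓡∂ n) p₀).left_inv h⟩
  · exact chartPush_of_notMem h

theorem chartPush_eq_zero_of_mem_boundary [IsManifold (𝓡∂ n) ∞ M]
    (h0 : ∀ x ∉ interior (extChartAt (𝓡∂ n) p₀).target, Z x = 0) {p : M}
    (hp : p ∈ (𝓡∂ n).boundary M) : chartPush p₀ Z p = 0 := by
  by_cases h : p ∈ (extChartAt (𝓡∂ n) p₀).source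
  · rw [chartPush_of_mem h]
    exact h0 _ fun hk => notMem_boundary_of_mem_interior_target h hk hp
  · exact chartPush_of_notMem h

end

/-- Smooth on the chart domain by composition, and zero off the image of K, which is compact and
hence closed. These two open sets cover M because K lies in the target. -/
theorem contMDiff_chartPush (hM : IsCompactSubmanifold M) (p₀ : M) {P F : Type*}
    [NormedAddCommGroup P] [NormedSpace ℝ P] [NormedAddCommGroup F] [NormedSpace ℝ F]
    {Z : P × EuclideanSpace ℝ (Fin n) → F} (hZ : ContDiff ℝ ∞ Z)
    {K : Set (EuclideanSpace ℝ (Fin n))} (hK : IsCompact K)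
    (hKT : K ⊆ (extChartAt (𝓡∂ n) p₀).target) (h0 : ∀ s, ∀ x ∉ K, Z (s, x) = 0) :
    ContMDiff (𝓘(ℝ, P).prod (𝓡∂ n)) 𝓘(ℝ, F) ∞
      (fun y : P × M => chartPush p₀ (fun x => Z (y.1, x)) y.2) := by
  have := hM.isManifold
  intro y
  by_cases hy : y.2 ∈ (extChartAt (𝓡∂ n) p₀).source
  · have h1 : ContMDiffAt (𝓡∂ n) 𝓘(ℝ, EuclideanSpace ℝ (Fin n)) ∞ (extChartAt (𝓡∂ n) p₀) y.2 :=
      (contMDiffOn_extChartAt (x := p₀) (n := ∞)).contMDiffAt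
        ((chartAt _ p₀).open_source.mem_nhds (by rwa [extChartAt_source] at hy))
    have h2 : ContMDiffAt (𝓘(ℝ, P).prod (𝓡∂ n)) 𝓘(ℝ, P × EuclideanSpace ℝ (Fin n)) ∞
        (fun y : P × M => (y.1, extChartAt (𝓡∂ n) p₀ y.2)) y :=
      contMDiffAt_fst.prodMk_space (h1.comp y contMDiffAt_snd)
    refine ((hZ.contMDiff.contMDiffAt).comp y h2).congr_of_eventuallyEq ?_
    have h3 : ∀ᶠ z : P × M in 𝓝 y, z.2 ∈ (extChartAt (𝓡∂ n) p₀).source :=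
      continuous_snd.continuousAt.eventually ((isOpen_extChartAt_source p₀).mem_nhds hy)
    filter_upwards [h3] with z hz
    exact chartPush_of_mem hz
  · have h1 : y.2 ∉ (extChartAt (𝓡∂ n) p₀).symm '' K := by
      rintro ⟨x, hx, hxy⟩
      exact hy (hxy ▸ (extChartAt (𝓡∂ n) p₀).map_target (hKT hx))
    refine contMDiffAt_const.congr_of_eventuallyEq (f := fun _ => (0 : F)) ?_
    have h3 : ∀ᶠ z : P × M in 𝓝 y, z.2 ∉ (extChartAt (𝓡∂ n) p₀).symm '' K :=
      continuous_snd.continuousAt.eventually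
        ((isClosed_symm_image_of_isCompact p₀ hK hKT).isOpen_compl.mem_nhds h1)
    filter_upwards [h3] with z hz
    exact chartPush_eq_zero_of_notMem_image (h0 z.1) hz

end ChartPush

/-! ### Diffeomorphisms supported in a chart -/

section ChartConj

variable {n : ℕ} [NeZero n] {M : Set (Amb n)} [ChartedSpace (EuclideanHalfSpace n) M]

open Classical in
/-- A self-map of the chart `extChartAt p₀`, extended by the identity. -/
def chartConj (p₀ : M) (σ : EuclideanSpace ℝ (Fin n) → EuclideanSpace ℝ (Fin n)) (p : M) : M :=
  if p ∈ (extChartAt (𝓡∂ n) p₀).source then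
    (extChartAt (𝓡∂ n) p₀).symm (σ (extChartAt (𝓡∂ n) p₀ p)) else p

variable {p₀ : M} {σ σ' : EuclideanSpace ℝ (Fin n) → EuclideanSpace ℝ (Fin n)}
  {K : Set (EuclideanSpace ℝ (Fin n))}

theorem chartConj_of_mem {p : M} (hp : p ∈ (extChartAt (𝓡∂ n) p₀).source) :
    chartConj p₀ σ p = (extChartAt (𝓡∂ n) p₀).symm (σ (extChartAt (𝓡∂ n) p₀ p)) :=
  if_pos hp

theorem chartConj_of_notMem {p : M} (hp : p ∉ (extChartAt (𝓡∂ n) p₀).source) :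
    chartConj p₀ σ p = p :=
  if_neg hp

theorem chartConj_leftInverse
    (hσ : MapsTo σ (extChartAt (𝓡∂ n) p₀).target (extChartAt (𝓡∂ n) p₀).target)
    (h : Function.LeftInverse σ' σ) :
    Function.LeftInverse (chartConj p₀ σ') (chartConj p₀ σ) := by
  intro p
  by_cases hp : p ∈ (extChartAt (𝓡∂ n) p₀).source
  · have h1 := hσ ((extChartAt (𝓡∂ n) p₀).map_source hp)
    rw [chartConj_of_mem hp, chartConj_of_mem ((extChartAt (𝓡∂ n) p₀).map_target h1),
      (extChartAt (𝓡∂ n) p₀).right_inv h1, h, (extChartAt (𝓡∂ n) p₀).left_inv hp]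
  · rw [chartConj_of_notMem hp, chartConj_of_notMem hp]

theorem contMDiff_chartConj (hM : IsCompactSubmanifold M) (hσ : ContDiff ℝ ∞ σ)
    (hσT : MapsTo σ (extChartAt (𝓡∂ n) p₀).target (extChartAt (𝓡∂ n) p₀).target)
    (hK : IsCompact K) (hKT : K ⊆ (extChartAt (𝓡∂ n) p₀).target) (h0 : ∀ x ∉ K, σ x = x) :
    ContMDiff (𝓡∂ n) (𝓡∂ n) ∞ (chartConj p₀ σ) := by
  have := hM.isManifold
  intro p
  by_cases hp : p ∈ (extChartAt (𝓡∂ n) p₀).source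
  · have h1 : ContMDiffOn (𝓡∂ n) 𝓘(ℝ, EuclideanSpace ℝ (Fin n)) ∞ (extChartAt (𝓡∂ n) p₀)
        (extChartAt (𝓡∂ n) p₀).source := by
      rw [extChartAt_source]
      exact contMDiffOn_extChartAt
    have h2 : ContMDiffOn (𝓡∂ n) 𝓘(ℝ, EuclideanSpace ℝ (Fin n)) ∞
        (fun p => σ (extChartAt (𝓡∂ n) p₀ p)) (extChartAt (𝓡∂ n) p₀).source :=
      hσ.contMDiff.comp_contMDiffOn h1
    have h3 := (contMDiffOn_extChartAt_symm (I := 𝓡∂ n) (n := ∞) p₀).comp h2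
      fun q hq => hσT ((extChartAt (𝓡∂ n) p₀).map_source hq)
    have hnhds := (isOpen_extChartAt_source (I := 𝓡∂ n) p₀).mem_nhds hp
    refine (h3.contMDiffAt hnhds).congr_of_eventuallyEq ?_
    filter_upwards [hnhds] with q hq
    exact chartConj_of_mem hq
  · have h1 : p ∉ (extChartAt (𝓡∂ n) p₀).symm '' K := by
      rintro ⟨x, hx, hxy⟩
      exact hp (hxy ▸ (extChartAt (𝓡∂ n) p₀).map_target (hKT hx))
    refine contMDiffAt_id.congr_of_eventuallyEq ?_
    filter_upwards [(isClosed_symm_image_of_isCompact p₀ hK hKT).isOpen_compl.mem_nhds h1]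
      with q hq
    by_cases hqs : q ∈ (extChartAt (𝓡∂ n) p₀).source
    · rw [chartConj_of_mem hqs, h0 _ fun hk => hq ⟨_, hk, (extChartAt (𝓡∂ n) p₀).left_inv hqs⟩,
        (extChartAt (𝓡∂ n) p₀).left_inv hqs, id]
    · exact chartConj_of_notMem hqs

/-- Both σ and its inverse fix every point off K, so both preserve the chart target, and their
conjugates extend smoothly by the identity. -/
theorem exists_diffeomorph_eq_chartConj (hM : IsCompactSubmanifold M)
    (σ : EuclideanSpace ℝ (Fin n) ≃ₜ EuclideanSpace ℝ (Fin n)) (h1 : ContDiff ℝ ∞ σ)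
    (h2 : ContDiff ℝ ∞ σ.symm) (hK : IsCompact K) (hKT : K ⊆ (extChartAt (𝓡∂ n) p₀).target)
    (h0 : ∀ x ∉ K, σ x = x) :
    ∃ ρ : Diffeomorph (𝓡∂ n) (𝓡∂ n) M M ∞, ∀ p, ρ p = chartConj p₀ σ p := by
  have h0' : ∀ x ∉ K, σ.symm x = x := fun x hx => by rw [σ.symm_apply_eq, h0 x hx]
  have hm : MapsTo σ (extChartAt (𝓡∂ n) p₀).target (extChartAt (𝓡∂ n) p₀).target := by
    intro x hx
    by_cases h : σ x ∈ K
    · exact hKT h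
    · rwa [σ.injective (h0 _ h)]
  have hm' : MapsTo σ.symm (extChartAt (𝓡∂ n) p₀).target (extChartAt (𝓡∂ n) p₀).target := by
    intro x hx
    by_cases h : σ.symm x ∈ K
    · exact hKT h
    · rwa [σ.symm.injective (h0' _ h)]
  exact ⟨⟨⟨chartConj p₀ σ, chartConj p₀ σ.symm, chartConj_leftInverse hm σ.left_inv,
    chartConj_leftInverse hm' σ.right_inv⟩, contMDiff_chartConj hM h1 hm hK hKT h0,
    contMDiff_chartConj hM h2 hm' hK hKT h0'⟩, fun p => rfl⟩

end ChartConj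

/-! ### Extension of fields along φ to the ambient space -/

section Extension

variable {n : ℕ} [NeZero n] {M : Set (Amb n)} [ChartedSpace (EuclideanHalfSpace n) M]

theorem chartDeriv_eq_fderiv {F : Type*} [NormedAddCommGroup F] [NormedSpace ℝ F] {p₀ : M}
    {ψ : M → F} {X : EuclideanSpace ℝ (Fin n) → F} {x : EuclideanSpace ℝ (Fin n)}
    (hx : x ∈ interior (extChartAt (𝓡∂ n) p₀).target)
    (h : ψ ∘ (extChartAt (𝓡∂ n) p₀).symm =ᶠ[𝓝 x] X) : chartDeriv p₀ ψ x = fderiv ℝ X x := by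
  rw [chartDeriv, fderivWithin_of_mem_nhds (mem_interior_iff_mem_nhds.1 hx), h.fderiv_eq]

/-- Vector fields along an embedding which are supported near an interior point extend to the
ambient space. -/
theorem exists_extension_of_chartPush (hM : IsCompactSubmanifold M) {φ : M → Amb n}
    (hφ : IsEmb φ) (p₀ : M) {x₀ : EuclideanSpace ℝ (Fin n)}
    (hx₀ : x₀ ∈ interior (extChartAt (𝓡∂ n) p₀).target) :
    ∃ r > 0, ∀ Z : EuclideanSpace ℝ (Fin n) → Amb n, ContDiff ℝ ∞ Z →
      (∀ x ∉ Metric.ball x₀ r, Z x = 0) →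
      ∃ V : Amb n → Amb n, ContDiff ℝ ∞ V ∧ ∀ p, V (φ p) = chartPush p₀ Z p := by
  have := hM.isManifold
  have := hM.compactSpace
  set e := extChartAt (𝓡∂ n) p₀
  have hx₀T : x₀ ∈ e.target := interior_subset hx₀
  obtain ⟨X, hX, R, hR, hXeq⟩ := exists_contDiff_eqOn_ball (k := ⊤) isOpen_interior
    ((contDiffOn_comp_extChartAt_symm le_rfl hφ.smooth p₀).mono interior_subset) hx₀
  have hL : Function.Injective (fderiv ℝ X x₀) := by
    rw [← chartDeriv_eq_fderiv (ψ := φ) hx₀]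
    · exact injective_chartDeriv hφ p₀ hx₀T
    · exact (hXeq.eventuallyEq_of_mem (Metric.ball_mem_nhds x₀ hR)).symm
  -- π∘X has derivative the identity at x₀, so with its local inverse κ the map κ∘π reads the chart
  -- coordinate off an ambient point. The extension will be η · (Z∘κ∘π) with a cutoff η.
  obtain ⟨π, hπ⟩ := exists_leftInverse_of_injective hL
  have hθ : ContDiff ℝ ∞ fun x => π (X x) := π.contDiff.comp hX
  have hθ0 : fderiv ℝ (fun x => π (X x)) x₀ = ContinuousLinearMap.id ℝ _ := by
    rw [← hπ]
    exact (π.hasFDerivAt.comp x₀ (hX.differentiable (by simp) x₀).hasFDerivAt).fderiv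
  obtain ⟨κ, N, W, hN, hx₀N, hW, hNW, hκ, hκθ⟩ := exists_contDiffOn_leftInverse hθ hθ0
  let O : Set M := e.source ∩ e ⁻¹' (N ∩ Metric.ball x₀ R)
  have hO : IsOpen O := isOpen_extChartAt_preimage' p₀ (hN.inter Metric.isOpen_ball)
  -- The rest of the image is compact and misses X x₀ by injectivity of φ, so η can be chosen to
  -- vanish on it; otherwise V could be nonzero on other parts of φ(M).
  have hclosed : IsClosed (φ '' Oᶜ) :=
    (hO.isClosed_compl.isCompact.image hφ.smooth.continuous).isClosed
  have hq₀ : φ (e.symm x₀) = X x₀ := (hXeq (Metric.mem_ball_self hR)).symm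
  have hy₀ : X x₀ ∈ (φ '' Oᶜ)ᶜ ∩ π ⁻¹' W := by
    refine ⟨?_, hNW hx₀N⟩
    rintro ⟨q, hq, hqx⟩
    have hqe := hφ.injective (hqx.trans hq₀.symm)
    refine hq (hqe ▸ ⟨e.map_target hx₀T, ?_⟩)
    rw [mem_preimage, e.right_inv hx₀T]
    exact ⟨hx₀N, Metric.mem_ball_self hR⟩
  obtain ⟨δ, hδ, hδsub⟩ := Metric.isOpen_iff.1
    (hclosed.isOpen_compl.inter (hW.preimage π.continuous)) _ hy₀
  let η : ContDiffBump (X x₀) := ⟨δ / 4, δ / 2, by positivity, by linarith⟩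
  have hηs : tsupport η ⊆ (φ '' Oᶜ)ᶜ ∩ π ⁻¹' W := by
    rw [η.tsupport_eq]
    exact (Metric.closedBall_subset_ball (by change δ / 2 < δ; linarith)).trans hδsub
  have hnear : N ∩ Metric.ball x₀ R ∩ interior e.target ∩ X ⁻¹' Metric.ball (X x₀) (δ / 4) ∈ 𝓝 x₀ :=
    inter_mem (inter_mem (inter_mem (hN.mem_nhds hx₀N) (Metric.ball_mem_nhds _ hR))
      (isOpen_interior.mem_nhds hx₀))
      (hX.continuous.continuousAt (Metric.ball_mem_nhds _ (by positivity)))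
  obtain ⟨r, hr, hrsub⟩ := Metric.mem_nhds_iff.1 hnear
  refine ⟨r, hr, fun Z hZ hZ0 => ⟨fun y => η y • Z (κ (π y)), ?_, fun p => ?_⟩⟩
  · refine contDiff_smul_of_tsupport_subset (k := ⊤) η.contDiff (hW.preimage π.continuous) ?_
      (hηs.trans inter_subset_right)
    exact hZ.comp_contDiffOn (hκ.comp π.contDiff.contDiffOn fun y hy => hy)
  · change η (φ p) • Z (κ (π (φ p))) = _
    have hinO : ∀ q ∈ O, κ (π (φ q)) = e q := by
      intro q hq
      have h1 : φ q = X (e q) := by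
        rw [hXeq hq.2.2, Function.comp_apply, e.left_inv hq.1]
      rw [h1]
      exact hκθ _ hq.2.1
    by_cases hp : p ∈ e.source ∧ e p ∈ Metric.ball x₀ r
    · have h1 := hrsub hp.2
      have h2 : φ p = X (e p) := by
        rw [hXeq h1.1.1.2, Function.comp_apply, e.left_inv hp.1]
      have h3 : η (φ p) = 1 := η.one_of_mem_closedBall
        (Metric.ball_subset_closedBall (h2 ▸ h1.2))
      rw [h3, one_smul, hinO p ⟨hp.1, h1.1.1⟩]
      exact (chartPush_of_mem hp.1).symm
    · have h1 : chartPush p₀ Z p = 0 := by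
        by_cases hs : p ∈ e.source
        · rw [chartPush_of_mem hs]
          exact hZ0 _ fun h => hp ⟨hs, h⟩
        · exact chartPush_of_notMem hs
      rw [h1]
      by_cases hO' : p ∈ O
      · rw [hinO p hO', hZ0 _ fun h => hp ⟨hO'.1, h⟩, smul_zero]
      · have h2 : η (φ p) = 0 := image_eq_zero_of_notMem_tsupport fun h =>
          (hηs h).1 ⟨p, hO', rfl⟩
        rw [h2, zero_smul]

end Extension

/-! ### The two-parameter shear family -/

section ShearFamily

variable {n : ℕ} [NeZero n] {M : Set (Amb n)} [ChartedSpace (EuclideanHalfSpace n) M]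

/-- The map `X` extends the embedding `φ`, expressed in the chart `extChartAt p₀`, from the ball
`B(x₀, R)`, and `w` is a smooth function supported in that ball. -/
structure IsChartShear (φ : M → Amb n) (p₀ : M) (x₀ : EuclideanSpace ℝ (Fin n)) (R : ℝ)
    (X : EuclideanSpace ℝ (Fin n) → Amb n) (w : EuclideanSpace ℝ (Fin n) → ℝ) : Prop where
  ball_subset : Metric.ball x₀ R ⊆ interior (extChartAt (𝓡∂ n) p₀).target
  contDiff_param : ContDiff ℝ ∞ X
  eqOn : EqOn X (φ ∘ (extChartAt (𝓡∂ n) p₀).symm) (Metric.ball x₀ R)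
  contDiff_weight : ContDiff ℝ ∞ w
  tsupport_subset : tsupport w ⊆ Metric.ball x₀ R

/-- A two-parameter family of maps through `φ`: the curve `s = (t, 0)` is the perturbation of
identity in a tangential direction, and the curve `s = (t, t)` consists of reparametrizations of
`φ`. -/
def shearFamily (φ : M → Amb n) (p₀ : M) (X : EuclideanSpace ℝ (Fin n) → Amb n)
    (w : EuclideanSpace ℝ (Fin n) → ℝ) (v : EuclideanSpace ℝ (Fin n))
    (s : EuclideanSpace ℝ (Fin 2)) (p : M) : Amb n :=
  φ p + s 0 • chartPush p₀ (fun x => diffQuotient X w v (s 1, x)) p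

variable {φ : M → Amb n} {p₀ : M} {x₀ : EuclideanSpace ℝ (Fin n)} {R : ℝ}
  {X : EuclideanSpace ℝ (Fin n) → Amb n} {w : EuclideanSpace ℝ (Fin n) → ℝ}
  {v : EuclideanSpace ℝ (Fin n)}

namespace IsChartShear

theorem hasCompactSupport (h : IsChartShear φ p₀ x₀ R X w) : HasCompactSupport w :=
  Metric.isCompact_of_isClosed_isBounded (isClosed_tsupport w)
    (Metric.isBounded_ball.subset h.tsupport_subset)

theorem tsupport_subset_target (h : IsChartShear φ p₀ x₀ R X w) :
    tsupport w ⊆ (extChartAt (𝓡∂ n) p₀).target :=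
  (h.tsupport_subset.trans h.ball_subset).trans interior_subset

theorem contMDiff_shearFamily (hM : IsCompactSubmanifold M) (h : IsChartShear φ p₀ x₀ R X w)
    (hφ : IsEmb φ) (v : EuclideanSpace ℝ (Fin n)) :
    ContMDiff (𝓘(ℝ, EuclideanSpace ℝ (Fin 2)).prod (𝓡∂ n)) 𝓘(ℝ, Amb n) ∞
      (fun x : EuclideanSpace ℝ (Fin 2) × M => shearFamily φ p₀ X w v x.1 x.2) := by
  have h1 : ContMDiff (𝓘(ℝ, EuclideanSpace ℝ (Fin 2)).prod (𝓡∂ n)) 𝓘(ℝ, ℝ) ∞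
      (fun x : EuclideanSpace ℝ (Fin 2) × M => x.1 0) := by
    have : ContDiff ℝ ∞ fun s : EuclideanSpace ℝ (Fin 2) => s 0 := by fun_prop
    exact this.contMDiff.comp contMDiff_fst
  have h2 : ContDiff ℝ ∞ fun y : EuclideanSpace ℝ (Fin 2) × EuclideanSpace ℝ (Fin n) =>
      diffQuotient X w v (y.1 1, y.2) :=
    (contDiff_diffQuotient h.contDiff_param h.contDiff_weight v).comp (by fun_prop)
  have h3 := contMDiff_chartPush hM p₀ h2 h.hasCompactSupport h.tsupport_subset_target
    fun s x hx => diffQuotient_eq_zero (image_eq_zero_of_notMem_tsupport hx)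
  exact (hφ.smooth.comp contMDiff_snd).add (h1.smul h3)

theorem shearFamily_of_notMem (h : ∀ x ∉ tsupport w, w x = 0) {p : M}
    (hp : p ∉ (extChartAt (𝓡∂ n) p₀).symm '' tsupport w) (s : EuclideanSpace ℝ (Fin 2)) :
    shearFamily φ p₀ X w v s p = φ p := by
  rw [shearFamily, chartPush_eq_zero_of_notMem_image
    (fun x hx => diffQuotient_eq_zero (h x hx)) hp, smul_zero, add_zero]

theorem shearFamily_boundary (hM : IsCompactSubmanifold M) (h : IsChartShear φ p₀ x₀ R X w)
    (hφ : IsPreShape φ) (s : EuclideanSpace ℝ (Fin 2)) {p : M} (hp : p ∈ (𝓡∂ n).boundary M) :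
    shearFamily φ p₀ X w v s p = p := by
  have := hM.isManifold
  rw [shearFamily, chartPush_eq_zero_of_mem_boundary (fun x hx => diffQuotient_eq_zero
    (image_eq_zero_of_notMem_tsupport fun hx' => hx (h.ball_subset (h.tsupport_subset hx')))) hp,
    smul_zero, add_zero, hφ.fixes_boundary p hp]

theorem shearFamily_eq_left {s : EuclideanSpace ℝ (Fin 2)} (hs : s 1 = 0) :
    shearFamily φ p₀ X w v s =
      φ + s 0 • chartPush p₀ (fun x => fderiv ℝ X x (w x • v)) := by
  funext p
  simp only [shearFamily, hs, diffQuotient_zero]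
  rfl

theorem shearFamily_eq_right {s : EuclideanSpace ℝ (Fin 2)} (hs : s 0 = 0) :
    shearFamily φ p₀ X w v s = φ := by
  funext p
  rw [shearFamily, hs, zero_smul, add_zero]

section Reparametrization

variable {t : ℝ} {σ : EuclideanSpace ℝ (Fin n) ≃ₜ EuclideanSpace ℝ (Fin n)}

omit [NeZero n] in
theorem shear_eq_self (hσ : ∀ x, σ x = x + (t * w x) • v) {x : EuclideanSpace ℝ (Fin n)}
    (hx : x ∉ tsupport w) : σ x = x := by
  rw [hσ, image_eq_zero_of_notMem_tsupport hx, mul_zero, zero_smul, add_zero]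

omit [NeZero n] in
-- If σ x lay off the support, σ would fix it, and injectivity would give σ x = x.
theorem mapsTo_shear_tsupport (hσ : ∀ x, σ x = x + (t * w x) • v) :
    MapsTo σ (tsupport w) (tsupport w) := by
  intro x hx
  by_contra hc
  exact hc ((σ.injective (shear_eq_self hσ hc)).symm ▸ hx)

theorem mapsTo_shear_ball (h : IsChartShear φ p₀ x₀ R X w) (hσ : ∀ x, σ x = x + (t * w x) • v) :
    MapsTo σ (Metric.ball x₀ R) (Metric.ball x₀ R) := by
  intro x hx
  by_cases hx' : x ∈ tsupport w
  · exact h.tsupport_subset (mapsTo_shear_tsupport hσ hx')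
  · rwa [shear_eq_self hσ hx']

/-- Here t Q(t, x) = X(σ x) − X(x) telescopes with φ, since X agrees with φ in the chart at x and σ
x whenever x lies in the support. -/
theorem shearFamily_diag (h : IsChartShear φ p₀ x₀ R X w) (hσ : ∀ x, σ x = x + (t * w x) • v)
    {s : EuclideanSpace ℝ (Fin 2)} (h0 : s 0 = t) (h1 : s 1 = t) :
    shearFamily φ p₀ X w v s = φ ∘ chartConj p₀ σ := by
  funext p
  rw [shearFamily, h0, h1, Function.comp_apply]
  by_cases hp : p ∈ (extChartAt (𝓡∂ n) p₀).source
  · rw [chartPush_of_mem hp, chartConj_of_mem hp, smul_diffQuotient h.contDiff_param, ← hσ]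
    by_cases hx : extChartAt (𝓡∂ n) p₀ p ∈ tsupport w
    · have e1 := h.eqOn (h.tsupport_subset hx)
      have e2 := h.eqOn (h.tsupport_subset (mapsTo_shear_tsupport hσ hx))
      rw [Function.comp_apply, (extChartAt (𝓡∂ n) p₀).left_inv hp] at e1
      rw [Function.comp_apply] at e2
      rw [e1, e2, add_sub_cancel]
    · rw [shear_eq_self hσ hx, sub_self, add_zero, (extChartAt (𝓡∂ n) p₀).left_inv hp]
  · rw [chartPush_of_notMem hp, chartConj_of_notMem hp, smul_zero, add_zero]

theorem comp_chartConj_eventuallyEq (h : IsChartShear φ p₀ x₀ R X w)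
    (hσ : ∀ x, σ x = x + (t * w x) • v) {x : EuclideanSpace ℝ (Fin n)}
    (hx : x ∈ Metric.ball x₀ R) :
    (φ ∘ chartConj p₀ σ) ∘ (extChartAt (𝓡∂ n) p₀).symm =ᶠ[𝓝 x] X ∘ σ := by
  filter_upwards [Metric.isOpen_ball.mem_nhds hx] with y hy
  have hyT := interior_subset (h.ball_subset hy)
  rw [Function.comp_apply, Function.comp_apply, Function.comp_apply,
    chartConj_of_mem ((extChartAt (𝓡∂ n) p₀).map_target hyT),
    (extChartAt (𝓡∂ n) p₀).right_inv hyT, h.eqOn (mapsTo_shear_ball h hσ hy), Function.comp_apply]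

/-- Chain rule for X∘σ: the derivative of σ is a rank-one perturbation of the identity with
determinant 1 + t ∂_v w, and positivity removes the absolute value. -/
theorem normDet_chartDeriv_comp_chartConj (h : IsChartShear φ p₀ x₀ R X w)
    (hσ : ∀ x, σ x = x + (t * w x) • v) {x : EuclideanSpace ℝ (Fin n)}
    (hx : x ∈ Metric.ball x₀ R) (hpos : 0 < 1 + t * fderiv ℝ w x v) :
    (chartDeriv p₀ (φ ∘ chartConj p₀ σ) x).toLinearMap.normDet =
      (chartDeriv p₀ φ (σ x)).toLinearMap.normDet * (1 + t * fderiv ℝ w x v) := by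
  have hσx := mapsTo_shear_ball h hσ hx
  have hD : HasFDerivAt σ (ContinuousLinearMap.id ℝ _ + (t • fderiv ℝ w x).smulRight v) x :=
    (hasFDerivAt_shear h.contDiff_weight v t x).congr_of_eventuallyEq
      (Eventually.of_forall hσ)
  have hX : HasFDerivAt X (fderiv ℝ X (σ x)) (σ x) :=
    (h.contDiff_param.differentiable (by simp) _).hasFDerivAt
  rw [chartDeriv_eq_fderiv (h.ball_subset hx) (h.comp_chartConj_eventuallyEq hσ hx),
    (hX.comp x hD).fderiv, chartDeriv_eq_fderiv (X := X) (h.ball_subset hσx)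
      (h.eqOn.eventuallyEq_of_mem (Metric.isOpen_ball.mem_nhds hσx)).symm,
    ContinuousLinearMap.toLinearMap_comp, LinearMap.normDet_comp_of_finrank_eq _ _ rfl,
    LinearMap.normDet_eq_abs_det]
  congr 1
  have := det_id_add_smulRight (t • fderiv ℝ w x) v
  rw [ContinuousLinearMap.det] at this
  rw [this, smul_apply, smul_eq_mul, abs_of_pos hpos]

end Reparametrization

end IsChartShear

end ShearFamily

/-! ### The integrand along reparametrizations -/

section ShearVariation

variable {n : ℕ} [NeZero n] {M : Set (Amb n)} [ChartedSpace (EuclideanHalfSpace n) M]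
  {g : M → ℝ} {f : (M → Amb n) → Amb n → ℝ} {τ : (p : M) → Fin n → TangentSpace (𝓡∂ n) p}
  {τφ : (M → Amb n) → Amb n → Fin n → Amb n}
  {φ : M → Amb n} {p₀ : M} {x₀ : EuclideanSpace ℝ (Fin n)} {R : ℝ}
  {X : EuclideanSpace ℝ (Fin n) → Amb n} {w : EuclideanSpace ℝ (Fin n) → ℝ}

/-- The point `(t, t)` of the parameter plane. -/
def diagPoint (t : ℝ) : EuclideanSpace ℝ (Fin 2) :=
  t • (EuclideanSpace.single 0 1 + EuclideanSpace.single 1 1)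

theorem diagPoint_zero (t : ℝ) : diagPoint t 0 = t := by simp [diagPoint]

theorem diagPoint_one (t : ℝ) : diagPoint t 1 = t := by simp [diagPoint]

theorem continuous_diagPoint : Continuous diagPoint := by
  unfold diagPoint
  fun_prop

theorem hasDerivAt_comp_ray {G : Type*} [NormedAddCommGroup G] [NormedSpace ℝ G]
    {P : Type*} [NormedAddCommGroup P] [NormedSpace ℝ P] {J : P → G} {D : P →L[ℝ] G}
    (h : HasFDerivAt J D 0) (a : P) : HasDerivAt (fun t : ℝ => J (t • a)) (D a) 0 := by
  have hℓ : HasDerivAt (fun t : ℝ => t • a) a 0 := by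
    simpa using (hasDerivAt_id (0 : ℝ)).smul_const a
  exact HasFDerivAt.comp_hasDerivAt_of_eq (0 : ℝ) h hℓ (zero_smul _ _).symm

namespace IsChartShear

/-- For small `t`, the members `(t, t)` of a shear family are reparametrizations of `φ`. -/
theorem eventually_diag (hM : IsCompactSubmanifold M) (hf : IsTarget g f) (hφ : IsPreShape φ)
    (h : IsChartShear φ p₀ x₀ R X w) (v : EuclideanSpace ℝ (Fin n)) :
    ∀ᶠ t in 𝓝 (0 : ℝ), (∀ x, 0 < 1 + t * fderiv ℝ w x v) ∧
      ∃ σ : EuclideanSpace ℝ (Fin n) ≃ₜ EuclideanSpace ℝ (Fin n),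
        (∀ x, σ x = x + (t * w x) • v) ∧
        shearFamily φ p₀ X w v (diagPoint t) = φ ∘ chartConj p₀ σ ∧
        ContMDiff (𝓡∂ n) 𝓘(ℝ, Amb n) 1 (φ ∘ chartConj p₀ σ) ∧
        ∀ s ∈ range φ, f (φ ∘ chartConj p₀ σ) s = f φ s := by
  have h0 : IsEmb (shearFamily φ p₀ X w v (diagPoint 0)) := by
    rw [shearFamily_eq_right (diagPoint_zero 0)]
    exact hφ.isEmb
  -- Shape functionality requires φ∘ρ to be a pre-shape, which stability supplies for small t.
  have hpre := continuous_diagPoint.continuousAt.eventually (eventually_isPreShape hM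
    (h.contMDiff_shearFamily hM hφ.isEmb v) (fun s p hp => h.shearFamily_boundary hM hφ s hp) h0)
  filter_upwards [eventually_exists_shear h.contDiff_weight h.hasCompactSupport v, hpre]
    with t ⟨ht, σ, hσ, hσ1, hσ2⟩ hpre
  obtain ⟨ρ, hρ⟩ := exists_diffeomorph_eq_chartConj hM σ hσ1 hσ2 h.hasCompactSupport
    h.tsupport_subset_target fun x hx => shear_eq_self hσ hx
  have hdiag := h.shearFamily_diag hσ (diagPoint_zero t) (diagPoint_one t)
  have hρ' : φ ∘ ρ = φ ∘ chartConj p₀ σ := by rw [funext hρ]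
  rw [hdiag] at hpre
  refine ⟨ht, σ, hσ, hdiag, hpre.isEmb.contMDiff_one, ?_⟩
  rw [← hρ'] at hpre ⊢
  exact hf.shape_functionality φ hφ ρ hpre

/-- The family equals φ near p, so the Jacobian is unchanged. The value of f could still depend on φ
elsewhere; shape functionality excludes this. -/
theorem eventually_density_of_notMem (hM : IsCompactSubmanifold M) (hf : IsTarget g f)
    (hφ : IsPreShape φ) (h : IsChartShear φ p₀ x₀ R X w) (v : EuclideanSpace ℝ (Fin n)) {p : M}
    (hp : p ∉ (extChartAt (𝓡∂ n) p₀).symm '' tsupport w) :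
    ∀ᶠ t in 𝓝 (0 : ℝ),
      density g f (shearFamily φ p₀ X w v (diagPoint t)) p = density g f φ p := by
  have hw0 : ∀ x ∉ tsupport w, w x = 0 := fun x hx => image_eq_zero_of_notMem_tsupport hx
  filter_upwards [h.eventually_diag hM hf hφ v] with t ⟨_, σ, hσ, hdiag, _, hft⟩
  have hnear : shearFamily φ p₀ X w v (diagPoint t) =ᶠ[𝓝 p] φ := by
    filter_upwards [(isClosed_symm_image_of_isCompact p₀ h.hasCompactSupport
      h.tsupport_subset_target).isOpen_compl.mem_nhds hp] with q hq
    exact shearFamily_of_notMem hw0 hq _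
  have hjac : jac (shearFamily φ p₀ X w v (diagPoint t)) p = jac φ p := by
    have hD : diffModel (shearFamily φ p₀ X w v (diagPoint t)) p = diffModel φ p :=
      hnear.mfderiv_eq
    rw [jac, jac, hD]
  rw [density, density, hjac, shearFamily_of_notMem hw0 hp, hdiag, hft _ ⟨p, rfl⟩]

/-- A closed form in t, ready for `hasDerivAt_weighted_sq`: f is frozen and merely evaluated at the
sheared point. The last division passes from Lebesgue measure in the chart to the surface measure of
M. -/
theorem eventually_density_of_mem (hM : IsCompactSubmanifold M) (hf : IsTarget g f)
    (hφ : IsPreShape φ) (h : IsChartShear φ p₀ x₀ R X w) (v : EuclideanSpace ℝ (Fin n))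
    {m F : EuclideanSpace ℝ (Fin n) → ℝ}
    (hm : EqOn m (fun x => (chartDeriv p₀ φ x).toLinearMap.normDet) (Metric.ball x₀ R))
    (hF : EqOn F (fun x => f φ (φ ((extChartAt (𝓡∂ n) p₀).symm x))) (Metric.ball x₀ R))
    {x : EuclideanSpace ℝ (Fin n)} (hx : x ∈ Metric.ball x₀ R) :
    ∀ᶠ t in 𝓝 (0 : ℝ),
      density g f (shearFamily φ p₀ X w v (diagPoint t)) ((extChartAt (𝓡∂ n) p₀).symm x) =
      1 / 2 * (m (x + (t * w x) • v) * (1 + t * fderiv ℝ w x v) *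
        (g ((extChartAt (𝓡∂ n) p₀).symm x) *
          (chartDeriv p₀ (fun q : M => (q : Amb n)) x).toLinearMap.normDet /
            (m (x + (t * w x) • v) * (1 + t * fderiv ℝ w x v)) - F (x + (t * w x) • v)) ^ 2) /
        (chartDeriv p₀ (fun q : M => (q : Amb n)) x).toLinearMap.normDet := by
  have := hM.isManifold
  have hxT := interior_subset (h.ball_subset hx)
  have hι : 0 < (chartDeriv p₀ (fun q : M => (q : Amb n)) x).toLinearMap.normDet :=
    normDet_pos_of_injective (injective_chartDeriv hM.inclusion p₀ hxT)
  filter_upwards [h.eventually_diag hM hf hφ v] with t ⟨hpos, σ, hσ, hdiag, hC1, hft⟩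
  have hσx := mapsTo_shear_ball h hσ hx
  have e1 := normDet_chartDeriv_eq_jac_mul hM hC1 p₀ hxT
  rw [h.normDet_chartDeriv_comp_chartConj hσ hx (hpos x)] at e1
  have e2 := hm hσx
  have e3 := hF hσx
  simp only at e2 e3
  have e4 : (φ ∘ chartConj p₀ σ) ((extChartAt (𝓡∂ n) p₀).symm x) =
      φ ((extChartAt (𝓡∂ n) p₀).symm (σ x)) := by
    rw [Function.comp_apply, chartConj_of_mem ((extChartAt (𝓡∂ n) p₀).map_target hxT),
      (extChartAt (𝓡∂ n) p₀).right_inv hxT]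
  have hmpos : 0 < (chartDeriv p₀ φ (σ x)).toLinearMap.normDet :=
    normDet_pos_of_injective (injective_chartDeriv hφ.isEmb p₀
      (interior_subset (h.ball_subset hσx)))
  rw [hdiag, density, e4, hft _ ⟨_, rfl⟩, ← e3, ← hσ, e2, e1]
  have hj : jac (φ ∘ chartConj p₀ σ) ((extChartAt (𝓡∂ n) p₀).symm x) ≠ 0 := by
    intro h0
    rw [h0, zero_mul] at e1
    exact (mul_pos hmpos (hpos x)).ne' e1
  have := hι.ne'
  field_simp

end IsChartShear

end ShearVariation

/-! ### The weak equation for the defect -/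

section FiberVariation

variable {n : ℕ} [NeZero n] {M : Set (Amb n)} [ChartedSpace (EuclideanHalfSpace n) M]
  {g : M → ℝ} {f : (M → Amb n) → Amb n → ℝ} {τ : (p : M) → Fin n → TangentSpace (𝓡∂ n) p}
  {τφ : (M → Amb n) → Amb n → Fin n → Amb n}
  {φ : M → Amb n} {p₀ : M} {x₀ : EuclideanSpace ℝ (Fin n)} {R : ℝ}
  {X : EuclideanSpace ℝ (Fin n) → Amb n} {w : EuclideanSpace ℝ (Fin n) → ℝ}

namespace IsChartShear

theorem chartPush_mem_range (hM : IsCompactSubmanifold M) (hφ : IsEmb φ)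
    (h : IsChartShear φ p₀ x₀ R X w) (v : EuclideanSpace ℝ (Fin n)) (p : M) :
    ∃ u : TangentSpace (𝓡∂ n) p,
      diff φ p u = chartPush p₀ (fun x => fderiv ℝ X x (w x • v)) p := by
  have := hM.isManifold
  by_cases hp : p ∈ (extChartAt (𝓡∂ n) p₀).source ∧ extChartAt (𝓡∂ n) p₀ p ∈ tsupport w
  · have hx := h.tsupport_subset hp.2
    have hxT := (extChartAt (𝓡∂ n) p₀).map_source hp.1
    obtain ⟨A, hA⟩ := exists_chartDeriv_eq (F := Amb n) p₀ hxT
    have e1 := hA φ hφ.contMDiff_one (w (extChartAt (𝓡∂ n) p₀ p) • v)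
    rw [chartDeriv_eq_fderiv (X := X) (h.ball_subset hx)
      (h.eqOn.eventuallyEq_of_mem (Metric.isOpen_ball.mem_nhds hx)).symm,
      (extChartAt (𝓡∂ n) p₀).left_inv hp.1] at e1
    rw [chartPush_of_mem hp.1]
    exact ⟨_, e1.symm⟩
  · refine ⟨0, ?_⟩
    rw [map_zero]
    by_cases hs : p ∈ (extChartAt (𝓡∂ n) p₀).source
    · have hw0 : w (extChartAt (𝓡∂ n) p₀ p) = 0 :=
        image_eq_zero_of_notMem_tsupport fun hx => hp ⟨hs, hx⟩
      rw [chartPush_of_mem hs, hw0, zero_smul, map_zero]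
    · rw [chartPush_of_notMem hs]

/-- The diagonal direction is the sum of the two axes. On the first the family is φ + t V∘φ with V
tangential, on the second it is constant, so the linear derivative vanishes on the diagonal. -/
theorem exists_integral_eq_zero (hM : IsCompactSubmanifold M)
    (hg : ContMDiff (𝓡∂ n) 𝓘(ℝ, ℝ) ∞ g) (hf : IsTarget g f) (hτ : IsFrame τ)
    (hτφ : ∀ ψ : M → Amb n, IsPreShape ψ → IsImageFrame τ ψ (τφ ψ)) (hφ : IsPreShape φ)
    (hst : FiberStationary (objective g f τ τφ) φ) (h : IsChartShear φ p₀ x₀ R X w)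
    (v : EuclideanSpace ℝ (Fin n)) {V : Amb n → Amb n} (hV : ContDiff ℝ ∞ V)
    (hVφ : ∀ p, V (φ p) = chartPush p₀ (fun x => fderiv ℝ X x (w x • v)) p) :
    ∃ u : M → ℝ, Continuous u ∧
      (∀ p, HasDerivAt (fun t => density g f (shearFamily φ p₀ X w v (diagPoint t)) p) (u p) 0) ∧
      ∫ p, u p ∂(surfaceMeasure M) = 0 := by
  have := hM.isManifold
  have := hM.compactSpace
  have : IsFiniteMeasure (surfaceMeasure M) := isFiniteMeasure_inducedMeasure hM hM.inclusion
  have hc0 : shearFamily φ p₀ X w v 0 = φ := shearFamily_eq_right rfl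
  obtain ⟨hd, hcont, hD⟩ := hasFDerivAt_objective hM hg hf hτ hτφ
    (h.contMDiff_shearFamily hM hφ.isEmb v) (fun s p hp => h.shearFamily_boundary hM hφ s hp)
    (s₀ := 0) (by rw [hc0]; exact hφ.isEmb)
  set D := ∫ p, fderiv ℝ (fun s => density g f (shearFamily φ p₀ X w v s) p) 0 ∂(surfaceMeasure M)
    with hDdef
  let e : EuclideanSpace ℝ (Fin 2) := EuclideanSpace.single 0 1 + EuclideanSpace.single 1 1
  refine ⟨fun p => fderiv ℝ (fun s => density g f (shearFamily φ p₀ X w v s) p) 0 e,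
    hcont.clm_apply continuous_const, fun p => hasDerivAt_comp_ray (hd p).hasFDerivAt e, ?_⟩
  have hint : D e = ∫ p, fderiv ℝ (fun s => density g f (shearFamily φ p₀ X w v s) p) 0 e
      ∂(surfaceMeasure M) :=
    ContinuousLinearMap.integral_apply (integrable_of_continuous _ hcont) e
  rw [← hint, map_add]
  have hdir : IsDirection M V := by
    refine ⟨hV, fun p hp => ?_⟩
    have h1 := hVφ p
    rw [hφ.fixes_boundary p hp] at h1
    rw [h1]
    refine chartPush_eq_zero_of_mem_boundary (fun x hx => ?_) hp
    have hw0 : w x = 0 := image_eq_zero_of_notMem_tsupport fun hx' =>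
      hx (h.ball_subset (h.tsupport_subset hx'))
    rw [hw0, zero_smul, map_zero]
  have htan : IsTangential φ V := by
    intro p _ ν hν
    obtain ⟨u, hu⟩ := h.chartPush_mem_range hM hφ.isEmb v p
    rw [hVφ p, ← hu]
    exact hν.2 u
  have h0 : D (EuclideanSpace.single 0 1) = 0 := by
    have h1 := hasDerivAt_comp_ray hD (EuclideanSpace.single 0 1)
    have h2 : ∀ t : ℝ, shearFamily φ p₀ X w v (t • EuclideanSpace.single 0 1) =
        φ + t • (V ∘ φ) := by
      intro t
      rw [shearFamily_eq_left (by simp)]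
      funext p
      simp [hVφ]
    simp only [h2] at h1
    exact (hasDerivAlong_of_hasDerivAt h1).unique (hst V hdir htan)
  have h1 : D (EuclideanSpace.single 1 1) = 0 := by
    have h1 := hasDerivAt_comp_ray hD (EuclideanSpace.single 1 1)
    have h2 : ∀ t : ℝ, shearFamily φ p₀ X w v (t • EuclideanSpace.single 1 1) = φ := by
      intro t
      exact shearFamily_eq_right (by simp)
    simp only [h2] at h1
    exact h1.unique (hasDerivAt_const _ _)
  rw [h0, h1, add_zero]

/-- Computing u in the chart from the closed form of the diagonal density gives the integrand of
`integral_firstVariation`; outside the support of w it is zero. -/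
theorem integral_weight_eq_zero (hM : IsCompactSubmanifold M) (hf : IsTarget g f)
    (hφ : IsPreShape φ) (h : IsChartShear φ p₀ x₀ R X w)
    (v : EuclideanSpace ℝ (Fin n)) {u : M → ℝ} (hu : Continuous u)
    (hud : ∀ p,
      HasDerivAt (fun t => density g f (shearFamily φ p₀ X w v (diagPoint t)) p) (u p) 0)
    (hu0 : ∫ p, u p ∂(surfaceMeasure M) = 0) {m a F : EuclideanSpace ℝ (Fin n) → ℝ}
    (hm1 : ContDiff ℝ 1 m) (ha1 : ContDiff ℝ 1 a) (hF1 : ContDiff ℝ 1 F)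
    (hm : EqOn m (fun x => (chartDeriv p₀ φ x).toLinearMap.normDet) (Metric.ball x₀ R))
    (ha : EqOn a (fun x => g ((extChartAt (𝓡∂ n) p₀).symm x) /
      jac φ ((extChartAt (𝓡∂ n) p₀).symm x)) (Metric.ball x₀ R))
    (hF : EqOn F (fun x => f φ (φ ((extChartAt (𝓡∂ n) p₀).symm x))) (Metric.ball x₀ R)) :
    ∫ x, w x • (m x * a x * fderiv ℝ (fun y => a y - F y) x v) = 0 := by
  have := hM.isManifold
  have hw1 : ContDiff ℝ 1 w := h.contDiff_weight.of_le (by simp)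
  rw [← integral_firstVariation volume hm1 ha1 hF1 hw1 h.hasCompactSupport v]
  have hoff : ∀ p, p ∉ (extChartAt (𝓡∂ n) p₀).symm '' tsupport w → u p = 0 := fun p hp =>
    (hud p).unique ((hasDerivAt_const _ _).congr_of_eventuallyEq
      (h.eventually_density_of_notMem hM hf hφ v hp))
  have hsrc : ∀ p, p ∉ (extChartAt (𝓡∂ n) p₀).source → u p = 0 := by
    refine fun p hp => hoff p ?_
    rintro ⟨x, hx, rfl⟩
    exact hp ((extChartAt (𝓡∂ n) p₀).map_target (h.tsupport_subset_target hx))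
  have hchart := integral_chart hM hM.inclusion p₀ hu.measurable hsrc
  rw [show ∫ p, u p ∂(inducedMeasure fun p : M => (p : Amb n)) = 0 from hu0] at hchart
  have hzero : ∀ x ∉ tsupport w, 1 / 2 * (fderiv ℝ m x (w x • v) + m x * fderiv ℝ w x v) *
      (F x ^ 2 - a x ^ 2) - (m x * a x - m x * F x) * fderiv ℝ F x (w x • v) = 0 := by
    intro x hx
    have hw0 : w x = 0 := image_eq_zero_of_notMem_tsupport hx
    have hDw : fderiv ℝ w x = 0 :=
      image_eq_zero_of_notMem_tsupport (f := fderiv ℝ w) fun h' =>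
        hx (tsupport_fderiv_subset ℝ h')
    simp [hw0, hDw]
  refine (setIntegral_eq_integral_of_forall_compl_eq_zero (s := (extChartAt (𝓡∂ n) p₀).target)
    fun x hx => hzero x fun hx' => hx (h.tsupport_subset_target hx')).symm.trans
      (Eq.trans ?_ hchart.symm)
  refine (setIntegral_congr_fun (measurableSet_extChartAt_target p₀) fun x hxT => Eq.symm ?_)
  by_cases hx : x ∈ Metric.ball x₀ R
  · have hι : 0 < (chartDeriv p₀ (fun q : M => (q : Amb n)) x).toLinearMap.normDet :=
      normDet_pos_of_injective (injective_chartDeriv hM.inclusion p₀ hxT)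
    have hmpos : 0 < m x := by
      rw [hm hx]
      exact normDet_pos_of_injective (injective_chartDeriv hφ.isEmb p₀ hxT)
    have hℓ : HasDerivAt (fun t : ℝ => x + (t * w x) • v) (w x • v) 0 := by
      simpa using (((hasDerivAt_id (0 : ℝ)).mul_const (w x)).smul_const v).const_add x
    have hℓ0 : x = x + ((0 : ℝ) * w x) • v := by simp
    have hmd := HasFDerivAt.comp_hasDerivAt_of_eq (0 : ℝ)
      (hm1.differentiable (by simp) x).hasFDerivAt hℓ hℓ0
    have hFd := HasFDerivAt.comp_hasDerivAt_of_eq (0 : ℝ)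
      (hF1.differentiable (by simp) x).hasFDerivAt hℓ hℓ0
    have hlin : HasDerivAt (fun t : ℝ => 1 + t * fderiv ℝ w x v) (fderiv ℝ w x v) 0 := by
      simpa using ((hasDerivAt_id (0 : ℝ)).mul_const (fderiv ℝ w x v)).const_add 1
    have hmain := (hasDerivAt_weighted_sq
      (γ := g ((extChartAt (𝓡∂ n) p₀).symm x) *
        (chartDeriv p₀ (fun q : M => (q : Amb n)) x).toLinearMap.normDet)
      (hmd.mul hlin) hFd (by simpa using hmpos.ne')).div_const
      (chartDeriv p₀ (fun q : M => (q : Amb n)) x).toLinearMap.normDet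
    have hu' := (hud _).unique (hmain.congr_of_eventuallyEq
      (h.eventually_density_of_mem hM hf hφ v hm hF hx))
    -- Here m = jac φ · ι with ι the volume density of the inclusion, so a = g / jac φ is also gι /
    -- m.
    have hax : a x = g ((extChartAt (𝓡∂ n) p₀).symm x) *
        (chartDeriv p₀ (fun q : M => (q : Amb n)) x).toLinearMap.normDet / m x := by
      rw [ha hx, hm hx]
      simp only
      rw [normDet_chartDeriv_eq_jac_mul hM hφ.isEmb.contMDiff_one p₀ hxT,
        mul_div_mul_right _ _ hι.ne']
    have hax' : g ((extChartAt (𝓡∂ n) p₀).symm x) *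
        (chartDeriv p₀ (fun q : M => (q : Amb n)) x).toLinearMap.normDet = m x * a x := by
      rw [hax]
      field_simp
    rw [hu', mul_div_cancel₀ _ hι.ne']
    simp only [Pi.mul_apply, Function.comp_apply, zero_mul, zero_smul, add_zero, mul_one]
    rw [← hax, hax']
  · have h1 : (extChartAt (𝓡∂ n) p₀).symm x ∉ (extChartAt (𝓡∂ n) p₀).symm '' tsupport w := by
      rintro ⟨y, hy, hyx⟩
      have hyx' := (extChartAt (𝓡∂ n) p₀).symm.injOn (h.tsupport_subset_target hy) hxT hyx
      exact hx (hyx' ▸ h.tsupport_subset hy)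
    simp only [hoff _ h1, hzero x fun hx' => hx (h.tsupport_subset hx'), mul_zero]

end IsChartShear

end FiberVariation

/-! ### Vanishing derivative implies local constancy -/

section LocallyConstant

variable {n : ℕ} [NeZero n] {M : Set (Amb n)} [ChartedSpace (EuclideanHalfSpace n) M]

/-- A continuous function on a manifold with boundary whose derivative vanishes in the interiors
of all charts is locally constant. -/
theorem isLocallyConstant_of_hasFDerivAt_zero {h : M → ℝ} (hc : Continuous h)
    (hd : ∀ p₀ : M, ∀ x ∈ interior (extChartAt (𝓡∂ n) p₀).target,
      HasFDerivAt (h ∘ (extChartAt (𝓡∂ n) p₀).symm)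
        (0 : EuclideanSpace ℝ (Fin n) →L[ℝ] ℝ) x) : IsLocallyConstant h := by
  refine (IsLocallyConstant.iff_eventually_eq h).2 fun p₀ => ?_
  set e := extChartAt (𝓡∂ n) p₀
  obtain ⟨r, hr, hrT⟩ := Metric.mem_nhdsWithin_iff.1
    (extChartAt_target_mem_nhdsWithin (I := 𝓡∂ n) p₀)
  set S := Metric.ball (e p₀) r ∩ range (𝓡∂ n)
  have hconv : Convex ℝ (interior S) :=
    ((convex_ball _ _).inter (𝓡∂ n).convex_range).interior
  have hdiff : ∀ x ∈ interior S, HasFDerivAt (h ∘ e.symm)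
      (0 : EuclideanSpace ℝ (Fin n) →L[ℝ] ℝ) x := fun x hx => hd p₀ x (interior_mono hrT hx)
  have hcS : ContinuousOn (h ∘ e.symm) S :=
    hc.comp_continuousOn ((continuousOn_extChartAt_symm p₀).mono hrT)
  -- The derivative is controlled only at interior points; these are dense in the half-ball, and
  -- continuity carries constancy to the boundary.
  have hclos : S ⊆ closure (interior S) := by
    rw [interior_inter, Metric.isOpen_ball.interior_eq]
    rintro x ⟨hxb, hxr⟩
    exact Metric.isOpen_ball.inter_closure ⟨hxb, (𝓡∂ n).range_subset_closure_interior hxr⟩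
  have hp₀S : e p₀ ∈ S := ⟨Metric.mem_ball_self hr, extChartAt_target_subset_range p₀
    (mem_extChartAt_target p₀)⟩
  obtain ⟨y, hy⟩ : (interior S).Nonempty := closure_nonempty_iff.1 ⟨_, hclos hp₀S⟩
  have hconst : EqOn (h ∘ e.symm) (fun _ => (h ∘ e.symm) y) (interior S) := fun x hx =>
    isOpen_interior.is_const_of_fderiv_eq_zero hconv.isPreconnected
      (fun z hz => (hdiff z hz).differentiableAt.differentiableWithinAt)
      (fun z hz => (hdiff z hz).fderiv) hx hy
  have hconst' := hconst.of_subset_closure hcS continuousOn_const interior_subset hclos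
  have hval : ∀ q ∈ e.source ∩ e ⁻¹' Metric.ball (e p₀) r, h q = (h ∘ e.symm) y := by
    intro q hq
    have h1 := hconst' ⟨hq.2, extChartAt_target_subset_range p₀ (e.map_source hq.1)⟩
    rwa [Function.comp_apply, e.left_inv hq.1] at h1
  have hp₀ : p₀ ∈ e.source ∩ e ⁻¹' Metric.ball (e p₀) r :=
    ⟨mem_extChartAt_source p₀, Metric.mem_ball_self hr⟩
  filter_upwards [(isOpen_extChartAt_preimage' p₀ Metric.isOpen_ball).mem_nhds hp₀] with q hq
  rw [hval q hq, hval p₀ hp₀]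

end LocallyConstant

/-! ### Fiber stationarity forces zero defect -/

section FiberStationary

variable {n : ℕ} [NeZero n] {M : Set (Amb n)} [ChartedSpace (EuclideanHalfSpace n) M]
  {g : M → ℝ} {f : (M → Amb n) → Amb n → ℝ} {τ : (p : M) → Fin n → TangentSpace (𝓡∂ n) p}
  {τφ : (M → Amb n) → Amb n → Fin n → Amb n} {φ : M → Amb n}

theorem exists_contDiff_local (p₀ : M) {x₀ : EuclideanSpace ℝ (Fin n)}
    (hx₀ : x₀ ∈ interior (extChartAt (𝓡∂ n) p₀).target) {F : Type*} [NormedAddCommGroup F]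
    [NormedSpace ℝ F] {A : EuclideanSpace ℝ (Fin n) → F}
    (hA : ContDiffOn ℝ ∞ A (extChartAt (𝓡∂ n) p₀).target) :
    ∃ B : EuclideanSpace ℝ (Fin n) → F, ContDiff ℝ ∞ B ∧
      ∃ r > 0, EqOn B A (Metric.ball x₀ r) :=
  exists_contDiff_eqOn_ball (k := ⊤) isOpen_interior (hA.mono interior_subset) hx₀

/-- Fundamental lemma of the calculus of variations; continuity upgrades almost everywhere to
everywhere on the open set. -/
theorem eqOn_zero_of_integral_weight_eq_zero {E : Type*} [NormedAddCommGroup E] [NormedSpace ℝ E]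
    [FiniteDimensional ℝ E] [MeasurableSpace E] [BorelSpace E] (μ : Measure E)
    [μ.IsAddHaarMeasure] {U : Set E} (hU : IsOpen U) {u : E → ℝ} (hu : Continuous u)
    (h : ∀ w : E → ℝ, ContDiff ℝ ∞ w → tsupport w ⊆ U → HasCompactSupport w →
      ∫ x, w x • u x ∂μ = 0) : ∀ x ∈ U, u x = 0 := by
  have hae := hU.ae_eq_zero_of_integral_contDiff_smul_eq_zero
    (hu.locallyIntegrable.locallyIntegrableOn U) fun w h1 h2 h3 => h w h1 h3 h2
  have h2 : u =ᵐ[μ.restrict U] fun _ => 0 := (ae_restrict_iff' hU.measurableSet).2 hae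
  exact Measure.eqOn_open_of_ae_eq h2 hU hu.continuousOn continuousOn_const

/-- Fiber stationarity forces the defect `g / jac φ - f φ ∘ φ` to have vanishing derivative. -/
theorem FiberStationary.hasFDerivAt_zero (hM : IsCompactSubmanifold M)
    (hg : ContMDiff (𝓡∂ n) 𝓘(ℝ, ℝ) ∞ g) (hg_pos : ∀ p, 0 < g p) (hf : IsTarget g f)
    (hτ : IsFrame τ) (hτφ : ∀ ψ : M → Amb n, IsPreShape ψ → IsImageFrame τ ψ (τφ ψ))
    (hφ : IsPreShape φ) (hst : FiberStationary (objective g f τ τφ) φ) (p₀ : M)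
    {x₀ : EuclideanSpace ℝ (Fin n)} (hx₀ : x₀ ∈ interior (extChartAt (𝓡∂ n) p₀).target) :
    HasFDerivAt ((fun p => g p / jac φ p - f φ (φ p)) ∘ (extChartAt (𝓡∂ n) p₀).symm)
      (0 : EuclideanSpace ℝ (Fin n) →L[ℝ] ℝ) x₀ := by
  have := hM.isManifold
  have hcm : ContDiffOn ℝ ∞ (fun x => (chartDeriv p₀ φ x).toLinearMap.normDet)
      (extChartAt (𝓡∂ n) p₀).target := fun x hx =>
    (contDiffAt_normDet (injective_chartDeriv hφ.isEmb p₀ hx)).comp_contDiffWithinAt x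
      (contDiffOn_chartDeriv le_rfl (m := ∞) (by simp) hφ.isEmb.smooth p₀ x hx)
  have hca : ContDiffOn ℝ ∞ (fun x => g ((extChartAt (𝓡∂ n) p₀).symm x) /
      jac φ ((extChartAt (𝓡∂ n) p₀).symm x)) (extChartAt (𝓡∂ n) p₀).target :=
    (contDiffOn_comp_extChartAt_symm le_rfl hg p₀).div
      (contDiffOn_comp_extChartAt_symm le_rfl (contMDiff_jac hM hφ.isEmb) p₀)
      fun x _ => (jac_pos hM hφ.isEmb _).ne'
  obtain ⟨r₀, hr₀, hext⟩ := exists_extension_of_chartPush hM hφ.isEmb p₀ hx₀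
  obtain ⟨r₁, hr₁, hT⟩ := Metric.isOpen_iff.1 isOpen_interior x₀ hx₀
  obtain ⟨X, hX, r₂, hr₂, hXeq⟩ := exists_contDiff_local p₀ hx₀
    (contDiffOn_comp_extChartAt_symm le_rfl hφ.isEmb.smooth p₀)
  obtain ⟨m, hm, r₃, hr₃, hmeq⟩ := exists_contDiff_local p₀ hx₀ hcm
  obtain ⟨a, ha, r₄, hr₄, haeq⟩ := exists_contDiff_local p₀ hx₀ hca
  obtain ⟨F, hF, r₅, hr₅, hFeq⟩ := exists_contDiff_local p₀ hx₀
    (contDiffOn_comp_extChartAt_symm le_rfl (hf.smooth φ hφ) p₀)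
  -- One radius on which the ball lies in the chart interior, all smooth extensions agree with the
  -- given functions, and fields extend to the ambient space.
  obtain ⟨R, hR, h0, h1, h2, h3, h4, h5⟩ : ∃ R > 0, R ≤ r₀ ∧ R ≤ r₁ ∧ R ≤ r₂ ∧ R ≤ r₃ ∧
      R ≤ r₄ ∧ R ≤ r₅ :=
    ⟨min r₀ (min r₁ (min r₂ (min r₃ (min r₄ r₅)))), by positivity, by simp, by simp, by simp,
      by simp, by simp, by simp⟩
  have hmR := hmeq.mono (Metric.ball_subset_ball (x := x₀) h3)
  have haR := haeq.mono (Metric.ball_subset_ball (x := x₀) h4)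
  have hFR := hFeq.mono (Metric.ball_subset_ball (x := x₀) h5)
  have hd1 : ContDiff ℝ 1 fun y => a y - F y := (ha.sub hF).of_le (by simp)
  have key : ∀ v : EuclideanSpace ℝ (Fin n), ∀ x ∈ Metric.ball x₀ R,
      m x * a x * fderiv ℝ (fun y => a y - F y) x v = 0 := by
    intro v
    refine eqOn_zero_of_integral_weight_eq_zero volume Metric.isOpen_ball
      ((hm.continuous.mul ha.continuous).mul
        ((hd1.continuous_fderiv (by simp)).clm_apply continuous_const)) fun w hw hws _ => ?_
    have hsh : IsChartShear φ p₀ x₀ R X w :=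
      ⟨(Metric.ball_subset_ball h1).trans hT, hX, hXeq.mono (Metric.ball_subset_ball h2), hw, hws⟩
    obtain ⟨V, hV, hVφ⟩ := hext (fun x => fderiv ℝ X x (w x • v))
      ((hX.fderiv_right (m := ∞) (by simp)).clm_apply (hw.smul contDiff_const)) fun x hx => by
        have hw0 : w x = 0 := image_eq_zero_of_notMem_tsupport fun hx' =>
          hx (Metric.ball_subset_ball h0 (hws hx'))
        rw [hw0, zero_smul, map_zero]
    obtain ⟨u, hu, hud, hu0⟩ := hsh.exists_integral_eq_zero hM hg hf hτ hτφ hφ hst v hV hVφ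
    exact hsh.integral_weight_eq_zero hM hf hφ v hu hud hu0 (hm.of_le (by simp))
      (ha.of_le (by simp)) (hF.of_le (by simp)) hmR haR hFR
  have hx₀R : x₀ ∈ Metric.ball x₀ R := Metric.mem_ball_self hR
  have hmpos : m x₀ ≠ 0 := by
    rw [hmR hx₀R]
    exact (normDet_pos_of_injective
      (injective_chartDeriv hφ.isEmb p₀ (interior_subset hx₀))).ne'
  have hapos : a x₀ ≠ 0 := by
    rw [haR hx₀R]
    exact (div_pos (hg_pos _) (jac_pos hM hφ.isEmb _)).ne'
  have hfd : fderiv ℝ (fun y => a y - F y) x₀ = 0 := by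
    ext v
    exact (mul_eq_zero.1 (key v x₀ hx₀R)).resolve_left (mul_ne_zero hmpos hapos)
  have hfin := (hd1.differentiable (by simp) x₀).hasFDerivAt
  rw [hfd] at hfin
  refine hfin.congr_of_eventuallyEq ?_
  filter_upwards [Metric.ball_mem_nhds x₀ hR] with x hx
  rw [haR hx, hFR hx]
  rfl

/-- Connectedness makes the defect constant. Its integral against the positive weight `jac φ` is ∫ g
− ∫ jac φ · F, zero by normalization, so the constant is zero. -/
theorem FiberStationary.div_jac_eq (hM : IsCompactSubmanifold M)
    (hg : ContMDiff (𝓡∂ n) 𝓘(ℝ, ℝ) ∞ g) (hg_pos : ∀ p, 0 < g p) (hf : IsTarget g f)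
    (hτ : IsFrame τ) (hτφ : ∀ ψ : M → Amb n, IsPreShape ψ → IsImageFrame τ ψ (τφ ψ))
    (hφ : IsPreShape φ) (hst : FiberStationary (objective g f τ τφ) φ) (p : M) :
    g p / jac φ p = f φ (φ p) := by
  have := hM.isManifold
  have := hM.compactSpace
  have : IsFiniteMeasure (surfaceMeasure M) := isFiniteMeasure_inducedMeasure hM hM.inclusion
  have : PathConnectedSpace M := isPathConnected_iff_pathConnectedSpace.1 hM.pathConnected
  have hpos := jac_pos hM hφ.isEmb
  have hjc : Continuous (jac φ) := (contMDiff_jac hM hφ.isEmb).continuous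
  have hfc : Continuous fun p => f φ (φ p) := (hf.smooth φ hφ).continuous
  have hloc := isLocallyConstant_of_hasFDerivAt_zero
    (h := fun p => g p / jac φ p - f φ (φ p))
    ((hg.continuous.div hjc fun p => (hpos p).ne').sub hfc)
    fun p₀ x hx => hst.hasFDerivAt_zero hM hg hg_pos hf hτ hτφ hφ p₀ hx
  have hconst : ∀ q, g q - jac φ q * f φ (φ q) = jac φ q * (g p / jac φ p - f φ (φ p)) := by
    intro q
    rw [← hloc.apply_eq_of_preconnectedSpace q p]
    have := (hpos q).ne'
    field_simp
  have hjfc : Continuous fun q => jac φ q * f φ (φ q) := hjc.mul hfc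
  have hint : ∫ q, (g q - jac φ q * f φ (φ q)) ∂(surfaceMeasure M) = 0 := by
    rw [integral_sub (integrable_of_continuous _ hg.continuous)
      (integrable_of_continuous _ hjfc), integral_target_eq hM hf hφ, sub_self]
  simp only [hconst, integral_mul_const] at hint
  have hne : surfaceMeasure M ≠ 0 := inducedMeasure_ne_zero hM hM.inclusion
  have hjpos : 0 < ∫ q, jac φ q ∂(surfaceMeasure M) := by
    rw [integral_pos_iff_support_of_nonneg (fun q => (hpos q).le) (integrable_of_continuous _ hjc),
      Function.support_eq_univ fun q => (hpos q).ne']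
    exact pos_iff_ne_zero.2 fun h => hne (Measure.measure_univ_eq_zero.1 h)
  exact sub_eq_zero.1 ((mul_eq_zero.1 hint).resolve_left hjpos.ne')

theorem FiberStationary.nodeDensity_eq (hM : IsCompactSubmanifold M)
    (hg : ContMDiff (𝓡∂ n) 𝓘(ℝ, ℝ) ∞ g) (hg_pos : ∀ p, 0 < g p) (hf : IsTarget g f)
    (hτ : IsFrame τ) (hτφ : ∀ ψ : M → Amb n, IsPreShape ψ → IsImageFrame τ ψ (τφ ψ))
    (hφ : IsPreShape φ) (hst : FiberStationary (objective g f τ τφ) φ) :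
    ∀ s ∈ range φ, nodeDensity g τ (τφ φ) φ s = f φ s := by
  rintro _ ⟨p, rfl⟩
  rw [nodeDensity_apply hM hτ hφ.isEmb (hτφ φ hφ)]
  exact hst.div_jac_eq hM hg hg_pos hf hτ hτφ hφ p

end FiberStationary

end PreShape

end

theorem proposition2p3 {n : ℕ} [NeZero n] {M : Set (PreShape.Amb n)}
    [ChartedSpace (EuclideanHalfSpace n) M] (hM : PreShape.IsCompactSubmanifold M)
    (g : M → ℝ) (hg : ContMDiff (𝓡∂ n) 𝓘(ℝ, ℝ) ∞ g) (hg_pos : ∀ p, 0 < g p)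
    (f : (M → PreShape.Amb n) → PreShape.Amb n → ℝ) (hf : PreShape.IsTarget g f)
    (τ : (p : M) → Fin n → TangentSpace (𝓡∂ n) p) (hτ : PreShape.IsFrame τ)
    (τφ : (M → PreShape.Amb n) → PreShape.Amb n → Fin n → PreShape.Amb n)
    (hτφ : ∀ ψ : M → PreShape.Amb n, PreShape.IsPreShape ψ →
      PreShape.IsImageFrame τ ψ (τφ ψ))
    (φ : M → PreShape.Amb n) (hφ : PreShape.IsPreShape φ) :
    [ -- (i) fiber stationarity
      PreShape.FiberStationary (PreShape.objective g f τ τφ) φ,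
      -- (ii) global solution of the parameterization tracking problem
      ∀ ψ : M → PreShape.Amb n, PreShape.IsPreShape ψ →
        PreShape.objective g f τ τφ φ ≤ PreShape.objective g f τ τφ ψ,
      -- (ii) in its explicit form
      ∀ s ∈ range φ, PreShape.nodeDensity g τ (τφ φ) φ s = f φ s,
      -- (iii) full stationarity, and vanishing normal component
      PreShape.Stationary (PreShape.objective g f τ τφ) φ ∧
        PreShape.NormalStationary (PreShape.objective g f τ τφ) φ ].TFAE := by
  tfae_have 1 → 3 := fun h => h.nodeDensity_eq hM hg hg_pos hf hτ hτφ hφ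
  tfae_have 3 → 2 := fun h ψ _ => PreShape.isMin_of_nodeDensity_eq h
    (hφ.isEmb.measurableEmbedding hM).measurableSet_range ψ
  tfae_have 2 → 4 := fun h => ⟨PreShape.stationary_of_isMin hM hg hf hτ hτφ hφ h,
    PreShape.normalStationary_of_isMin hM hg hf hτ hτφ hφ h⟩
  tfae_have 4 → 1 := fun h V hV _ => h.1 V hV
  tfae_finish
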